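/- **Setting.** Fix $p\in\mathbb N$. Let $t\to\infty$ index a sequence of designs: at stage $t$ there are $m=m_t$ clusters, cluster $i\le m$ has $n_i=n_{t,i}$ measurements with covariates $x_{ij}=x_{t,ij}\in\mathbb R^p$, used for both the fixed and the random effects. Put $X_i=[x_{i1},\dots,x_{in_i}]^\top$, $N=\sum_{i\le m}n_i$, $n=N/m$, $n_L=\min_{i\le m} n_i$. Assume $m\to\infty$, $n_L\to\infty$, $m/n_L\to0$ and $n_i=O(n_L)$ uniformly in $i\le m$. Let $a$ be a function on an open interval $D\subseteq\mathbb R$, $\dot\phi>0$, and let $f(y\mid\eta,\phi)=\exp[\phi^{-1}\{y\eta-a(\eta)\}+c(y,\phi)]$, where $f(\cdot\mid\eta,\dot\phi)$ is a probability density with respect to a fixed measure $\nu$ for every $\eta\in D$. Let $\dot\beta\in\mathbb R^p$, and let $\dot b_1,\dot b_2,\dots\in\mathbb R^p$ be the (realised, given) true random effects. Conditionally on them the responses $y_{ij}$ of stage $t$ are independent, $y_{ij}$ having density $f(\cdot\mid\dot\eta_{ij},\dot\phi)$ with $\dot\eta_{ij}=x_{ij}^\top\dot\beta+x_{ij}^\top\dot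 b_i$; all probabilities below are conditional on $(\dot b_i)$. Let $\dot\mu_{ij}=a'(\dot\eta_{ij})$ and $\dot\theta=(\dot\beta^\top,\dot b_1^\top,\dots,\dot b_m^\top)^\top$. Given a working matrix $\hat G$ and working dispersion $\hat\phi$ (random, possibly depending on the data), the PQL estimator $\hat\theta=(\hat\beta^\top,\hat b_1^\top,\dots,\hat b_m^\top)^\top$ is a random vector which, with probability tending to one, maximises $$Q(\theta)=\sum_{i=1}^m\sum_{j=1}^{n_i}\ln f(y_{ij}\mid x_{ij}^\top\beta+x_{ij}^\top b_i,\hat\phi)-\tfrac12\sum_{i=1}^m b_i^\top\hat G^{-1}b_i$$ over all $\theta=(\beta,b_1,\dots,b_m)$ whose linear predictors lie in $D$ (all $\theta$, if $D=\mathbb R$). Write $\dot W_i(\phi)=\phi^{-1}\mathrm{diag}\{a''(\dot\eta_{i1}),\dots,a''(\dot\eta_{in_i})\}$ and $\dot H_i=\{n_i^{-1}X_i^\top\dot W_i(\dot\phi)X_i\}^{-1}$. **Conditions.** * (C1) $a$ is three times continuously differentiable on $D$, and for some $c_0>0$: $c_0\le a''\le c_0^{-1}$ and $|a'''|\le c_0^{-1}$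 on $D$. * (C2) The $\|x_{ij}\|_\infty$ are bounded by a constant. As $t\to\infty$, $\dot H_i\to\dot K_i$ for each $i$ and $m^{-1}\sum_{i=1}^m n n_i^{-1}\dot H_i\to\dot K$. For some $c_1>0$ the eigenvalues of $\dot K$, of all $\dot K_i$ and, for all large $t$, of all $\dot H_i$, $i\le m$, lie in $[c_1,c_1^{-1}]$. * (C3) For some $\varepsilon>0$, $(\dot\eta_{ij}-\varepsilon,\dot\eta_{ij}+\varepsilon)\subseteq D$ for all $t$, $i\le m$, $j\le n_i$; and $\sup_{M\ge1}M^{-1}\sum_{i=1}^M\|\dot b_i\|<\infty$. * (C4) $\hat G$ is positive definite with $\hat G^{-1}=O_p(1)$; $\hat\phi>0$ and $\hat\phi=O_p(1)$. * (C5) For all $t$ and $i\le m$, each component of $n_i^{1/2}\{X_i^\top\dot W_i(\hat\phi)X_i+\hat G^{-1}\}^{-1}\{\hat\phi^{-1}X_i^\top(y_i-\dot\mu_i)-\hat G^{-1}\dot b_i\}$ has a finite fourth moment. **Finite selection.** $A=A_t$ is a $q\times(m+1)p$ matrix ($q$ fixed), written $[A^{(0)},A^{(1)},\dots,A^{(m)}]$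 with $q\times p$ blocks, such that for each row there is $m_0$ with that row of $A^{(i)}$ zero for all $i>m_0$ whenever $m>m_0$, and such that $A^{(i)}\to L_i$ componentwise for each $i\ge0$, with some $L_i\ne0$. **Theorem.** Let the growth assumptions and (C1) hold. If $D=\mathbb R$ and $\dot b_1,\dot b_2,\dots$ are i.i.d. $N(0,\dot G)$ with $\dot G$ positive semidefinite, then almost every realisation $(\dot b_i)$ satisfies (C3). For every sequence $(\dot b_i)$ for which (C2)–(C5) hold, put $\dot\theta^*=\dot\theta-(-1,1,\dots,1)^\top\otimes m^{-1}\sum_{i=1}^m\dot b_i$, i.e. $\dot\theta^*$ has fixed effects $\dot\beta+m^{-1}\sum_{i}\dot b_i$ and random effects $\dot b_i-m^{-1}\sum_{i'}\dot b_{i'}$. Then, conditionally on $(\dot b_i)$ and as $t\to\infty$: (a) $\|\hat\theta-\dot\theta^*\|_\infty=o_p(1)$. (b) For every $A$ with the finite selection property, with $\mathcal D=\mathrm{bdiag}(N^{1/2}I_p,n_1^{1/2}I_p,\dots,n_m^{1/2}I_p)$, the limit $$\Omega=\lim_{t\to\infty}A\,\mathrm{bdiag}\Big\{\tfrac1m\sum_{i=1}^m\tfrac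 n{n_i}\dot H_i,\ \dot H_1,\dots,\dot H_m\Big\}A^\top$$ exists, is positive semidefinite, and equals $L_0\dot KL_0^\top+\sum_{i\ge1}L_i\dot K_iL_i^\top$ (so fixed effects and the different clusters are asymptotically independent), and $$A\,\mathcal D\,(\hat\theta-\dot\theta^*)\ \xrightarrow{D}\ N(0,\Omega).$$ -/

import Mathlib

open MeasureTheory ProbabilityTheory Filter Topology Matrix

noncomputable section

namespace PQL

/-- A one-parameter exponential dispersion family at its true dispersion parameter `φ`: for every
canonical parameter `η` in the open interval `dom`, the function
`y ↦ exp (φ⁻¹ (y η - a η) + c y φ)` is a probability density with respect to `ν`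
(for instance Lebesgue or counting measure). Values of `a` outside `dom` are irrelevant. -/
structure ExpFamily where
  dom : Set ℝ
  a : ℝ → ℝ
  c : ℝ → ℝ → ℝ
  ν : Measure ℝ
  φ : ℝ
  isOpen_dom : IsOpen dom
  convex_dom : Convex ℝ dom
  φ_pos : 0 < φ
  measurable_c : Measurable fun y => c y φ
  normalized : ∀ η ∈ dom, ∫⁻ y, ENNReal.ofReal (Real.exp (φ⁻¹ * (y * η - a η) + c y φ)) ∂ν = 1

/-- The log-density `ln f(y | η, φ)`, with the dispersion parameter left free. -/
def ExpFamily.logDensity (F : ExpFamily) (φ η y : ℝ) : ℝ :=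
  φ⁻¹ * (y * η - F.a η) + F.c y φ

/-- The distribution of a response with canonical parameter `η` and the true dispersion. -/
def ExpFamily.law (F : ExpFamily) (η : ℝ) : Measure ℝ :=
  F.ν.withDensity fun y => ENNReal.ofReal (Real.exp (F.logDensity F.φ η y))

/-- Mean function `a'`. -/
def ExpFamily.mean (F : ExpFamily) (η : ℝ) : ℝ := deriv F.a η

/-- An asymptotic sequence of designs, indexed by `t`: at stage `t` there are `m t` clusters, cluster
`i < m t` has `n t i` measurements, and `x t i j`, `j < n t i`, are the covariate vectors, used both
for the fixed and for the random effects. -/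
structure Design (p : ℕ) where
  m : ℕ → ℕ
  n : ℕ → ℕ → ℕ
  x : ℕ → ℕ → ℕ → Fin p → ℝ

/-- Parameter vectors `θ = (β, b₁, …, b_m)` of length `(m + 1) p`: the coordinate `(k, none)` is the
`k`-th fixed effect, the coordinate `(k, some i)` is the `k`-th random effect of cluster `i`. The
norm of this type is the maximum norm. -/
abbrev Param (p m : ℕ) : Type := Fin p × Option (Fin m) → ℝ

def Param.fixed {p m : ℕ} (θ : Param p m) : Fin p → ℝ := fun k => θ (k, none)

def Param.random {p m : ℕ} (θ : Param p m) (i : Fin m) : Fin p → ℝ := fun k => θ (k, some i)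

section Setup

variable {p : ℕ} (d : Design p) (F : ExpFamily) (β : Fin p → ℝ)
  (b : ℕ → EuclideanSpace ℝ (Fin p))

/-- Smallest cluster size `n_L`. -/
def Design.nL (t : ℕ) : ℕ := ⨅ i : Fin (d.m t), d.n t i

/-- Total sample size `N`. -/
def Design.N (t : ℕ) : ℕ := ∑ i : Fin (d.m t), d.n t i

/-- Average cluster size `N / m`. -/
def Design.nbar (t : ℕ) : ℝ := (d.N t : ℝ) / (d.m t : ℝ)

/-- The design matrix of cluster `i`. -/
def Design.X (t i : ℕ) : Matrix (Fin (d.n t i)) (Fin p) ℝ := Matrix.of fun j => d.x t i j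

/-- The growth regime `m → ∞`, `n_L → ∞`, `m / n_L → 0`, `n_i = O(n_L)` uniformly in `i`. -/
structure Design.Regime : Prop where
  m_tendsto : Tendsto d.m atTop atTop
  nL_tendsto : Tendsto d.nL atTop atTop
  ratio : Tendsto (fun t => (d.m t : ℝ) / (d.nL t : ℝ)) atTop (𝓝 0)
  balanced : ∃ C : ℝ, ∀ᶠ t in atTop, ∀ i < d.m t, (d.n t i : ℝ) ≤ C * d.nL t

/-- True linear predictor of measurement `j` in cluster `i`. -/
def etaTrue (t i j : ℕ) : ℝ := d.x t i j ⬝ᵥ β + d.x t i j ⬝ᵥ (b i).ofLp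

/-- Linear predictor at an arbitrary parameter vector. -/
def eta {t : ℕ} (θ : Param p (d.m t)) (i : Fin (d.m t)) (j : ℕ) : ℝ :=
  d.x t i j ⬝ᵥ θ.fixed + d.x t i j ⬝ᵥ θ.random i

/-- The weight matrix `ψ⁻¹ diag (a''(η_{i1}), …, a''(η_{i n_i}))` at the true linear predictors. -/
def weight (ψ : ℝ) (t i : ℕ) : Matrix (Fin (d.n t i)) (Fin (d.n t i)) ℝ :=
  ψ⁻¹ • Matrix.diagonal fun j : Fin (d.n t i) => iteratedDeriv 2 F.a (etaTrue d β b t i j)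

/-- `H_i = (n_i⁻¹ X_iᵀ W_i X_i)⁻¹` with `W_i` the weight matrix at the true dispersion. -/
def H (t i : ℕ) : Matrix (Fin p) (Fin p) ℝ :=
  ((d.n t i : ℝ)⁻¹ • ((d.X t i)ᵀ * weight d F β b F.φ t i * d.X t i))⁻¹

/-- `m⁻¹ ∑ i, (n / n_i) H_i`, with `n` the average cluster size. -/
def Hbar (t : ℕ) : Matrix (Fin p) (Fin p) ℝ :=
  (d.m t : ℝ)⁻¹ • ∑ i : Fin (d.m t), (d.nbar t / (d.n t i : ℝ)) • H d F β b t i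

/-- The eigenvalues of the symmetric matrix `M` lie in `[c, c⁻¹]`. -/
def EigenvaluesWithin (c : ℝ) (M : Matrix (Fin p) (Fin p) ℝ) : Prop :=
  (M - c • (1 : Matrix (Fin p) (Fin p) ℝ)).PosSemidef ∧
    (c⁻¹ • (1 : Matrix (Fin p) (Fin p) ℝ) - M).PosSemidef

/-- Smoothness of `a`: three times continuously differentiable, `a''` bounded and bounded away from
zero, `a'''` bounded. -/
structure Cond1 : Prop where
  contDiff : ContDiffOn ℝ 3 F.a F.dom
  bounds : ∃ c₀ > 0, ∀ η ∈ F.dom, c₀ ≤ iteratedDeriv 2 F.a η ∧ iteratedDeriv 2 F.a η ≤ c₀⁻¹ ∧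
    |iteratedDeriv 3 F.a η| ≤ c₀⁻¹

/-- Bounded covariates, and convergence of `H_i` to `K i` and of `Hbar` to `K₀`, with eigenvalues in
`[c₁, c₁⁻¹]`, uniformly over the clusters present. -/
structure Cond2 (K₀ : Matrix (Fin p) (Fin p) ℝ) (K : ℕ → Matrix (Fin p) (Fin p) ℝ) : Prop where
  bounded : ∃ C₁ : ℝ, ∀ t, ∀ i < d.m t, ∀ j < d.n t i, ‖d.x t i j‖ < C₁
  tendsto : ∀ i, Tendsto (fun t => H d F β b t i) atTop (𝓝 (K i))
  tendsto_bar : Tendsto (fun t => Hbar d F β b t) atTop (𝓝 K₀)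
  eigenvalues : ∃ c₁ > 0, (∀ᶠ t in atTop, ∀ i < d.m t, EigenvaluesWithin c₁ (H d F β b t i)) ∧
    (∀ i, EigenvaluesWithin c₁ (K i)) ∧ EigenvaluesWithin c₁ K₀

/-- The true linear predictors stay uniformly inside the domain, and the averages
`M⁻¹ ∑ i < M, ‖b_i‖` of the true random effects are bounded (as they are when all `b_i` lie in one
compact set, and for almost every realisation of i.i.d. normal random effects). -/
structure Cond3 : Prop where
  interior : ∃ ε > 0, ∀ t, ∀ i < d.m t, ∀ j < d.n t i, Metric.ball (etaTrue d β b t i j) ε ⊆ F.dom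
  effects : ∃ C : ℝ, ∀ M : ℕ, ∑ i ∈ Finset.range M, ‖b i‖ ≤ C * M

variable {Ω : Type*} [MeasurableSpace Ω] (P : Measure Ω)

/-- `Z_t = O_p(1)` as `t → ∞`. -/
def BoundedInProb (Z : ℕ → Ω → ℝ) : Prop :=
  ∀ ε > 0, ∃ M : ℝ, ∀ᶠ t in atTop, P {ω | M < |Z t ω|} ≤ ENNReal.ofReal ε

/-- The model given the random effects: at each stage the responses are independent, and `y t i j`
follows the exponential family with canonical parameter the true linear predictor. -/
structure ResponseModel (y : ℕ → ℕ → ℕ → Ω → ℝ) : Prop where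
  law : ∀ t, ∀ i < d.m t, ∀ j < d.n t i, HasLaw (y t i j) (F.law (etaTrue d β b t i j)) P
  indep : ∀ t, iIndepFun
    (fun s : (Σ i : Fin (d.m t), Fin (d.n t i)) => y t s.1 s.2) P

/-- The working matrix `G` is positive definite with `G⁻¹ = O_p(1)`, and the working dispersion `ψ` is
positive and `O_p(1)`. -/
structure Cond4 (G : ℕ → Ω → Matrix (Fin p) (Fin p) ℝ) (ψ : ℕ → Ω → ℝ) : Prop where
  measurable_G : ∀ t k l, Measurable fun ω => G t ω k l
  measurable_ψ : ∀ t, Measurable (ψ t)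
  posDef : ∀ t ω, (G t ω).PosDef
  inv_bounded : ∀ k l, BoundedInProb P fun t ω => (G t ω)⁻¹ k l
  pos : ∀ t ω, 0 < ψ t ω
  bounded : BoundedInProb P ψ

/-- The vector
`n_i^{1/2} (X_iᵀ W_i X_i + G⁻¹)⁻¹ (ψ⁻¹ X_iᵀ (y_i - μ_i) - G⁻¹ b_i)` with `W_i` the
weight matrix at the working dispersion `ψ`. -/
def scoreRatio (t i : ℕ) (yi : ℕ → ℝ) (G : Matrix (Fin p) (Fin p) ℝ) (ψ : ℝ) : Fin p → ℝ :=
  Real.sqrt (d.n t i) • (((d.X t i)ᵀ * weight d F β b ψ t i * d.X t i + G⁻¹)⁻¹ *ᵥ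
    (ψ⁻¹ • ((d.X t i)ᵀ *ᵥ fun j => yi j - F.mean (etaTrue d β b t i j)) - G⁻¹ *ᵥ (b i).ofLp))

/-- Componentwise finite fourth moments of `scoreRatio`. -/
def Cond5 (y : ℕ → ℕ → ℕ → Ω → ℝ) (G : ℕ → Ω → Matrix (Fin p) (Fin p) ℝ)
    (ψ : ℕ → Ω → ℝ) : Prop :=
  ∀ t, ∀ i < d.m t, ∀ k,
    Integrable (fun ω => scoreRatio d F β b t i (fun j => y t i j ω) (G t ω) (ψ t ω) k ^ 4) P

/-- The PQL objective function for responses `y`, working matrix `G`, working dispersion `ψ`. -/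
def objective {t : ℕ} (y : ℕ → ℕ → ℝ) (G : Matrix (Fin p) (Fin p) ℝ) (ψ : ℝ)
    (θ : Param p (d.m t)) : ℝ :=
  (∑ i : Fin (d.m t), ∑ j : Fin (d.n t i), F.logDensity ψ (eta d θ i j) (y i j)) -
    (1 / 2) * ∑ i : Fin (d.m t), θ.random i ⬝ᵥ (G⁻¹ *ᵥ θ.random i)

/-- Parameter vectors whose linear predictors all lie in the domain of `a`
(every vector, if that domain is the real line). -/
def feasible (t : ℕ) : Set (Param p (d.m t)) :=
  {θ | ∀ (i : Fin (d.m t)) (j : Fin (d.n t i)), eta d θ i j ∈ F.dom}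

/-- `θ` maximises the PQL objective function. -/
def IsPQLEstimate {t : ℕ} (y : ℕ → ℕ → ℝ) (G : Matrix (Fin p) (Fin p) ℝ) (ψ : ℝ)
    (θ : Param p (d.m t)) : Prop :=
  θ ∈ feasible d F t ∧ IsMaxOn (objective d F y G ψ) (feasible d F t) θ

/-- The true parameter vector at stage `t`. -/
def thetaTrue (t : ℕ) : Param p (d.m t)
  | (k, none) => β k
  | (k, some i) => b i k

/-- The vector `(-1, 1, …, 1)` of length `m + 1`. -/
def oneStar {m : ℕ} : Option (Fin m) → ℝ
  | none => -1
  | some _ => 1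

/-- `m⁻¹ ∑ i, b_i`. -/
def bbar (t : ℕ) : EuclideanSpace ℝ (Fin p) := (d.m t : ℝ)⁻¹ • ∑ i : Fin (d.m t), b i

/-- The sum-to-zero reparametrised truth: the true vector minus `(-1, 1, …, 1) ⊗ m⁻¹ ∑ i, b_i`. -/
def target (t : ℕ) : Param p (d.m t) :=
  thetaTrue d β b t - fun s => oneStar s.2 * bbar d b t s.1

/-- The scaling matrix: `N^{1/2}` for the fixed effects, `n_i^{1/2}` for cluster `i`. -/
def scaling (t : ℕ) : Matrix (Fin p × Option (Fin (d.m t))) (Fin p × Option (Fin (d.m t))) ℝ :=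
  Matrix.diagonal fun s => match s.2 with
    | none => Real.sqrt (d.N t)
    | some i => Real.sqrt (d.n t i)

/-- The block-diagonal matrix with blocks `Hbar, H_1, …, H_m`. -/
def blockMatrix (t : ℕ) :
    Matrix (Fin p × Option (Fin (d.m t))) (Fin p × Option (Fin (d.m t))) ℝ :=
  Matrix.blockDiagonal fun s : Option (Fin (d.m t)) => match s with
    | none => Hbar d F β b t
    | some i => H d F β b t i

/-- The entry of a `q × (m + 1) p` matrix in row `r`, block `s` and place `k` of the block, where
`none` is the block of the fixed effects and `some i` that of cluster `i`; zero if there is no such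
cluster. -/
def entry {q m : ℕ} (A : Matrix (Fin q) (Fin p × Option (Fin m)) ℝ) (r : Fin q) (k : Fin p) :
    Option ℕ → ℝ
  | none => A r (k, none)
  | some i => if h : i < m then A r (k, some ⟨i, h⟩) else 0

/-- The finite selection property of a sequence of `q × (m + 1) p` matrices, with componentwise
limits `L none` (fixed effects) and `L (some i)` (cluster `i`), not all of them zero. -/
structure FiniteSelection {q : ℕ}
    (A : ∀ t, Matrix (Fin q) (Fin p × Option (Fin (d.m t))) ℝ)
    (L : Option ℕ → Matrix (Fin q) (Fin p) ℝ) : Prop where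
  finite : ∀ r, ∃ m₀ : ℕ, ∀ t, m₀ < d.m t → ∀ i : Fin (d.m t), m₀ ≤ i → ∀ k,
    A t r (k, some i) = 0
  tendsto : ∀ r k s, Tendsto (fun t => entry (A t) r k s) atTop (𝓝 (L s r k))
  nonzero : ∃ r k s, L s r k ≠ 0

end Setup

end PQL

end

/-!
Shifting `β` and all `b_i` in opposite directions leaves the linear predictors unchanged, so a
maximiser of the objective has random effects summing to zero; this is why `target`, and not the
true parameter, is estimated. Let `δ_i` be the error of the estimate of `β + b_i`. The errors of
the estimate are then `m⁻¹ ∑ δ_j` (fixed effects) and `δ_i - m⁻¹ ∑ δ_j` (random effects). The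
first-order condition of cluster `i` equates `n_i φ H_i⁻¹ δ_i` with the score `X_iᵀ (y_i - μ_i)`, up
to a term of order `n_i ‖δ_i‖²` and a penalty of the order of the estimated random effect. Since
`a''` is bounded below, this first gives `‖δ_i‖² = O_p(1 / n_L)` on average, and then
`δ_i = ℓ_i + O_p(1 / n_L)`, both on average and for each fixed `i`, where
`ℓ_i = (n_i φ)⁻¹ H_i X_iᵀ (y_i - μ_i)`.

Scaling the fixed effects by `N^{1/2}` inflates the remainder to order `(m / n_L)^{1/2}`, which
still vanishes. What is left is a linear combination of the independent `ℓ_i`, and so of independent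
centred responses, to which Lyapunov's theorem applies. A single `ℓ_i` has a vanishing share in
`m⁻¹ ∑ ℓ_j`: the scaled fixed effects and cluster `i` have covariance `O(m^{-1/2})`, whence their
asymptotic independence.
-/

noncomputable section

namespace PQL

section Taylor

variable {s : Set ℝ} {f f' : ℝ → ℝ} {C x y : ℝ}

theorem abs_sub_sub_mul_le_of_lipschitz_deriv (hs : Convex ℝ s)
    (hf : ∀ z ∈ s, HasDerivAt f (f' z) z)
    (hf' : ∀ z ∈ s, ∀ w ∈ s, |f' z - f' w| ≤ C * |z - w|) (hx : x ∈ s) (hy : y ∈ s) :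
    |f x - f y - f' y * (x - y)| ≤ C * (x - y) ^ 2 := by
  have hsub : segment ℝ y x ⊆ s := hs.segment_subset hy hx
  have hderiv : ∀ z ∈ segment ℝ y x,
      HasDerivWithinAt (fun z => f z - f' y * z) (f' z - f' y) (segment ℝ y x) z := fun z hz => by
    simpa only [mul_one] using
      ((hf z (hsub hz)).fun_sub ((hasDerivAt_id' z).const_mul (f' y))).hasDerivWithinAt
  have hbound : ∀ z ∈ segment ℝ y x, ‖f' z - f' y‖ ≤ C * |x - y| := fun z hz => by
    refine (hf' z (hsub hz) y hy).trans ?_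
    obtain ⟨a, b, ha, hb, hab, rfl⟩ := hz
    have hz : a • y + b • x - y = b * (x - y) := by
      simp only [smul_eq_mul]; linear_combination y * hab
    rw [hz, abs_mul, abs_of_nonneg hb, mul_left_comm]
    exact mul_le_of_le_one_left ((abs_nonneg _).trans (hf' x hx y hy)) (by linarith)
  have key := (convex_segment y x).norm_image_sub_le_of_norm_hasDerivWithin_le hderiv hbound
    (left_mem_segment ℝ y x) (right_mem_segment ℝ y x)
  rw [Real.norm_eq_abs, Real.norm_eq_abs, mul_assoc, abs_mul_abs_self, ← sq] at key
  convert key using 2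
  ring

end Taylor

/-! ### Lyapunov's central limit theorem -/

section Lyapunov

theorem norm_cexp_ofReal_mul_I_sub_le (x : ℝ) :
    ‖Complex.exp (x * Complex.I) - (1 + x * Complex.I - x ^ 2 / 2)‖ ≤ |x| ^ 3 := by
  have hnorm : ‖(x : ℂ) * Complex.I‖ = |x| := by simp
  rcases le_or_gt |x| 2 with hx | hx
  · have h := Complex.exp_bound' (x := x * Complex.I) (n := 3)
      (by rw [hnorm]; norm_num; linarith)
    have hsum : ∑ k ∈ Finset.range 3, ((x : ℂ) * Complex.I) ^ k / k.factorial =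
        1 + x * Complex.I - x ^ 2 / 2 := by
      simp [Finset.sum_range_succ, Nat.factorial, mul_pow]
      ring
    rw [hsum, hnorm] at h
    refine h.trans ?_
    norm_num [Nat.factorial]
    linarith [pow_nonneg (abs_nonneg x) 3]
  · calc ‖Complex.exp (x * Complex.I) - (1 + x * Complex.I - x ^ 2 / 2)‖
        ≤ ‖Complex.exp (x * Complex.I)‖ + (‖(1 : ℂ)‖ + ‖(x : ℂ) * Complex.I‖ +
            ‖(x : ℂ) ^ 2 / 2‖) :=
          (norm_sub_le _ _).trans (by gcongr; exact (norm_sub_le _ _).trans (by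
            gcongr; exact norm_add_le _ _))
      _ = 2 + |x| + |x| ^ 2 / 2 := by
          rw [Complex.norm_exp_ofReal_mul_I, hnorm]; simp; ring
      _ ≤ |x| ^ 3 := by nlinarith [mul_pos (sub_pos.2 hx) (sub_pos.2 hx)]

theorem abs_one_sub_sub_exp_neg_le {x : ℝ} (hx : 0 ≤ x) :
    |1 - x - Real.exp (-x)| ≤ x * √x := by
  have hlow : 1 - x ≤ Real.exp (-x) := by linarith [Real.add_one_le_exp (-x)]
  rw [abs_of_nonpos (by linarith)]
  rcases le_or_gt x 1 with h1 | h1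
  · have hexp := (abs_le.1 (Real.abs_exp_sub_one_sub_id_le (x := -x)
      (by rwa [abs_neg, abs_of_nonneg hx]))).2
    have hsqrt : x ≤ √x := Real.le_sqrt_of_sq_le (by nlinarith)
    nlinarith
  · have hexp : Real.exp (-x) ≤ 1 := Real.exp_le_one_iff.2 (by linarith)
    have hsqrt : 1 ≤ √x := Real.one_le_sqrt.2 h1.le
    nlinarith

theorem norm_prod_sub_prod_le {ι R : Type*} [NormedCommRing R] [NormOneClass R] (s : Finset ι)
    {f g : ι → R} (hf : ∀ i ∈ s, ‖f i‖ ≤ 1) (hg : ∀ i ∈ s, ‖g i‖ ≤ 1) :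
    ‖∏ i ∈ s, f i - ∏ i ∈ s, g i‖ ≤ ∑ i ∈ s, ‖f i - g i‖ := by
  classical
  induction s using Finset.induction_on with
  | empty => simp
  | insert a s ha ih =>
    rw [Finset.forall_mem_insert] at hf hg
    have hprod : ‖∏ i ∈ s, g i‖ ≤ 1 :=
      (s.norm_prod_le g).trans (Finset.prod_le_one (fun _ _ => norm_nonneg _) hg.2)
    rw [Finset.prod_insert ha, Finset.prod_insert ha, Finset.sum_insert ha,
      show ∀ u v u' v' : R, u * v - u' * v' = (u - u') * v' + u * (v - v') by intros; ring]
    refine (norm_add_le _ _).trans (add_le_add ?_ ?_)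
    · exact (norm_mul_le _ _).trans (mul_le_of_le_one_right (norm_nonneg _) hprod)
    · exact (norm_mul_le _ _).trans
        ((mul_le_of_le_one_left (norm_nonneg _) hf.1).trans (ih hf.2 hg.2))

variable {Ω : Type*} [MeasurableSpace Ω] {P : Measure Ω} [IsProbabilityMeasure P] {Y : Ω → ℝ}

/-- Integrate `3 a y² ≤ 2 |y|³ + a³` at `a = √(∫ y²)`. -/
theorem integral_sq_mul_sqrt_le (hY : MemLp Y 3 P) :
    (∫ ω, Y ω ^ 2 ∂P) * √(∫ ω, Y ω ^ 2 ∂P) ≤ ∫ ω, |Y ω| ^ 3 ∂P := by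
  set v := ∫ ω, Y ω ^ 2 ∂P with hv
  have hv0 : 0 ≤ v := integral_nonneg fun ω => sq_nonneg _
  have hpt : ∀ ω, 3 * √v * Y ω ^ 2 ≤ 2 * |Y ω| ^ 3 + √v ^ 3 := fun ω => by
    rw [← sq_abs (Y ω)]
    nlinarith [mul_nonneg (sq_nonneg (|Y ω| - √v))
      (add_nonneg (mul_nonneg zero_le_two (abs_nonneg (Y ω))) (Real.sqrt_nonneg v))]
  have h3 : Integrable (fun ω => |Y ω| ^ 3) P := hY.integrable_norm_pow three_ne_zero
  have h2 : Integrable (fun ω => Y ω ^ 2) P := (hY.mono_exponent (by norm_num)).integrable_sq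
  have key := integral_mono (h2.const_mul (3 * √v)) ((h3.const_mul 2).add (integrable_const _)) hpt
  simp only [Pi.add_apply] at key
  rw [integral_const_mul, integral_add (h3.const_mul 2) (integrable_const _), integral_const_mul,
    integral_const, probReal_univ, one_smul, ← hv] at key
  have hcube : √v ^ 3 = v * √v := by rw [pow_succ, Real.sq_sqrt hv0]
  linarith

theorem norm_charFun_map_sub_le (hY : MemLp Y 3 P) (h0 : ∫ ω, Y ω ∂P = 0) (τ : ℝ) :
    ‖charFun (P.map Y) τ - ((1 - τ ^ 2 * (∫ ω, Y ω ^ 2 ∂P) / 2 : ℝ) : ℂ)‖ ≤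
      |τ| ^ 3 * ∫ ω, |Y ω| ^ 3 ∂P := by
  have h1 : Integrable Y P := hY.integrable (by norm_num)
  have h2 : Integrable (fun ω => Y ω ^ 2) P := (hY.mono_exponent (by norm_num)).integrable_sq
  have h3 : Integrable (fun ω => |Y ω| ^ 3) P := hY.integrable_norm_pow three_ne_zero
  have hexp : Integrable (fun ω => Complex.exp (((τ * Y ω : ℝ) : ℂ) * Complex.I)) P :=
    Integrable.of_bound ((by fun_prop : Continuous fun z : ℝ =>
      Complex.exp (((τ * z : ℝ) : ℂ) * Complex.I)).comp_aestronglyMeasurable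
        hY.aestronglyMeasurable) 1
      (ae_of_all _ fun ω => (Complex.norm_exp_ofReal_mul_I _).le)
  have hlin : Integrable (fun ω => 1 + ((τ * Y ω : ℝ) : ℂ) * Complex.I) P :=
    (integrable_const _).add ((h1.const_mul τ).ofReal.mul_const _)
  have hquad : Integrable (fun ω => (((τ * Y ω) ^ 2 / 2 : ℝ) : ℂ)) P := by
    simp_rw [mul_pow]
    exact ((h2.const_mul _).div_const 2).ofReal
  have hpoly : Integrable
      (fun ω => 1 + ((τ * Y ω : ℝ) : ℂ) * Complex.I - (((τ * Y ω) ^ 2 / 2 : ℝ) : ℂ)) P :=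
    hlin.sub hquad
  have htaylor : ∫ ω, (1 + ((τ * Y ω : ℝ) : ℂ) * Complex.I - (((τ * Y ω) ^ 2 / 2 : ℝ) : ℂ)) ∂P =
      ((1 - τ ^ 2 * (∫ ω, Y ω ^ 2 ∂P) / 2 : ℝ) : ℂ) := by
    rw [integral_sub hlin hquad, integral_add (integrable_const _)
      ((h1.const_mul τ).ofReal.mul_const _), integral_mul_const, integral_complex_ofReal,
      integral_complex_ofReal, integral_const_mul, h0]
    simp_rw [mul_pow, integral_div, integral_const_mul]
    simp
  have hchar : charFun (P.map Y) τ = ∫ ω, Complex.exp (((τ * Y ω : ℝ) : ℂ) * Complex.I) ∂P := by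
    rw [charFun_apply_real, integral_map hY.aestronglyMeasurable.aemeasurable (by fun_prop)]
    simp only [Complex.ofReal_mul]
  rw [hchar, ← htaylor, ← integral_sub hexp hpoly]
  refine (norm_integral_le_of_norm_le (h3.const_mul (|τ| ^ 3)) (ae_of_all _ fun ω => ?_)).trans_eq
    (integral_const_mul _ _)
  rw [← mul_pow, ← abs_mul]
  simpa using norm_cexp_ofReal_mul_I_sub_le (τ * Y ω)

theorem norm_charFun_map_sub_exp_le (hY : MemLp Y 3 P) (h0 : ∫ ω, Y ω ∂P = 0) (τ : ℝ) :
    ‖charFun (P.map Y) τ - (Real.exp (-(τ ^ 2 * (∫ ω, Y ω ^ 2 ∂P) / 2)) : ℂ)‖ ≤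
      2 * |τ| ^ 3 * ∫ ω, |Y ω| ^ 3 ∂P := by
  set v := ∫ ω, Y ω ^ 2 ∂P
  have hv0 : 0 ≤ v := integral_nonneg fun ω => sq_nonneg _
  have hx0 : 0 ≤ τ ^ 2 * v / 2 := by positivity
  have hexp : ‖((1 - τ ^ 2 * v / 2 : ℝ) : ℂ) - (Real.exp (-(τ ^ 2 * v / 2)) : ℂ)‖ ≤
      |τ| ^ 3 * ∫ ω, |Y ω| ^ 3 ∂P := by
    rw [← Complex.ofReal_sub, Complex.norm_real, Real.norm_eq_abs]
    calc |1 - τ ^ 2 * v / 2 - Real.exp (-(τ ^ 2 * v / 2))|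
        ≤ τ ^ 2 * v / 2 * √(τ ^ 2 * v / 2) := abs_one_sub_sub_exp_neg_le hx0
      _ ≤ τ ^ 2 * v * √(τ ^ 2 * v) := by gcongr <;> linarith [mul_nonneg (sq_nonneg τ) hv0]
      _ = |τ| ^ 3 * (v * √v) := by
          rw [Real.sqrt_mul (sq_nonneg τ), Real.sqrt_sq_eq_abs, ← sq_abs τ]; ring
      _ ≤ |τ| ^ 3 * ∫ ω, |Y ω| ^ 3 ∂P := by gcongr; exact integral_sq_mul_sqrt_le hY
  linarith [norm_sub_le_norm_sub_add_norm_sub (charFun (P.map Y) τ)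
    ((1 - τ ^ 2 * v / 2 : ℝ) : ℂ) (Real.exp (-(τ ^ 2 * v / 2)) : ℂ),
    norm_charFun_map_sub_le hY h0 τ]

theorem tendsto_charFun_map_sum_of_lyapunov {α : Type*} {l : Filter α} {ι : α → Type*}
    [∀ a, Fintype (ι a)] {Y : ∀ a, ι a → Ω → ℝ} {σ : ℝ} (hindep : ∀ a, iIndepFun (Y a) P)
    (hmem : ∀ a k, MemLp (Y a k) 3 P) (hmean : ∀ a k, ∫ ω, Y a k ω ∂P = 0)
    (hvar : Tendsto (fun a => ∑ k, ∫ ω, Y a k ω ^ 2 ∂P) l (𝓝 σ))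
    (hthird : Tendsto (fun a => ∑ k, ∫ ω, |Y a k ω| ^ 3 ∂P) l (𝓝 0)) (τ : ℝ) :
    Tendsto (fun a => charFun (P.map fun ω => ∑ k, Y a k ω) τ) l
      (𝓝 (Real.exp (-(τ ^ 2 * σ / 2)) : ℂ)) := by
  have hgauss : Tendsto
      (fun a => (Real.exp (-(τ ^ 2 * (∑ k, ∫ ω, Y a k ω ^ 2 ∂P) / 2)) : ℂ)) l
      (𝓝 (Real.exp (-(τ ^ 2 * σ / 2)) : ℂ)) := by
    refine Tendsto.comp (g := fun v : ℝ => (Real.exp (-(τ ^ 2 * v / 2)) : ℂ)) ?_ hvar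
    exact (by fun_prop : Continuous fun v : ℝ => (Real.exp (-(τ ^ 2 * v / 2)) : ℂ)).tendsto σ
  refine tendsto_of_tendsto_of_dist hgauss (squeeze_zero (fun _ => dist_nonneg) (fun a => ?_)
    (by simpa using hthird.const_mul (2 * |τ| ^ 3)))
  have hprod : (Real.exp (-(τ ^ 2 * (∑ k, ∫ ω, Y a k ω ^ 2 ∂P) / 2)) : ℂ) =
      ∏ k, (Real.exp (-(τ ^ 2 * (∫ ω, Y a k ω ^ 2 ∂P) / 2)) : ℂ) := by
    rw [← Complex.ofReal_prod, ← Real.exp_sum, Finset.sum_neg_distrib, Finset.mul_sum,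
      Finset.sum_div]
  have hmap : ∀ k, IsProbabilityMeasure (P.map (Y a k)) := fun k =>
    Measure.isProbabilityMeasure_map (hmem a k).aestronglyMeasurable.aemeasurable
  rw [dist_comm, dist_eq_norm, hprod, iIndepFun.charFun_map_fun_sum_eq_prod
    (fun k => (hmem a k).aestronglyMeasurable.aemeasurable) (hindep a), Finset.prod_apply,
    Finset.mul_sum]
  refine (norm_prod_sub_prod_le _ (fun k _ => norm_charFun_le_one _) fun k _ => ?_).trans
    (Finset.sum_le_sum fun k _ => norm_charFun_map_sub_exp_le (hmem a k) (hmean a k) τ)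
  rw [Complex.norm_real, Real.norm_eq_abs, abs_of_pos (Real.exp_pos _), Real.exp_le_one_iff]
  have : 0 ≤ ∫ ω, Y a k ω ^ 2 ∂P := integral_nonneg fun ω => sq_nonneg _
  linarith [mul_nonneg (sq_nonneg τ) this]

end Lyapunov

/-! ### Linear algebra in the maximum norm -/

section LinearAlgebra

variable {ι κ : Type*} [Fintype ι] [Fintype κ]

theorem abs_dotProduct_le (u v : ι → ℝ) : |u ⬝ᵥ v| ≤ Fintype.card ι * (‖u‖ * ‖v‖) := by
  calc |u ⬝ᵥ v| ≤ ∑ k, |u k * v k| := Finset.abs_sum_le_sum_abs _ _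
    _ ≤ ∑ _k : ι, ‖u‖ * ‖v‖ := Finset.sum_le_sum fun k _ => by
        rw [abs_mul]
        exact mul_le_mul (norm_le_pi_norm u k) (norm_le_pi_norm v k) (abs_nonneg _) (norm_nonneg _)
    _ = Fintype.card ι * (‖u‖ * ‖v‖) := by simp

theorem norm_sq_le_dotProduct_self (u : ι → ℝ) : ‖u‖ ^ 2 ≤ u ⬝ᵥ u := by
  have h0 : 0 ≤ u ⬝ᵥ u := Finset.sum_nonneg fun k _ => mul_self_nonneg (u k)
  refine (Real.le_sqrt (norm_nonneg u) h0).1 ((pi_norm_le_iff_of_nonneg (Real.sqrt_nonneg _)).2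
    fun k => Real.le_sqrt_of_sq_le ?_)
  rw [Real.norm_eq_abs, sq_abs, sq]
  exact Finset.single_le_sum (f := fun k => u k * u k) (fun k _ => mul_self_nonneg (u k))
    (Finset.mem_univ k)

theorem norm_mulVec_le {M : Matrix ι κ ℝ} {B : ℝ} (hB : 0 ≤ B) (hM : ∀ k l, |M k l| ≤ B)
    (v : κ → ℝ) : ‖M *ᵥ v‖ ≤ Fintype.card κ * B * ‖v‖ := by
  refine (pi_norm_le_iff_of_nonneg (by positivity)).2 fun k => ?_
  refine (abs_dotProduct_le (M k) v).trans ?_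
  rw [mul_assoc]
  gcongr
  exact (pi_norm_le_iff_of_nonneg hB).2 (hM k)

theorem sum_smul_dotProduct (f : κ → ℝ) (x : κ → ι → ℝ) (v : ι → ℝ) :
    (∑ j, f j • x j) ⬝ᵥ v = ∑ j, f j * (x j ⬝ᵥ v) := by
  simp [sum_dotProduct]

theorem hasDerivAt_dotProduct_mulVec_self {A : Matrix ι ι ℝ} (hA : A.IsSymm)
    (u v : ι → ℝ) :
    HasDerivAt (fun s : ℝ => (u + s • v) ⬝ᵥ (A *ᵥ (u + s • v))) (2 * (v ⬝ᵥ (A *ᵥ u))) 0 := by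
  have hsymm : u ⬝ᵥ (A *ᵥ v) = v ⬝ᵥ (A *ᵥ u) := by
    rw [dotProduct_mulVec, ← mulVec_transpose, hA.eq, dotProduct_comm]
  have hpoly : (fun s : ℝ => (u + s • v) ⬝ᵥ (A *ᵥ (u + s • v))) =
      fun s : ℝ => u ⬝ᵥ (A *ᵥ u) + (s * (2 * (v ⬝ᵥ (A *ᵥ u))) + s ^ 2 * (v ⬝ᵥ (A *ᵥ v))) := by
    ext s
    simp only [mulVec_add, mulVec_smul, dotProduct_add, add_dotProduct, dotProduct_smul,
      smul_dotProduct, smul_eq_mul, hsymm]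
    ring
  rw [hpoly]
  simpa using (((hasDerivAt_id (0 : ℝ)).mul_const (2 * (v ⬝ᵥ (A *ᵥ u)))).add
    (((hasDerivAt_id (0 : ℝ)).pow 2).mul_const (v ⬝ᵥ (A *ᵥ v)))).const_add (u ⬝ᵥ (A *ᵥ u))

end LinearAlgebra

namespace EigenvaluesWithin

variable {p : ℕ} {c : ℝ} {M : Matrix (Fin p) (Fin p) ℝ}

theorem mul_dotProduct_self_le (h : EigenvaluesWithin c M) (v : Fin p → ℝ) :
    c * (v ⬝ᵥ v) ≤ v ⬝ᵥ (M *ᵥ v) := by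
  have := h.1.dotProduct_mulVec_nonneg v
  simp only [star_trivial, sub_mulVec, smul_mulVec, one_mulVec, dotProduct_sub,
    dotProduct_smul, smul_eq_mul] at this
  linarith

theorem dotProduct_mulVec_le (h : EigenvaluesWithin c M) (v : Fin p → ℝ) :
    v ⬝ᵥ (M *ᵥ v) ≤ c⁻¹ * (v ⬝ᵥ v) := by
  have := h.2.dotProduct_mulVec_nonneg v
  simp only [star_trivial, sub_mulVec, smul_mulVec, one_mulVec, dotProduct_sub,
    dotProduct_smul, smul_eq_mul] at this
  linarith

theorem isSymm (h : EigenvaluesWithin c M) : M.IsSymm := by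
  have h1 : (M - c • (1 : Matrix (Fin p) (Fin p) ℝ))ᵀ = M - c • 1 := by
    simpa only [IsHermitian, conjTranspose_eq_transpose_of_trivial] using h.1.1
  rw [transpose_sub, transpose_smul, transpose_one] at h1
  exact sub_left_injective h1

theorem posDef (h : EigenvaluesWithin c M) (hc : 0 < c) : M.PosDef := by
  refine PosDef.of_dotProduct_mulVec_pos ?_ fun v hv => ?_
  · rw [IsHermitian, conjTranspose_eq_transpose_of_trivial, h.isSymm.eq]
  · have h1 : 0 < v ⬝ᵥ v := lt_of_lt_of_le (by positivity) (norm_sq_le_dotProduct_self v)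
    exact (mul_pos hc h1).trans_le (h.mul_dotProduct_self_le v)

theorem abs_apply_le (h : EigenvaluesWithin c M) (hc : 0 < c) (k l : Fin p) :
    |M k l| ≤ c⁻¹ := by
  have hdiag : ∀ k, M k k ≤ c⁻¹ := fun k => by
    simpa using h.dotProduct_mulVec_le (Pi.single k 1)
  have hquad : ∀ s : ℝ, 0 ≤ M k k + s * M k l + s * M l k + s ^ 2 * M l l := fun s => by
    have := (h.posDef hc).posSemidef.dotProduct_mulVec_nonneg (Pi.single k 1 + s • Pi.single l 1)
    simp only [mulVec_add, mulVec_smul, add_dotProduct, dotProduct_add, star_trivial,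
      smul_dotProduct, dotProduct_smul, smul_eq_mul, single_one_dotProduct, mulVec_single_one,
      col_apply] at this
    linarith
  have hadd := hquad 1
  have hsub := hquad (-1)
  rw [h.isSymm.apply k l] at hadd hsub
  rw [abs_le]
  constructor <;> linarith [hdiag k, hdiag l]

theorem norm_mulVec_le (h : EigenvaluesWithin c M) (hc : 0 < c) (v : Fin p → ℝ) :
    ‖M *ᵥ v‖ ≤ p * c⁻¹ * ‖v‖ := by
  simpa using PQL.norm_mulVec_le (inv_nonneg.2 hc.le) (h.abs_apply_le hc) v

theorem inv_mul_cancel (h : EigenvaluesWithin c M⁻¹) (hc : 0 < c) : M⁻¹ * M = 1 :=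
  nonsing_inv_mul _ (isUnit_nonsing_inv_det_iff.1 (h.posDef hc).det_pos.ne'.isUnit)

theorem mul_dotProduct_self_le_of_inv (h : EigenvaluesWithin c M⁻¹) (hc : 0 < c)
    (u : Fin p → ℝ) : c * (u ⬝ᵥ u) ≤ u ⬝ᵥ (M *ᵥ u) := by
  -- expand `0 ≤ vᵀ M⁻¹ v` at `v = M u - c u`
  have hnonneg := (h.posDef hc).posSemidef.dotProduct_mulVec_nonneg (M *ᵥ u - c • u)
  have hinv : M⁻¹ *ᵥ (M *ᵥ u) = u := by rw [mulVec_mulVec, h.inv_mul_cancel hc, one_mulVec]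
  have hsymm : (M *ᵥ u) ⬝ᵥ (M⁻¹ *ᵥ u) = u ⬝ᵥ u := by
    rw [dotProduct_mulVec, ← mulVec_transpose, h.isSymm.eq, hinv]
  have hupper : c ^ 2 * (u ⬝ᵥ (M⁻¹ *ᵥ u)) ≤ c * (u ⬝ᵥ u) := by
    refine (mul_le_mul_of_nonneg_left (h.dotProduct_mulVec_le u) (sq_nonneg c)).trans_eq ?_
    field_simp
  simp only [star_trivial, mulVec_sub, mulVec_smul, hinv, sub_dotProduct, dotProduct_sub,
    smul_dotProduct, dotProduct_smul, smul_eq_mul, hsymm, dotProduct_comm (M *ᵥ u) u] at hnonneg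
  nlinarith

end EigenvaluesWithin

/-! ### The cumulant function and the score of a cluster -/

/-- The bounds of `Cond1` on the second and third derivatives of the cumulant function, with a named
constant. -/
structure CurvatureBounds (F : ExpFamily) (c₀ : ℝ) : Prop where
  contDiff : ContDiffOn ℝ 3 F.a F.dom
  pos : 0 < c₀
  lower : ∀ η ∈ F.dom, c₀ ≤ iteratedDeriv 2 F.a η
  upper : ∀ η ∈ F.dom, iteratedDeriv 2 F.a η ≤ c₀⁻¹
  third : ∀ η ∈ F.dom, |iteratedDeriv 3 F.a η| ≤ c₀⁻¹

theorem Cond1.exists_curvatureBounds {F : ExpFamily} (h : Cond1 F) :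
    ∃ c₀, CurvatureBounds F c₀ := by
  obtain ⟨c₀, hc, hb⟩ := h.bounds
  exact ⟨c₀, h.contDiff, hc, fun η hη => (hb η hη).1, fun η hη => (hb η hη).2.1,
    fun η hη => (hb η hη).2.2⟩

namespace CurvatureBounds

variable {F : ExpFamily} {c₀ x y η : ℝ}

theorem hasDerivAt_iteratedDeriv (h : CurvatureBounds F c₀) {n : ℕ} (hn : n < 3)
    (hη : η ∈ F.dom) :
    HasDerivAt (iteratedDeriv n F.a) (iteratedDeriv (n + 1) F.a η) η := by
  have hwithin : DifferentiableAt ℝ (iteratedDerivWithin n F.a F.dom) η :=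
    (h.contDiff.differentiableOn_iteratedDerivWithin (m := n) (by exact_mod_cast hn)
      F.isOpen_dom.uniqueDiffOn η hη).differentiableAt (F.isOpen_dom.mem_nhds hη)
  rw [iteratedDeriv_succ]
  exact (hwithin.congr_of_eventuallyEq ((iteratedDerivWithin_of_isOpen
    F.isOpen_dom).symm.eventuallyEq_of_mem (F.isOpen_dom.mem_nhds hη))).hasDerivAt

theorem hasDerivAt (h : CurvatureBounds F c₀) (hη : η ∈ F.dom) : HasDerivAt F.a (F.mean η) η := by
  simpa [ExpFamily.mean] using h.hasDerivAt_iteratedDeriv (n := 0) (by norm_num) hη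

theorem hasDerivAt_mean (h : CurvatureBounds F c₀) (hη : η ∈ F.dom) :
    HasDerivAt F.mean (iteratedDeriv 2 F.a η) η := by
  have := h.hasDerivAt_iteratedDeriv (n := 1) (by norm_num) hη
  rwa [iteratedDeriv_one] at this

theorem abs_mean_sub_le (h : CurvatureBounds F c₀) (hx : x ∈ F.dom) (hy : y ∈ F.dom) :
    |F.mean x - F.mean y| ≤ c₀⁻¹ * |x - y| := by
  refine F.convex_dom.norm_image_sub_le_of_norm_hasDerivWithin_le
    (fun z hz => (h.hasDerivAt_mean hz).hasDerivWithinAt) (fun z hz => ?_) hy hx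
  rw [Real.norm_eq_abs, abs_of_nonneg (h.pos.le.trans (h.lower z hz))]
  exact h.upper z hz

theorem abs_curvature_sub_le (h : CurvatureBounds F c₀) (hx : x ∈ F.dom) (hy : y ∈ F.dom) :
    |iteratedDeriv 2 F.a x - iteratedDeriv 2 F.a y| ≤ c₀⁻¹ * |x - y| :=
  F.convex_dom.norm_image_sub_le_of_norm_hasDerivWithin_le
    (fun _ hz => (h.hasDerivAt_iteratedDeriv (n := 2) (by norm_num) hz).hasDerivWithinAt)
    (fun z hz => h.third z hz) hy hx

theorem abs_mean_taylor_le (h : CurvatureBounds F c₀) (hx : x ∈ F.dom) (hy : y ∈ F.dom) :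
    |F.mean x - F.mean y - iteratedDeriv 2 F.a y * (x - y)| ≤ c₀⁻¹ * (x - y) ^ 2 :=
  abs_sub_sub_mul_le_of_lipschitz_deriv F.convex_dom (fun _ => h.hasDerivAt_mean)
    (fun _ hz _ hw => h.abs_curvature_sub_le hz hw) hx hy

theorem cumulant_taylor_le (h : CurvatureBounds F c₀) (hx : x ∈ F.dom) (hy : y ∈ F.dom) :
    F.a x - F.a y - F.mean y * (x - y) ≤ c₀⁻¹ * (x - y) ^ 2 :=
  (le_abs_self _).trans (abs_sub_sub_mul_le_of_lipschitz_deriv F.convex_dom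
    (fun _ => h.hasDerivAt) (fun _ hz _ hw => h.abs_mean_sub_le hz hw) hx hy)

theorem mul_sq_le_mean_sub_mul (h : CurvatureBounds F c₀) (hx : x ∈ F.dom) (hy : y ∈ F.dom) :
    c₀ * (x - y) ^ 2 ≤ (F.mean x - F.mean y) * (x - y) := by
  wlog hxy : y ≤ x generalizing x y
  · linarith [this hy hx (le_of_not_ge hxy)]
  have hderiv : ∀ z ∈ F.dom, HasDerivAt F.mean (iteratedDeriv 2 F.a z) z :=
    fun z => h.hasDerivAt_mean
  have hslope : c₀ * (x - y) ≤ F.mean x - F.mean y :=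
    F.convex_dom.mul_sub_le_image_sub_of_le_deriv
      (fun z hz => (hderiv z hz).continuousAt.continuousWithinAt)
      (fun z hz => (hderiv z (interior_subset hz)).differentiableAt.differentiableWithinAt)
      (fun z hz => (h.lower z (interior_subset hz)).trans_eq
        (hderiv z (interior_subset hz)).deriv.symm) y hy x hx hxy
  linarith [mul_le_mul_of_nonneg_right hslope (sub_nonneg.2 hxy)]

section Score

variable {ι J : Type*} [Fintype ι] [Fintype J] {κ C : ℝ} {X : J → ι → ℝ} {z : J → ℝ}
  {γ γ' l : ι → ℝ}

theorem norm_sub_le_of_score_eq (hF : CurvatureBounds F c₀) (hκ : 0 ≤ κ)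
    (hγ : ∀ j, X j ⬝ᵥ γ ∈ F.dom) (hγ' : ∀ j, X j ⬝ᵥ γ' ∈ F.dom)
    (hX : ∀ u, κ * (u ⬝ᵥ u) ≤ ∑ j, (X j ⬝ᵥ u) ^ 2)
    (hscore : ∑ j, (z j - F.mean (X j ⬝ᵥ γ')) • X j = l) :
    c₀ * κ * ‖γ' - γ‖ ≤
      Fintype.card ι * (‖∑ j, (z j - F.mean (X j ⬝ᵥ γ)) • X j‖ + ‖l‖) := by
  set u := γ' - γ with hu
  set S := ∑ j, (z j - F.mean (X j ⬝ᵥ γ)) • X j with hS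
  have hmonotone : c₀ * ∑ j, (X j ⬝ᵥ u) ^ 2 ≤ (S - l) ⬝ᵥ u := by
    rw [← hscore, hS, sub_dotProduct, sum_smul_dotProduct, sum_smul_dotProduct,
      ← Finset.sum_sub_distrib, Finset.mul_sum]
    refine Finset.sum_le_sum fun j _ => ?_
    rw [← sub_mul, sub_sub_sub_cancel_left, hu, dotProduct_sub]
    exact hF.mul_sq_le_mean_sub_mul (hγ' j) (hγ j)
  have hdual : (S - l) ⬝ᵥ u ≤ Fintype.card ι * ((‖S‖ + ‖l‖) * ‖u‖) := by
    refine (le_abs_self _).trans ((abs_dotProduct_le _ _).trans ?_)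
    gcongr
    exact norm_sub_le _ _
  have hquad : c₀ * κ * ‖u‖ ^ 2 ≤ c₀ * ∑ j, (X j ⬝ᵥ u) ^ 2 := by
    rw [mul_assoc]
    exact mul_le_mul_of_nonneg_left ((mul_le_mul_of_nonneg_left (norm_sq_le_dotProduct_self u)
      hκ).trans (hX u)) hF.pos.le
  rcases (norm_nonneg u).eq_or_lt with h0 | h0
  · rw [← h0]; simp only [mul_zero]; positivity
  · exact le_of_mul_le_mul_right (by linarith) h0

theorem norm_score_expansion_le (hF : CurvatureBounds F c₀)
    (hC : 0 ≤ C) (hXC : ∀ j, ‖X j‖ ≤ C)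
    (hγ : ∀ j, X j ⬝ᵥ γ ∈ F.dom) (hγ' : ∀ j, X j ⬝ᵥ γ' ∈ F.dom)
    (hscore : ∑ j, (z j - F.mean (X j ⬝ᵥ γ')) • X j = l) :
    ‖∑ j, (iteratedDeriv 2 F.a (X j ⬝ᵥ γ) * (X j ⬝ᵥ (γ' - γ))) • X j -
      ∑ j, (z j - F.mean (X j ⬝ᵥ γ)) • X j‖ ≤
      ‖l‖ + Fintype.card J * (C * (c₀⁻¹ * (Fintype.card ι * (C * ‖γ' - γ‖)) ^ 2)) := by
  set u := γ' - γ
  have hc := hF.pos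
  have hXu : ∀ j, X j ⬝ᵥ u = X j ⬝ᵥ γ' - X j ⬝ᵥ γ := fun j => dotProduct_sub _ _ _
  set R : J → ℝ := fun j =>
    F.mean (X j ⬝ᵥ γ') - F.mean (X j ⬝ᵥ γ) - iteratedDeriv 2 F.a (X j ⬝ᵥ γ) * (X j ⬝ᵥ u) with hR
  have hsplit : ∑ j, (iteratedDeriv 2 F.a (X j ⬝ᵥ γ) * (X j ⬝ᵥ u)) • X j -
      ∑ j, (z j - F.mean (X j ⬝ᵥ γ)) • X j = -l - ∑ j, R j • X j := by
    rw [← hscore, ← Finset.sum_sub_distrib, ← Finset.sum_neg_distrib, ← Finset.sum_sub_distrib]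
    refine Finset.sum_congr rfl fun j _ => ?_
    rw [← sub_smul, ← neg_smul, ← sub_smul]
    congr 1
    ring
  have hremainder : ∀ j, |R j| ≤ c₀⁻¹ * (Fintype.card ι * (C * ‖u‖)) ^ 2 := fun j => by
    have habs : |X j ⬝ᵥ u| ≤ Fintype.card ι * (C * ‖u‖) :=
      (abs_dotProduct_le _ _).trans (by gcongr; exact hXC j)
    calc |R j| ≤ c₀⁻¹ * |X j ⬝ᵥ u| ^ 2 := by
          simp only [hR, sq_abs, hXu]
          exact hF.abs_mean_taylor_le (hγ' j) (hγ j)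
      _ ≤ _ := by gcongr
  rw [hsplit]
  refine (norm_sub_le _ _).trans ?_
  rw [norm_neg]
  gcongr
  calc ‖∑ j, R j • X j‖ ≤ ∑ j, ‖R j • X j‖ := norm_sum_le _ _
    _ ≤ ∑ _j : J, C * (c₀⁻¹ * (Fintype.card ι * (C * ‖u‖)) ^ 2) := Finset.sum_le_sum fun j _ => by
        rw [norm_smul, mul_comm]
        exact mul_le_mul (hXC j) (hremainder j) (norm_nonneg _) hC
    _ = _ := by simp

end Score

end CurvatureBounds

/-! ### Moments of the exponential family -/

section Moments

variable {F : ExpFamily} {c₀ η ε r s : ℝ}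

theorem ExpFamily.measurable_density (F : ExpFamily) (η : ℝ) :
    Measurable fun y => ENNReal.ofReal (Real.exp (F.logDensity F.φ η y)) := by
  have := F.measurable_c
  unfold ExpFamily.logDensity
  fun_prop

theorem ExpFamily.isProbabilityMeasure_law (hη : η ∈ F.dom) : IsProbabilityMeasure (F.law η) :=
  ⟨by rw [ExpFamily.law, withDensity_apply _ MeasurableSet.univ, Measure.restrict_univ]
      exact F.normalized η hη⟩

theorem ExpFamily.lintegral_exp_law (hs : η + F.φ * s ∈ F.dom) :
    ∫⁻ y, ENNReal.ofReal (Real.exp (s * y)) ∂(F.law η) =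
      ENNReal.ofReal (Real.exp (F.φ⁻¹ * (F.a (η + F.φ * s) - F.a η))) := by
  -- tilting by `exp (s y)` moves the canonical parameter from `η` to `η + φ s`
  have htilt : ∀ y, ((fun y => ENNReal.ofReal (Real.exp (F.logDensity F.φ η y))) *
      fun y => ENNReal.ofReal (Real.exp (s * y))) y =
      ENNReal.ofReal (Real.exp (F.φ⁻¹ * (F.a (η + F.φ * s) - F.a η))) *
      ENNReal.ofReal (Real.exp (F.logDensity F.φ (η + F.φ * s) y)) := fun y => by
    rw [Pi.mul_apply, ← ENNReal.ofReal_mul (Real.exp_pos _).le,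
      ← ENNReal.ofReal_mul (Real.exp_pos _).le, ← Real.exp_add, ← Real.exp_add]
    congr 2
    simp only [ExpFamily.logDensity]
    have := F.φ_pos.ne'
    field
  rw [ExpFamily.law, lintegral_withDensity_eq_lintegral_mul _ (F.measurable_density η)
    (by fun_prop), lintegral_congr htilt, lintegral_const_mul _ (F.measurable_density _)]
  exact (congrArg _ (F.normalized _ hs)).trans (mul_one _)

theorem ExpFamily.integrable_exp_law (hs : η + F.φ * s ∈ F.dom) :
    Integrable (fun y => Real.exp (s * y)) (F.law η) := by
  refine ⟨by fun_prop, ?_⟩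
  rw [hasFiniteIntegral_iff_ofReal (ae_of_all _ fun y => (Real.exp_pos _).le),
    F.lintegral_exp_law hs]
  exact ENNReal.ofReal_lt_top

theorem ExpFamily.mgf_law (hs : η + F.φ * s ∈ F.dom) :
    mgf id (F.law η) s = Real.exp (F.φ⁻¹ * (F.a (η + F.φ * s) - F.a η)) := by
  rw [mgf, integral_eq_lintegral_of_nonneg_ae (ae_of_all _ fun y => (Real.exp_pos _).le)
    (by fun_prop)]
  simp only [id]
  rw [F.lintegral_exp_law hs, ENNReal.toReal_ofReal (Real.exp_pos _).le]

theorem ExpFamily.eventually_add_mul_mem_dom (hη : η ∈ F.dom) :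
    ∀ᶠ s in 𝓝 0, η + F.φ * s ∈ F.dom := by
  have hcont : Continuous fun s => η + F.φ * s := by fun_prop
  exact hcont.continuousAt.eventually_mem (by simpa using F.isOpen_dom.mem_nhds hη)

theorem ExpFamily.zero_mem_interior_integrableExpSet (hη : η ∈ F.dom) :
    (0 : ℝ) ∈ interior (integrableExpSet id (F.law η)) := by
  rw [mem_interior_iff_mem_nhds]
  filter_upwards [F.eventually_add_mul_mem_dom hη] with s hs using F.integrable_exp_law hs

theorem ExpFamily.memLp_law (hη : η ∈ F.dom) (n : NNReal) : MemLp id n (F.law η) :=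
  memLp_of_mem_interior_integrableExpSet (F.zero_mem_interior_integrableExpSet hη) n

theorem ExpFamily.cgf_law_eventuallyEq (hη : η ∈ F.dom) :
    cgf id (F.law η) =ᶠ[𝓝 0] fun s => F.φ⁻¹ * (F.a (η + F.φ * s) - F.a η) := by
  filter_upwards [F.eventually_add_mul_mem_dom hη] with s hs
  rw [cgf, F.mgf_law hs, Real.log_exp]

theorem ExpFamily.hasDerivAt_add_mul (F : ExpFamily) (η s : ℝ) :
    HasDerivAt (fun s => η + F.φ * s) F.φ s := by
  simpa using ((hasDerivAt_id s).const_mul F.φ).const_add η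

namespace CurvatureBounds

theorem deriv_cgf_law_eventuallyEq (h : CurvatureBounds F c₀) (hη : η ∈ F.dom) :
    deriv (cgf id (F.law η)) =ᶠ[𝓝 0] fun s => F.mean (η + F.φ * s) := by
  refine (F.cgf_law_eventuallyEq hη).deriv.trans ?_
  filter_upwards [F.eventually_add_mul_mem_dom hη] with s hs
  have hderiv := (((h.hasDerivAt hs).comp s (F.hasDerivAt_add_mul η s)).sub_const
    (F.a η)).const_mul F.φ⁻¹
  rw [mul_comm (F.mean _), inv_mul_cancel_left₀ F.φ_pos.ne'] at hderiv
  exact hderiv.deriv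

theorem integral_law (h : CurvatureBounds F c₀) (hη : η ∈ F.dom) :
    ∫ y, y ∂(F.law η) = F.mean η := by
  have := F.isProbabilityMeasure_law hη
  have hcgf := deriv_cgf_zero (F.zero_mem_interior_integrableExpSet hη)
  rw [(h.deriv_cgf_law_eventuallyEq hη).self_of_nhds] at hcgf
  simpa using hcgf.symm

theorem integral_sub_mean_sq_law (h : CurvatureBounds F c₀) (hη : η ∈ F.dom) :
    ∫ y, (y - F.mean η) ^ 2 ∂(F.law η) = F.φ * iteratedDeriv 2 F.a η := by
  have := F.isProbabilityMeasure_law hη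
  have hcgf := iteratedDeriv_two_cgf_eq_integral (F.zero_mem_interior_integrableExpSet hη)
  have hmean : HasDerivAt F.mean (iteratedDeriv 2 F.a η) (η + F.φ * 0) := by
    simpa using h.hasDerivAt_mean hη
  rw [iteratedDeriv_succ, iteratedDeriv_one, (h.deriv_cgf_law_eventuallyEq hη).deriv_eq,
    (h.deriv_cgf_law_eventuallyEq hη).self_of_nhds] at hcgf
  have hderiv := (hmean.comp (0 : ℝ) (F.hasDerivAt_add_mul η 0)).deriv
  simp only [Function.comp_def] at hderiv
  rw [hderiv] at hcgf
  simp only [mul_zero, add_zero, id, zero_mul, Real.exp_zero, mul_one, mgf_zero, div_one] at hcgf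
  rw [← hcgf, mul_comm]

theorem integral_exp_mul_sub_mean_le (h : CurvatureBounds F c₀) (hη : η ∈ F.dom)
    (hs : η + F.φ * s ∈ F.dom) :
    ∫ y, Real.exp (s * (y - F.mean η)) ∂(F.law η) ≤ Real.exp (c₀⁻¹ * F.φ * s ^ 2) := by
  have hφ := F.φ_pos
  have hmgf : ∫ y, Real.exp (s * y) ∂(F.law η) = _ := F.mgf_law hs
  simp_rw [mul_sub, Real.exp_sub]
  rw [integral_div, hmgf, ← Real.exp_sub, Real.exp_le_exp]
  have htaylor := mul_le_mul_of_nonneg_left (h.cumulant_taylor_le hs hη) (inv_nonneg.2 hφ.le)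
  rw [add_sub_cancel_left, mul_sub, mul_left_comm F.φ⁻¹ (F.mean η),
    inv_mul_cancel_left₀ hφ.ne'] at htaylor
  calc F.φ⁻¹ * (F.a (η + F.φ * s) - F.a η) - s * F.mean η
      ≤ F.φ⁻¹ * (c₀⁻¹ * (F.φ * s) ^ 2) := by linarith
    _ = c₀⁻¹ * F.φ * s ^ 2 := by field

theorem integral_abs_sub_mean_pow_three_le (h : CurvatureBounds F c₀)
    (hε : Metric.ball η ε ⊆ F.dom) (hr0 : 0 < r) (hr : F.φ * r < ε) :
    ∫ y, |y - F.mean η| ^ 3 ∂(F.law η) ≤ 6 / r ^ 3 * (2 * Real.exp (c₀⁻¹ * F.φ * r ^ 2)) := by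
  have hmem : ∀ s, |s| ≤ r → η + F.φ * s ∈ F.dom := fun s hs => hε <| by
    rw [Metric.mem_ball, Real.dist_eq, add_sub_cancel_left, abs_mul, abs_of_pos F.φ_pos]
    exact (mul_le_mul_of_nonneg_left hs F.φ_pos.le).trans_lt hr
  have hη : η ∈ F.dom := by simpa using hmem 0 (by simpa using hr0.le)
  have hpos : η + F.φ * r ∈ F.dom := hmem r (abs_of_pos hr0).le
  have hneg : η + F.φ * -r ∈ F.dom := hmem (-r) (by rw [abs_neg, abs_of_pos hr0])
  have hint : ∀ {s}, η + F.φ * s ∈ F.dom →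
      Integrable (fun y => Real.exp (s * (y - F.mean η))) (F.law η) := fun hs => by
    simp_rw [mul_sub, Real.exp_sub]
    exact (F.integrable_exp_law hs).div_const _
  have hpt : ∀ y, |y - F.mean η| ^ 3 ≤
      6 / r ^ 3 * (Real.exp (r * (y - F.mean η)) + Real.exp (-r * (y - F.mean η))) := fun y => by
    have hcube := Real.pow_div_factorial_le_exp |r * (y - F.mean η)| (abs_nonneg _) 3
    have hexp := hcube.trans (Real.exp_abs_le _)
    rw [abs_mul, abs_of_pos hr0, mul_pow] at hexp
    norm_num [Nat.factorial] at hexp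
    rw [div_mul_eq_mul_div, le_div_iff₀ (by positivity), neg_mul]
    linarith
  refine (integral_mono_of_nonneg (ae_of_all _ fun y => by positivity)
    (((hint hpos).add (hint hneg)).const_mul _) (ae_of_all _ hpt)).trans ?_
  simp only [Pi.add_apply]
  rw [integral_const_mul, integral_add (hint hpos) (hint hneg), two_mul]
  gcongr
  · exact h.integral_exp_mul_sub_mean_le hη hpos
  · exact (h.integral_exp_mul_sub_mean_le hη hneg).trans_eq (by rw [neg_sq])

end CurvatureBounds

end Moments

/-! ### Weighted sums of residuals -/

theorem integral_sum_sq_of_iIndepFun {Ω ι : Type*} [MeasurableSpace Ω] {P : Measure Ω}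
    [IsProbabilityMeasure P] [Fintype ι] {Y : ι → Ω → ℝ} (hindep : iIndepFun Y P)
    (hmem : ∀ k, MemLp (Y k) 2 P) (hmean : ∀ k, ∫ ω, Y k ω ∂P = 0) :
    ∫ ω, (∑ k, Y k ω) ^ 2 ∂P = ∑ k, ∫ ω, Y k ω ^ 2 ∂P := by
  have hsum := memLp_finsetSum' Finset.univ fun k _ => hmem k
  have hsum_mean : ∫ ω, (∑ k, Y k) ω ∂P = 0 := by
    simp_rw [Finset.sum_apply]
    rw [integral_finsetSum _ fun k _ => (hmem k).integrable (by norm_num)]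
    exact Finset.sum_eq_zero fun k _ => hmean k
  have hvar := IndepFun.variance_sum (s := Finset.univ) (fun k _ => hmem k)
    (fun i _ j _ hij => hindep.indepFun hij)
  rw [variance_of_integral_eq_zero hsum.aestronglyMeasurable.aemeasurable hsum_mean] at hvar
  simp_rw [Finset.sum_apply] at hvar
  rw [hvar]
  exact Finset.sum_congr rfl fun k _ =>
    variance_of_integral_eq_zero (hmem k).aestronglyMeasurable.aemeasurable (hmean k)

/-- The index set of the observations of stage `t`. -/
abbrev Design.Obs {p : ℕ} (d : Design p) (t : ℕ) : Type := Σ i : Fin (d.m t), Fin (d.n t i)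

section Residuals

variable {p : ℕ} {d : Design p} {F : ExpFamily} {β : Fin p → ℝ}
  {b : ℕ → EuclideanSpace ℝ (Fin p)} {Ω : Type*} [MeasurableSpace Ω] {P : Measure Ω}
  {y : ℕ → ℕ → ℕ → Ω → ℝ} {c₀ ε r : ℝ} {t : ℕ}

variable (d F β b y) in
/-- The residual `y_ij - μ_ij` of an observation at the true linear predictor. -/
def resid (t i j : ℕ) (ω : Ω) : ℝ := y t i j ω - F.mean (etaTrue d β b t i j)

variable (d F β b) in
/-- The variance `φ a''(η_ij)` of an observation. -/
def obsVar (t i j : ℕ) : ℝ := F.φ * iteratedDeriv 2 F.a (etaTrue d β b t i j)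

theorem obsVar_le (hF : CurvatureBounds F c₀) {i j : ℕ} (h : etaTrue d β b t i j ∈ F.dom) :
    obsVar d F β b t i j ≤ F.φ * c₀⁻¹ :=
  mul_le_mul_of_nonneg_left (hF.upper _ h) F.φ_pos.le

theorem le_obsVar (hF : CurvatureBounds F c₀) {i j : ℕ} (h : etaTrue d β b t i j ∈ F.dom) :
    F.φ * c₀ ≤ obsVar d F β b t i j :=
  mul_le_mul_of_nonneg_left (hF.lower _ h) F.φ_pos.le

namespace ResponseModel

theorem iIndepFun_mul_resid (hy : ResponseModel d F β b P y) (w : d.Obs t → ℝ) :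
    iIndepFun (fun (s : d.Obs t) ω => w s * resid d F β b y t s.1 s.2 ω) P :=
  (hy.indep t).comp (fun s x => w s * (x - F.mean (etaTrue d β b t s.1 s.2)))
    (fun _ => by fun_prop)

theorem integral_comp_resid (hy : ResponseModel d F β b P y) (s : d.Obs t) {f : ℝ → ℝ}
    (hf : Measurable f) :
    ∫ ω, f (resid d F β b y t s.1 s.2 ω) ∂P =
      ∫ z, f (z - F.mean (etaTrue d β b t s.1 s.2)) ∂(F.law (etaTrue d β b t s.1 s.2)) :=
  (hy.law t s.1 s.1.2 s.2 s.2.2).integral_comp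
    (f := fun z => f (z - F.mean (etaTrue d β b t s.1 s.2)))
    (hf.comp (measurable_id.sub_const _)).aestronglyMeasurable

theorem integral_resid_sq (hF : CurvatureBounds F c₀) (hy : ResponseModel d F β b P y)
    {s : d.Obs t} (h : etaTrue d β b t s.1 s.2 ∈ F.dom) :
    ∫ ω, resid d F β b y t s.1 s.2 ω ^ 2 ∂P = obsVar d F β b t s.1 s.2 :=
  (hy.integral_comp_resid s (f := fun x => x ^ 2) (by fun_prop)).trans
    (hF.integral_sub_mean_sq_law h)

theorem integral_mul_resid_sq (hF : CurvatureBounds F c₀) (hy : ResponseModel d F β b P y)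
    {s : d.Obs t} (h : etaTrue d β b t s.1 s.2 ∈ F.dom) (w : ℝ) :
    ∫ ω, (w * resid d F β b y t s.1 s.2 ω) ^ 2 ∂P = w ^ 2 * obsVar d F β b t s.1 s.2 := by
  simp_rw [mul_pow]
  rw [integral_const_mul, hy.integral_resid_sq hF h]

theorem integral_resid (hF : CurvatureBounds F c₀) (hy : ResponseModel d F β b P y)
    {s : d.Obs t} (h : etaTrue d β b t s.1 s.2 ∈ F.dom) :
    ∫ ω, resid d F β b y t s.1 s.2 ω ∂P = 0 := by
  have := F.isProbabilityMeasure_law h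
  have hid : Integrable (fun z : ℝ => z) (F.law (etaTrue d β b t s.1 s.2)) :=
    (F.memLp_law h 1).integrable le_rfl
  refine (hy.integral_comp_resid s (f := fun x => x) (by fun_prop)).trans ?_
  rw [integral_sub hid (integrable_const _), hF.integral_law h]
  simp

theorem integral_mul_resid (hF : CurvatureBounds F c₀) (hy : ResponseModel d F β b P y)
    {s : d.Obs t} (h : etaTrue d β b t s.1 s.2 ∈ F.dom) (w : ℝ) :
    ∫ ω, w * resid d F β b y t s.1 s.2 ω ∂P = 0 := by
  rw [integral_const_mul, hy.integral_resid hF h, mul_zero]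

theorem integral_abs_mul_resid_pow_three_le (hF : CurvatureBounds F c₀)
    (hy : ResponseModel d F β b P y) {s : d.Obs t}
    (hε : Metric.ball (etaTrue d β b t s.1 s.2) ε ⊆ F.dom) (hr0 : 0 < r) (hr : F.φ * r < ε)
    {w δ : ℝ} (hw : |w| ≤ δ) :
    ∫ ω, |w * resid d F β b y t s.1 s.2 ω| ^ 3 ∂P ≤
      δ * (6 / r ^ 3 * (2 * Real.exp (c₀⁻¹ * F.φ * r ^ 2)) / (F.φ * c₀)) *
        (w ^ 2 * obsVar d F β b t s.1 s.2) := by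
  set K := 6 / r ^ 3 * (2 * Real.exp (c₀⁻¹ * F.φ * r ^ 2))
  have hφ := F.φ_pos
  have hc := hF.pos
  have hη : etaTrue d β b t s.1 s.2 ∈ F.dom :=
    hε (Metric.mem_ball_self ((mul_pos hφ hr0).trans hr))
  have hthird : ∫ ω, |resid d F β b y t s.1 s.2 ω| ^ 3 ∂P ≤ K :=
    (hy.integral_comp_resid s (f := fun x => |x| ^ 3) (by fun_prop)).trans_le
      (hF.integral_abs_sub_mean_pow_three_le hε hr0 hr)
  have hδ : 0 ≤ δ := (abs_nonneg w).trans hw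
  simp_rw [abs_mul, mul_pow]
  rw [integral_const_mul]
  calc |w| ^ 3 * ∫ ω, |resid d F β b y t s.1 s.2 ω| ^ 3 ∂P
      ≤ δ * w ^ 2 * K := by
        rw [pow_succ', sq_abs]
        gcongr
    _ = δ * (K / (F.φ * c₀)) * (w ^ 2 * (F.φ * c₀)) := by field
    _ ≤ _ := by gcongr; exact le_obsVar hF hη

variable [IsProbabilityMeasure P]

theorem memLp_mul_resid (hy : ResponseModel d F β b P y) {s : d.Obs t}
    (h : etaTrue d β b t s.1 s.2 ∈ F.dom) (w : ℝ) (n : NNReal) :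
    MemLp (fun ω => w * resid d F β b y t s.1 s.2 ω) n P := by
  have hl := hy.law t s.1 s.1.2 s.2 s.2.2
  have hmap : MemLp id n (P.map (y t s.1 s.2)) := by
    rw [hl.map_eq]; exact F.memLp_law h n
  exact (((memLp_map_measure_iff (by fun_prop) hl.aemeasurable).1 hmap).sub
    (memLp_const _)).const_mul w

theorem memLp_sum_mul_resid (hy : ResponseModel d F β b P y)
    (h : ∀ s : d.Obs t, etaTrue d β b t s.1 s.2 ∈ F.dom) (w : d.Obs t → ℝ) :
    MemLp (fun ω => ∑ s, w s * resid d F β b y t s.1 s.2 ω) 2 P :=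
  memLp_finsetSum _ fun s _ => hy.memLp_mul_resid (h s) (w s) 2

theorem integral_sum_mul_resid_sq (hF : CurvatureBounds F c₀) (hy : ResponseModel d F β b P y)
    (h : ∀ s : d.Obs t, etaTrue d β b t s.1 s.2 ∈ F.dom) (w : d.Obs t → ℝ) :
    ∫ ω, (∑ s, w s * resid d F β b y t s.1 s.2 ω) ^ 2 ∂P =
      ∑ s, w s ^ 2 * obsVar d F β b t s.1 s.2 := by
  rw [integral_sum_sq_of_iIndepFun (hy.iIndepFun_mul_resid w)
    (fun s => hy.memLp_mul_resid (h s) (w s) 2) fun s => hy.integral_mul_resid hF (h s) (w s)]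
  exact Finset.sum_congr rfl fun s _ => hy.integral_mul_resid_sq hF (h s) (w s)

theorem tendsto_charFun_sum_mul_resid (hF : CurvatureBounds F c₀) (hε : 0 < ε)
    (hint : ∀ t, ∀ i < d.m t, ∀ j < d.n t i, Metric.ball (etaTrue d β b t i j) ε ⊆ F.dom)
    (hy : ResponseModel d F β b P y) {w : ∀ t, d.Obs t → ℝ} {σ : ℝ}
    (hmax : ∀ δ > 0, ∀ᶠ t in atTop, ∀ s, |w t s| ≤ δ)
    (hvar : Tendsto (fun t => ∑ s : d.Obs t, w t s ^ 2 * obsVar d F β b t s.1 s.2)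
      atTop (𝓝 σ)) (τ : ℝ) :
    Tendsto (fun t => charFun (P.map fun ω => ∑ s, w t s * resid d F β b y t s.1 s.2 ω) τ)
      atTop (𝓝 (Real.exp (-(τ ^ 2 * σ / 2)) : ℂ)) := by
  have hφ := F.φ_pos
  have hball : ∀ t (s : d.Obs t), Metric.ball (etaTrue d β b t s.1 s.2) ε ⊆ F.dom :=
    fun t s => hint t s.1 s.1.2 s.2 s.2.2
  have hdom : ∀ t (s : d.Obs t), etaTrue d β b t s.1 s.2 ∈ F.dom :=
    fun t s => hball t s (Metric.mem_ball_self hε)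
  refine tendsto_charFun_map_sum_of_lyapunov (fun t => hy.iIndepFun_mul_resid (w t))
    (fun t s => hy.memLp_mul_resid (hdom t s) (w t s) 3)
    (fun t s => hy.integral_mul_resid hF (hdom t s) (w t s)) ?_ ?_ τ
  · exact hvar.congr fun t => Finset.sum_congr rfl fun s _ =>
      (hy.integral_mul_resid_sq hF (hdom t s) (w t s)).symm
  set r := ε / (2 * F.φ)
  have hr0 : 0 < r := by positivity
  have hr : F.φ * r < ε := by
    rw [show F.φ * r = ε / 2 by simp only [r]; field]
    exact half_lt_self hε
  set K := 6 / r ^ 3 * (2 * Real.exp (c₀⁻¹ * F.φ * r ^ 2)) / (F.φ * c₀)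
  have hbound : ∀ δ > 0, ∀ᶠ t in atTop,
      ∑ s : d.Obs t, ∫ ω, |w t s * resid d F β b y t s.1 s.2 ω| ^ 3 ∂P ≤
        δ * K * ∑ s : d.Obs t, w t s ^ 2 * obsVar d F β b t s.1 s.2 := fun δ hδ => by
    filter_upwards [hmax δ hδ] with t ht
    rw [Finset.mul_sum]
    exact Finset.sum_le_sum fun s _ =>
      hy.integral_abs_mul_resid_pow_three_le hF (hball t s) hr0 hr (ht s)
  refine tendsto_order.2 ⟨fun a ha => Eventually.of_forall fun t => ha.trans_le
    (Finset.sum_nonneg fun s _ => integral_nonneg fun ω => by positivity), fun a ha => ?_⟩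
  obtain ⟨δ, hδa, hδ⟩ : ∃ δ, δ * K * σ < a ∧ 0 < δ := by
    have hcont : Continuous fun δ : ℝ => δ * K * σ := by fun_prop
    exact (((hcont.tendsto 0).eventually_lt_const (by simpa using ha)).filter_mono
      nhdsWithin_le_nhds |>.and self_mem_nhdsWithin).exists (f := 𝓝[>] (0 : ℝ))
  filter_upwards [hbound δ hδ, (hvar.const_mul (δ * K)).eventually_lt_const hδa] with t h1 h2
  exact h1.trans_lt h2

end ResponseModel

end Residuals

/-! ### Independent and identically distributed random effects -/

theorem ae_exists_sum_norm_le_mul {E : Type*} [NormedAddCommGroup E] [MeasurableSpace E]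
    [BorelSpace E] {μ : Measure E} [IsProbabilityMeasure μ] (hμ : Integrable id μ) :
    ∀ᵐ b ∂(Measure.infinitePi fun _ : ℕ => μ),
      ∃ C : ℝ, ∀ M : ℕ, ∑ i ∈ Finset.range M, ‖b i‖ ≤ C * M := by
  have heval : ∀ i : ℕ, MeasurePreserving (fun b : ℕ → E => b i)
      (Measure.infinitePi fun _ : ℕ => μ) μ := fun i => measurePreserving_eval_infinitePi _ i
  have hident : ∀ i, IdentDistrib (fun b : ℕ → E => b i) (fun b => b 0)
      (Measure.infinitePi fun _ : ℕ => μ) (Measure.infinitePi fun _ : ℕ => μ) := fun i =>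
    ⟨(heval i).measurable.aemeasurable, (heval 0).measurable.aemeasurable,
      (heval i).map_eq.trans (heval 0).map_eq.symm⟩
  have hint : Integrable (fun b : ℕ → E => ‖b 0‖) (Measure.infinitePi fun _ : ℕ => μ) :=
    (heval 0).integrable_comp_of_integrable (g := fun x => ‖x‖) hμ.norm
  have hindep : iIndepFun (fun (i : ℕ) (b : ℕ → E) => ‖b i‖)
      (Measure.infinitePi fun _ : ℕ => μ) :=
    iIndepFun_infinitePi (X := fun _ x => ‖x‖) fun _ => measurable_norm
  filter_upwards [strong_law_ae_real _ hint (fun i j hij => hindep.indepFun hij)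
    fun i => (hident i).comp measurable_norm] with b hb
  obtain ⟨C, hC⟩ := hb.bddAbove_range
  refine ⟨C, fun M => ?_⟩
  rcases Nat.eq_zero_or_pos M with rfl | hM
  · simp
  · exact (div_le_iff₀ (by exact_mod_cast hM)).1 (hC (Set.mem_range_self M))

theorem ae_cond3_of_integrable {p : ℕ} (d : Design p) {F : ExpFamily} (β : Fin p → ℝ)
    (hdom : F.dom = Set.univ) {μ : Measure (EuclideanSpace ℝ (Fin p))} [IsProbabilityMeasure μ]
    (hμ : Integrable id μ) :
    ∀ᵐ b ∂(Measure.infinitePi fun _ : ℕ => μ), Cond3 d F β b := by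
  filter_upwards [ae_exists_sum_norm_le_mul hμ] with b hb
  exact ⟨⟨1, one_pos, fun _ _ _ _ _ => hdom ▸ Set.subset_univ _⟩, hb⟩

/-! ### First-order conditions -/

section FirstOrder

variable {p : ℕ} {d : Design p} {F : ExpFamily} {c₀ : ℝ} {t : ℕ}

theorem eta_add_smul (θ h : Param p (d.m t)) (s : ℝ) (i : Fin (d.m t)) (j : ℕ) :
    eta d (θ + s • h) i j = eta d θ i j + s * eta d h i j := by
  have hfixed : (θ + s • h).fixed = θ.fixed + s • h.fixed := rfl
  have hrandom : (θ + s • h).random i = θ.random i + s • h.random i := rfl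
  simp only [eta, hfixed, hrandom, dotProduct_add, dotProduct_smul, smul_eq_mul]
  ring

theorem eventually_add_smul_mem_feasible {θ : Param p (d.m t)} (hθ : θ ∈ feasible d F t)
    (h : Param p (d.m t)) : ∀ᶠ s in 𝓝 (0 : ℝ), θ + s • h ∈ feasible d F t := by
  simp only [feasible, Set.mem_ofPred_eq, eventually_all, eta_add_smul]
  intro i j
  have hcont : Continuous fun s : ℝ => eta d θ i j + s * eta d h i j := by fun_prop
  exact hcont.continuousAt.eventually_mem
    (F.isOpen_dom.mem_nhds (by simpa using hθ i j))

theorem CurvatureBounds.hasDerivAt_logDensity (hF : CurvatureBounds F c₀) {η : ℝ}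
    (hη : η ∈ F.dom) (ψ z : ℝ) :
    HasDerivAt (fun x => F.logDensity ψ x z) (ψ⁻¹ * (z - F.mean η)) η := by
  simpa [ExpFamily.logDensity] using
    ((((hasDerivAt_id η).const_mul z).sub (hF.hasDerivAt hη)).const_mul ψ⁻¹).add_const (F.c z ψ)

theorem hasDerivAt_objective_add_smul (hF : CurvatureBounds F c₀)
    {G : Matrix (Fin p) (Fin p) ℝ} (hG : G.IsSymm) {θ : Param p (d.m t)}
    (hθ : θ ∈ feasible d F t) (z : ℕ → ℕ → ℝ) (ψ : ℝ) (h : Param p (d.m t)) :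
    HasDerivAt (fun s : ℝ => objective d F z G ψ (θ + s • h))
      ((∑ i : Fin (d.m t), ∑ j : Fin (d.n t i),
        ψ⁻¹ * (z i j - F.mean (eta d θ i j)) * eta d h i j) -
        (1 / 2) * ∑ i : Fin (d.m t), 2 * (h.random i ⬝ᵥ (G⁻¹ *ᵥ θ.random i))) 0 := by
  refine HasDerivAt.sub (HasDerivAt.fun_sum fun i _ => HasDerivAt.fun_sum fun j _ => ?_)
    (HasDerivAt.const_mul _ (HasDerivAt.fun_sum fun i _ =>
      hasDerivAt_dotProduct_mulVec_self hG.inv _ _))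
  simp_rw [eta_add_smul]
  have hline : HasDerivAt (fun s : ℝ => eta d θ i j + s * eta d h i j) (eta d h i j) 0 := by
    simpa using ((hasDerivAt_id (0 : ℝ)).mul_const (eta d h i j)).const_add (eta d θ i j)
  exact (hF.hasDerivAt_logDensity (hθ i j) ψ (z i j)).comp_of_eq 0 hline (by simp)

namespace IsPQLEstimate

variable {z : ℕ → ℕ → ℝ} {G : Matrix (Fin p) (Fin p) ℝ} {ψ : ℝ} {θ : Param p (d.m t)}

theorem sum_score_mul_eta (hF : CurvatureBounds F c₀) (hG : G.IsSymm)
    (hθ : IsPQLEstimate d F z G ψ θ) (h : Param p (d.m t)) :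
    ∑ i : Fin (d.m t), ∑ j : Fin (d.n t i), ψ⁻¹ * (z i j - F.mean (eta d θ i j)) * eta d h i j =
      ∑ i : Fin (d.m t), h.random i ⬝ᵥ (G⁻¹ *ᵥ θ.random i) := by
  have hmax : IsLocalMax (fun s : ℝ => objective d F z G ψ (θ + s • h)) 0 := by
    filter_upwards [eventually_add_smul_mem_feasible hθ.1 h] with s hs
    simpa using hθ.2 hs
  have hderiv := hmax.hasDerivAt_eq_zero (hasDerivAt_objective_add_smul hF hG hθ.1 z ψ h)
  rw [← Finset.mul_sum] at hderiv
  linarith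

theorem score_eq (hF : CurvatureBounds F c₀) (hG : G.IsSymm) (hψ : ψ ≠ 0)
    (hθ : IsPQLEstimate d F z G ψ θ) (i : Fin (d.m t)) :
    ∑ j : Fin (d.n t i), (z i j - F.mean (eta d θ i j)) • d.x t i j =
      ψ • (G⁻¹ *ᵥ θ.random i) := by
  ext k
  let v : Param p (d.m t) :=
    fun s => if s.2 = some i then (Pi.single k 1 : Fin p → ℝ) s.1 else 0
  have hfixed : v.fixed = 0 := by ext l; simp [Param.fixed, v]
  have hrandom : v.random i = Pi.single k 1 := by ext l; simp [Param.random, v]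
  have hother : ∀ i', i' ≠ i → v.random i' = 0 := fun i' hi => by
    ext l; simp [Param.random, v, hi]
  have h := hθ.sum_score_mul_eta hF hG v
  rw [Finset.sum_eq_single_of_mem i (Finset.mem_univ i) fun i' _ hi => by
      simp [eta, hfixed, hother i' hi],
    Finset.sum_eq_single_of_mem i (Finset.mem_univ i) fun i' _ hi => by simp [hother i' hi]] at h
  have hv : ∀ j, eta d v i j = d.x t i j k := fun j => by simp [eta, hfixed, hrandom]
  simp only [hv, hrandom, single_one_dotProduct, mul_assoc, ← Finset.mul_sum] at h
  simp only [Finset.sum_apply, Pi.smul_apply, smul_eq_mul]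
  rw [← h, mul_inv_cancel_left₀ hψ]

/-- Moving all random effects by the same vector and the fixed effects by its opposite changes no
linear predictor, hence only the penalty. -/
theorem sum_random (hF : CurvatureBounds F c₀) (hG : G.PosDef)
    (hθ : IsPQLEstimate d F z G ψ θ) : ∑ i, θ.random i = 0 := by
  have hsymm : G.IsSymm := (conjTranspose_eq_transpose_of_trivial G).symm.trans hG.1
  have hzero : G⁻¹ *ᵥ ∑ i, θ.random i = 0 := by
    ext k
    let v : Param p (d.m t) := fun s => oneStar s.2 * (Pi.single k 1 : Fin p → ℝ) s.1
    have hfixed : v.fixed = -Pi.single k 1 := by ext l; simp [Param.fixed, v, oneStar]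
    have hrandom : ∀ i, v.random i = Pi.single k 1 := fun i => by
      ext l; simp [Param.random, v, oneStar]
    have h := hθ.sum_score_mul_eta hF hsymm v
    simp only [eta, hfixed, hrandom, dotProduct_neg, neg_add_cancel, mul_zero,
      Finset.sum_const_zero, single_one_dotProduct] at h
    rw [mulVec_sum, Finset.sum_apply, ← h, Pi.zero_apply]
  have hdet : IsUnit G.det := (isUnit_iff_isUnit_det _).1 hG.isUnit
  simpa [mulVec_mulVec, mul_nonsing_inv _ hdet] using congrArg (G *ᵥ ·) hzero

end IsPQLEstimate

end FirstOrder

/-! ### Leading terms of the errors -/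

section Stage

variable {p : ℕ} {d : Design p} {F : ExpFamily} {β : Fin p → ℝ}
  {b : ℕ → EuclideanSpace ℝ (Fin p)} {Ω : Type*}
  {y : ℕ → ℕ → ℕ → Ω → ℝ} {c₀ c₁ C₁ C₂ : ℝ} {t : ℕ}

variable (d F β b) in
/-- The non-asymptotic content of the growth regime and of (C2), (C3) at one stage `t`, with named
constants; it holds for all large `t` by `eventually_stageBounds`. -/
structure StageBounds (c₁ C₁ C₂ : ℝ) (t : ℕ) : Prop where
  c_pos : 0 < c₁
  C_nonneg : 0 ≤ C₁
  one_le_m : 1 ≤ d.m t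
  m_le : d.m t ≤ d.nL t
  size_le : ∀ i < d.m t, (d.n t i : ℝ) ≤ C₂ * d.nL t
  x_le : ∀ i < d.m t, ∀ j < d.n t i, ‖d.x t i j‖ ≤ C₁
  dom : ∀ i < d.m t, ∀ j < d.n t i, etaTrue d β b t i j ∈ F.dom
  eig : ∀ i < d.m t, EigenvaluesWithin c₁ (H d F β b t i)

theorem eventually_stageBounds {K₀ : Matrix (Fin p) (Fin p) ℝ} {K : ℕ → Matrix (Fin p) (Fin p) ℝ}
    (hreg : d.Regime) (h2 : Cond2 d F β b K₀ K) (h3 : Cond3 d F β b) :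
    ∃ c₁ C₁ C₂, ∀ᶠ t in atTop, StageBounds d F β b c₁ C₁ C₂ t := by
  obtain ⟨C₁, hC₁⟩ := h2.bounded
  obtain ⟨c₁, hc₁, heig, -⟩ := h2.eigenvalues
  obtain ⟨C₂, hC₂⟩ := hreg.balanced
  obtain ⟨ε, hε, hint⟩ := h3.interior
  refine ⟨c₁, max C₁ 0, C₂, ?_⟩
  filter_upwards [hreg.m_tendsto.eventually_ge_atTop 1, hreg.nL_tendsto.eventually_ge_atTop 1,
    hreg.ratio.eventually_lt_const one_pos, heig, hC₂] with t hm hn hratio heig hsize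
  refine ⟨hc₁, le_max_right _ _, hm, ?_, hsize, fun i hi j hj => ?_,
    fun i hi j hj => hint t i hi j hj (Metric.mem_ball_self hε), heig⟩
  · rw [div_lt_one (by exact_mod_cast hn)] at hratio
    exact_mod_cast hratio.le
  · exact (hC₁ t i hi j hj).le.trans (le_max_left _ _)

namespace StageBounds

theorem one_le_nL (h : StageBounds d F β b c₁ C₁ C₂ t) : (1 : ℝ) ≤ d.nL t := by
  exact_mod_cast h.one_le_m.trans h.m_le

theorem nL_pos (h : StageBounds d F β b c₁ C₁ C₂ t) : (0 : ℝ) < d.nL t :=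
  one_pos.trans_le h.one_le_nL

theorem m_pos (h : StageBounds d F β b c₁ C₁ C₂ t) : (0 : ℝ) < d.m t := by
  exact_mod_cast h.one_le_m

end StageBounds

theorem nL_le_n (d : Design p) {t : ℕ} (i : Fin (d.m t)) : (d.nL t : ℝ) ≤ d.n t i := by
  exact_mod_cast ciInf_le (OrderBot.bddBelow _) i

namespace StageBounds

theorem n_pos (h : StageBounds d F β b c₁ C₁ C₂ t) (i : Fin (d.m t)) : (0 : ℝ) < d.n t i :=
  h.nL_pos.trans_le (nL_le_n d i)

theorem C₂_pos (h : StageBounds d F β b c₁ C₁ C₂ t) : 0 < C₂ :=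
  pos_of_mul_pos_left ((h.n_pos ⟨0, h.one_le_m⟩).trans_le (h.size_le 0 h.one_le_m)) h.nL_pos.le

theorem N_le (h : StageBounds d F β b c₁ C₁ C₂ t) : (d.N t : ℝ) ≤ C₂ * (d.m t * d.nL t) := by
  rw [Design.N, Nat.cast_sum]
  calc ∑ i : Fin (d.m t), (d.n t i : ℝ) ≤ ∑ _i : Fin (d.m t), C₂ * d.nL t :=
        Finset.sum_le_sum fun i _ => h.size_le i i.2
    _ = C₂ * (d.m t * d.nL t) := by
        rw [Finset.sum_const, Finset.card_univ, Fintype.card_fin, nsmul_eq_mul]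
        ring

end StageBounds

variable (d F β b) in
/-- The normalised information matrix `n_i⁻¹ X_iᵀ W_i X_i` of cluster `i`, whose inverse is
`H d F β b t i`. -/
def info (t i : ℕ) : Matrix (Fin p) (Fin p) ℝ :=
  (d.n t i : ℝ)⁻¹ • ((d.X t i)ᵀ * weight d F β b F.φ t i * d.X t i)

theorem info_mulVec (t i : ℕ) (u : Fin p → ℝ) :
    info d F β b t i *ᵥ u = ((d.n t i : ℝ) * F.φ)⁻¹ •
      ∑ j : Fin (d.n t i), (iteratedDeriv 2 F.a (etaTrue d β b t i j) * (d.x t i j ⬝ᵥ u)) •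
        d.x t i j := by
  have hX : ((d.X t i)ᵀ * weight d F β b F.φ t i * d.X t i) *ᵥ u = F.φ⁻¹ •
      ∑ j : Fin (d.n t i), (iteratedDeriv 2 F.a (etaTrue d β b t i j) * (d.x t i j ⬝ᵥ u)) •
        d.x t i j := by
    rw [← mulVec_mulVec, ← mulVec_mulVec, weight, smul_mulVec, mulVec_smul]
    congr 1
    ext k
    simp only [mulVec, dotProduct, transpose_apply, Finset.sum_apply,
      Pi.smul_apply, smul_eq_mul]
    refine Finset.sum_congr rfl fun j _ => ?_
    rw [← dotProduct, ← mulVec, mulVec_diagonal]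
    simp only [Design.X, of_apply]
    rw [mul_comm]
  rw [info, smul_mulVec, hX, smul_smul, mul_inv]

theorem dotProduct_info_mulVec (t i : ℕ) (u : Fin p → ℝ) :
    u ⬝ᵥ (info d F β b t i *ᵥ u) = ((d.n t i : ℝ) * F.φ)⁻¹ *
      ∑ j : Fin (d.n t i), iteratedDeriv 2 F.a (etaTrue d β b t i j) * (d.x t i j ⬝ᵥ u) ^ 2 := by
  rw [info_mulVec, dotProduct_smul, smul_eq_mul, dotProduct_comm, sum_smul_dotProduct]
  congr 1
  exact Finset.sum_congr rfl fun j _ => by ring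

namespace StageBounds

theorem H_mul_info (h : StageBounds d F β b c₁ C₁ C₂ t) (i : Fin (d.m t)) :
    H d F β b t i * info d F β b t i = 1 :=
  EigenvaluesWithin.inv_mul_cancel (M := info d F β b t i) (h.eig i i.2) h.c_pos

theorem info_mulVec_H_mulVec (h : StageBounds d F β b c₁ C₁ C₂ t) (i : Fin (d.m t))
    (u : Fin p → ℝ) : info d F β b t i *ᵥ (H d F β b t i *ᵥ u) = u := by
  rw [mulVec_mulVec, mul_eq_one_comm.1 (h.H_mul_info i), one_mulVec]

theorem mul_dotProduct_self_le (h : StageBounds d F β b c₁ C₁ C₂ t) (hF : CurvatureBounds F c₀)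
    (i : Fin (d.m t)) (u : Fin p → ℝ) :
    c₀ * F.φ * c₁ * d.n t i * (u ⬝ᵥ u) ≤ ∑ j : Fin (d.n t i), (d.x t i j ⬝ᵥ u) ^ 2 := by
  have hφ := F.φ_pos
  have hc := hF.pos
  have hn := h.n_pos i
  have hinfo : c₁ * (u ⬝ᵥ u) ≤ u ⬝ᵥ (info d F β b t i *ᵥ u) :=
    EigenvaluesWithin.mul_dotProduct_self_le_of_inv (h.eig i i.2) h.c_pos u
  have hcurv : ∑ j : Fin (d.n t i), iteratedDeriv 2 F.a (etaTrue d β b t i j) *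
      (d.x t i j ⬝ᵥ u) ^ 2 ≤ c₀⁻¹ * ∑ j : Fin (d.n t i), (d.x t i j ⬝ᵥ u) ^ 2 := by
    rw [Finset.mul_sum]
    exact Finset.sum_le_sum fun j _ =>
      mul_le_mul_of_nonneg_right (hF.upper _ (h.dom i i.2 j j.2)) (sq_nonneg _)
  rw [dotProduct_info_mulVec] at hinfo
  calc c₀ * F.φ * c₁ * d.n t i * (u ⬝ᵥ u)
      = c₀ * F.φ * d.n t i * (c₁ * (u ⬝ᵥ u)) := by ring
    _ ≤ c₀ * F.φ * d.n t i * (((d.n t i : ℝ) * F.φ)⁻¹ *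
          (c₀⁻¹ * ∑ j : Fin (d.n t i), (d.x t i j ⬝ᵥ u) ^ 2)) := by
        refine mul_le_mul_of_nonneg_left (hinfo.trans ?_) (by positivity)
        gcongr
    _ = ∑ j : Fin (d.n t i), (d.x t i j ⬝ᵥ u) ^ 2 := by field_simp

end StageBounds

variable (d F β b y) in
/-- The score `X_iᵀ (y_i - μ_i)` of cluster `i` at the truth. -/
def score (t i : ℕ) (ω : Ω) : Fin p → ℝ :=
  ∑ j : Fin (d.n t i), resid d F β b y t i j ω • d.x t i j

variable (d F β b y) in
/-- The leading term `(n_i φ)⁻¹ H_i X_iᵀ (y_i - μ_i)` of the estimation error of cluster `i`. -/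
def lead (t i : ℕ) (ω : Ω) : Fin p → ℝ :=
  ((d.n t i : ℝ) * F.φ)⁻¹ • (H d F β b t i *ᵥ score d F β b y t i ω)

variable (d F β b y) in
/-- The average over the clusters of the leading terms; it is the leading term of the estimation
error of the fixed effects. -/
def leadMean (t : ℕ) (ω : Ω) : Fin p → ℝ :=
  (d.m t : ℝ)⁻¹ • ∑ i : Fin (d.m t), lead d F β b y t i ω

theorem sum_dotProduct_score (g : Fin (d.m t) → Fin p → ℝ) (ω : Ω) :
    ∑ i : Fin (d.m t), g i ⬝ᵥ score d F β b y t i ω =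
      ∑ s : d.Obs t, (g s.1 ⬝ᵥ d.x t s.1 s.2) * resid d F β b y t s.1 s.2 ω := by
  rw [Fintype.sum_sigma]
  refine Finset.sum_congr rfl fun i _ => ?_
  rw [score, dotProduct_comm, sum_smul_dotProduct]
  exact Finset.sum_congr rfl fun j _ => by rw [mul_comm, dotProduct_comm]

theorem dotProduct_lead (h : StageBounds d F β b c₁ C₁ C₂ t) (i : Fin (d.m t))
    (v : Fin p → ℝ) (ω : Ω) : v ⬝ᵥ lead d F β b y t i ω =
      (((d.n t i : ℝ) * F.φ)⁻¹ • (H d F β b t i *ᵥ v)) ⬝ᵥ score d F β b y t i ω := by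
  rw [lead, dotProduct_smul, smul_dotProduct, dotProduct_mulVec, ← mulVec_transpose,
    (h.eig i i.2).isSymm.eq]

namespace StageBounds

theorem norm_smul_H_mulVec_le (h : StageBounds d F β b c₁ C₁ C₂ t)
    (i : Fin (d.m t)) (v : Fin p → ℝ) :
    ‖((d.n t i : ℝ) * F.φ)⁻¹ • (H d F β b t i *ᵥ v)‖ ≤
      (d.n t i : ℝ)⁻¹ * (F.φ⁻¹ * (p * c₁⁻¹)) * ‖v‖ := by
  have hφ := F.φ_pos
  have hn := h.n_pos i
  rw [norm_smul, Real.norm_eq_abs, abs_of_pos (by positivity), mul_inv]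
  calc (d.n t i : ℝ)⁻¹ * F.φ⁻¹ * ‖H d F β b t i *ᵥ v‖
      ≤ (d.n t i : ℝ)⁻¹ * F.φ⁻¹ * (p * c₁⁻¹ * ‖v‖) := by
        gcongr
        exact (h.eig i i.2).norm_mulVec_le h.c_pos v
    _ = (d.n t i : ℝ)⁻¹ * (F.φ⁻¹ * (p * c₁⁻¹)) * ‖v‖ := by ring

end StageBounds

theorem sum_weight_sq_mul_obsVar (h : StageBounds d F β b c₁ C₁ C₂ t)
    (g : Fin (d.m t) → Fin p → ℝ) :
    ∑ s : d.Obs t, (g s.1 ⬝ᵥ d.x t s.1 s.2) ^ 2 * obsVar d F β b t s.1 s.2 =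
      ∑ i : Fin (d.m t), d.n t i * F.φ ^ 2 * (g i ⬝ᵥ (info d F β b t i *ᵥ g i)) := by
  rw [Fintype.sum_sigma]
  refine Finset.sum_congr rfl fun i _ => ?_
  rw [dotProduct_info_mulVec, ← mul_assoc, Finset.mul_sum]
  refine Finset.sum_congr rfl fun j _ => ?_
  have hφ := F.φ_pos.ne'
  have hn := (h.n_pos i).ne'
  rw [obsVar, dotProduct_comm]
  field_simp

theorem sum_weight_sq_mul_obsVar_le (h : StageBounds d F β b c₁ C₁ C₂ t)
    (hF : CurvatureBounds F c₀) (g : Fin (d.m t) → Fin p → ℝ) :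
    ∑ s : d.Obs t, (g s.1 ⬝ᵥ d.x t s.1 s.2) ^ 2 * obsVar d F β b t s.1 s.2 ≤
      F.φ * c₀⁻¹ * (p * C₁) ^ 2 * ∑ i : Fin (d.m t), d.n t i * ‖g i‖ ^ 2 := by
  have hφ := F.φ_pos
  have hc := hF.pos
  have hweight (i : Fin (d.m t)) (j : Fin (d.n t i)) :
      |g i ⬝ᵥ d.x t i j| ≤ p * (‖g i‖ * C₁) := by
    have := abs_dotProduct_le (g i) (d.x t i j)
    rw [Fintype.card_fin] at this
    refine this.trans ?_
    gcongr
    exact h.x_le i i.2 j j.2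
  rw [Fintype.sum_sigma, Finset.mul_sum]
  refine Finset.sum_le_sum fun i _ => ?_
  calc ∑ j : Fin (d.n t i), (g i ⬝ᵥ d.x t i j) ^ 2 * obsVar d F β b t i j
      ≤ ∑ _j : Fin (d.n t i), (p * (‖g i‖ * C₁)) ^ 2 * (F.φ * c₀⁻¹) := by
        refine Finset.sum_le_sum fun j _ => mul_le_mul ?_ (obsVar_le hF (h.dom i i.2 j j.2))
          (le_trans (by positivity) (le_obsVar hF (h.dom i i.2 j j.2))) (by positivity)
        rw [← sq_abs]
        exact pow_le_pow_left₀ (abs_nonneg _) (hweight i j) 2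
    _ = F.φ * c₀⁻¹ * (p * C₁) ^ 2 * (d.n t i * ‖g i‖ ^ 2) := by
        rw [Finset.sum_const, Finset.card_univ, Fintype.card_fin, nsmul_eq_mul]
        ring

theorem integral_dotProduct_self_le [MeasurableSpace Ω] {P : Measure Ω} {ι : Type*} [Fintype ι]
    {v : Ω → ι → ℝ} {B : ℝ} (hint : ∀ k, Integrable (fun ω => v ω k ^ 2) P)
    (hB : ∀ k, ∫ ω, v ω k ^ 2 ∂P ≤ B) :
    Integrable (fun ω => v ω ⬝ᵥ v ω) P ∧ ∫ ω, v ω ⬝ᵥ v ω ∂P ≤ Fintype.card ι * B := by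
  simp only [dotProduct, ← sq]
  refine ⟨integrable_finsetSum _ fun k _ => hint k, ?_⟩
  rw [integral_finsetSum _ fun k _ => hint k]
  calc ∑ k, ∫ ω, v ω k ^ 2 ∂P ≤ ∑ _k : ι, B := Finset.sum_le_sum fun k _ => hB k
    _ = Fintype.card ι * B := by rw [Finset.sum_const, Finset.card_univ, nsmul_eq_mul]

section Moments

variable [MeasurableSpace Ω] {P : Measure Ω} [IsProbabilityMeasure P]

namespace StageBounds

theorem integral_sum_dotProduct_score_sq_le (h : StageBounds d F β b c₁ C₁ C₂ t)
    (hF : CurvatureBounds F c₀) (hy : ResponseModel d F β b P y)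
    (g : Fin (d.m t) → Fin p → ℝ) :
    Integrable (fun ω => (∑ i : Fin (d.m t), g i ⬝ᵥ score d F β b y t i ω) ^ 2) P ∧
    ∫ ω, (∑ i : Fin (d.m t), g i ⬝ᵥ score d F β b y t i ω) ^ 2 ∂P ≤
      F.φ * c₀⁻¹ * (p * C₁) ^ 2 * ∑ i : Fin (d.m t), d.n t i * ‖g i‖ ^ 2 := by
  have hdom (s : d.Obs t) : etaTrue d β b t s.1 s.2 ∈ F.dom := h.dom s.1 s.1.2 s.2 s.2.2
  simp_rw [sum_dotProduct_score]
  refine ⟨(hy.memLp_sum_mul_resid hdom _).integrable_sq, ?_⟩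
  rw [hy.integral_sum_mul_resid_sq hF hdom]
  exact sum_weight_sq_mul_obsVar_le h hF g

theorem integral_score_dotProduct_self_le (h : StageBounds d F β b c₁ C₁ C₂ t)
    (hF : CurvatureBounds F c₀) (hy : ResponseModel d F β b P y) (i : Fin (d.m t)) :
    Integrable (fun ω => score d F β b y t i ω ⬝ᵥ score d F β b y t i ω) P ∧
    ∫ ω, score d F β b y t i ω ⬝ᵥ score d F β b y t i ω ∂P ≤
      p * (F.φ * c₀⁻¹ * (p * C₁) ^ 2 * d.n t i) := by
  have hcoord (k : Fin p) : Integrable (fun ω => score d F β b y t i ω k ^ 2) P ∧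
      ∫ ω, score d F β b y t i ω k ^ 2 ∂P ≤ F.φ * c₀⁻¹ * (p * C₁) ^ 2 * d.n t i := by
    let g : Fin (d.m t) → Fin p → ℝ := Pi.single i (Pi.single k 1)
    have hg (ω : Ω) : ∑ i' : Fin (d.m t), g i' ⬝ᵥ score d F β b y t i' ω =
        score d F β b y t i ω k := by
      rw [Finset.sum_eq_single i (fun i' _ hi => by simp [g, hi]) (by simp)]
      simp [g]
    have hnorm : ∑ i' : Fin (d.m t), (d.n t i' : ℝ) * ‖g i'‖ ^ 2 = d.n t i := by
      rw [Finset.sum_eq_single i (fun i' _ hi => by simp [g, hi]) (by simp)]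
      simp [g, Pi.norm_single]
    simpa only [hg, hnorm] using h.integral_sum_dotProduct_score_sq_le hF hy g
  have := integral_dotProduct_self_le (fun k => (hcoord k).1) fun k => (hcoord k).2
  rwa [Fintype.card_fin] at this

theorem integral_leadMean_apply_sq_le (h : StageBounds d F β b c₁ C₁ C₂ t)
    (hF : CurvatureBounds F c₀) (hy : ResponseModel d F β b P y) (k : Fin p) :
    Integrable (fun ω => leadMean d F β b y t ω k ^ 2) P ∧
    ∫ ω, leadMean d F β b y t ω k ^ 2 ∂P ≤ (d.m t * d.nL t : ℝ)⁻¹ *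
      (F.φ * c₀⁻¹ * (p * C₁) ^ 2 * (F.φ⁻¹ * (p * c₁⁻¹)) ^ 2) := by
  have hφ := F.φ_pos
  have hc₀ := hF.pos
  have hm := h.m_pos
  have hnL := h.nL_pos
  set D := F.φ⁻¹ * (p * c₁⁻¹)
  let g : Fin (d.m t) → Fin p → ℝ := fun i => (d.m t : ℝ)⁻¹ •
    (((d.n t i : ℝ) * F.φ)⁻¹ • (H d F β b t i *ᵥ Pi.single k 1))
  have hg (ω : Ω) : ∑ i : Fin (d.m t), g i ⬝ᵥ score d F β b y t i ω = leadMean d F β b y t ω k := by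
    simp only [leadMean, Pi.smul_apply, Finset.sum_apply, smul_eq_mul, Finset.mul_sum, g]
    refine Finset.sum_congr rfl fun i _ => ?_
    rw [smul_dotProduct, ← dotProduct_lead h, single_one_dotProduct, smul_eq_mul]
  have hnorm (i : Fin (d.m t)) : ‖g i‖ ≤ (d.m t : ℝ)⁻¹ * ((d.n t i : ℝ)⁻¹ * D) := by
    rw [norm_smul, Real.norm_eq_abs, abs_of_pos (by positivity)]
    have := h.norm_smul_H_mulVec_le i (Pi.single k 1)
    rw [Pi.norm_single, norm_one, mul_one] at this
    gcongr
  have hsum : ∑ i : Fin (d.m t), d.n t i * ‖g i‖ ^ 2 ≤ (d.m t * d.nL t : ℝ)⁻¹ * D ^ 2 := by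
    calc ∑ i : Fin (d.m t), d.n t i * ‖g i‖ ^ 2
        ≤ ∑ _i : Fin (d.m t), (d.m t : ℝ)⁻¹ ^ 2 * (D ^ 2 / d.nL t) := by
          refine Finset.sum_le_sum fun i _ => ?_
          have hn := h.n_pos i
          calc (d.n t i : ℝ) * ‖g i‖ ^ 2
              ≤ d.n t i * ((d.m t : ℝ)⁻¹ * ((d.n t i : ℝ)⁻¹ * D)) ^ 2 := by
                gcongr; exact hnorm i
            _ = (d.m t : ℝ)⁻¹ ^ 2 * (D ^ 2 / d.n t i) := by field_simp
            _ ≤ (d.m t : ℝ)⁻¹ ^ 2 * (D ^ 2 / d.nL t) := by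
              gcongr _ * (_ / ?_)
              exact nL_le_n d i
      _ = (d.m t * d.nL t : ℝ)⁻¹ * D ^ 2 := by
          rw [Finset.sum_const, Finset.card_univ, Fintype.card_fin, nsmul_eq_mul]
          field_simp
  obtain ⟨hint, hle⟩ := h.integral_sum_dotProduct_score_sq_le hF hy g
  simp only [hg] at hint hle
  refine ⟨hint, hle.trans ?_⟩
  rw [mul_left_comm]
  gcongr

theorem integral_leadMean_dotProduct_self_le (h : StageBounds d F β b c₁ C₁ C₂ t)
    (hF : CurvatureBounds F c₀) (hy : ResponseModel d F β b P y) :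
    Integrable (fun ω => leadMean d F β b y t ω ⬝ᵥ leadMean d F β b y t ω) P ∧
    ∫ ω, leadMean d F β b y t ω ⬝ᵥ leadMean d F β b y t ω ∂P ≤
      p * ((d.m t * d.nL t : ℝ)⁻¹ *
        (F.φ * c₀⁻¹ * (p * C₁) ^ 2 * (F.φ⁻¹ * (p * c₁⁻¹)) ^ 2)) := by
  have := integral_dotProduct_self_le
    (fun k => (h.integral_leadMean_apply_sq_le hF hy k).1)
    fun k => (h.integral_leadMean_apply_sq_le hF hy k).2
  rwa [Fintype.card_fin] at this

end StageBounds

end Moments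

end Stage

/-! ### Bounds on the estimation errors -/

/-- The inequalities linking the errors `U i`, the score norms `s i`, the norms `B i` of the centred
random effects and the linearisation errors `E i` of `m` clusters of size at least `n`. The mean of
the `U i` enters because the penalty acts on deviations from the mean. -/
structure ErrorSystem (M n : ℝ) {m : ℕ} (U s B E : Fin m → ℝ) : Prop where
  one_le : 1 ≤ M
  m_pos : 0 < m
  m_le : (m : ℝ) ≤ n
  four_mul_le : 4 * M ≤ n
  U_nonneg : ∀ i, 0 ≤ U i
  s_nonneg : ∀ i, 0 ≤ s i
  B_nonneg : ∀ i, 0 ≤ B i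
  U_le : ∀ i, n * U i ≤ M * (s i + (U i + (m : ℝ)⁻¹ * ∑ i', U i' + B i))
  E_le : ∀ i, n * E i ≤ M * (U i + (m : ℝ)⁻¹ * ∑ i', U i' + B i + n * U i ^ 2)
  sum_s_sq_le : ∑ i, s i ^ 2 ≤ M * (m * n)
  sum_B_le : ∑ i, B i ≤ M * m

namespace ErrorSystem

variable {M n : ℝ} {m : ℕ} {U s B E : Fin m → ℝ}

theorem n_pos (h : ErrorSystem M n U s B E) : 0 < n := by linarith [h.one_le, h.four_mul_le]

theorem cast_m_pos (h : ErrorSystem M n U s B E) : (0 : ℝ) < m := by exact_mod_cast h.m_pos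

theorem mean_U_le (h : ErrorSystem M n U s B E) : (m : ℝ)⁻¹ * ∑ i, U i ≤ 6 * M ^ 2 := by
  have hM := h.one_le
  have hm := h.cast_m_pos
  have hn := h.n_pos
  have h4 := h.four_mul_le
  set μ := (m : ℝ)⁻¹ * ∑ i, U i with hμ
  have hsum : ∑ i, U i = m * μ := by rw [hμ, mul_inv_cancel_left₀ hm.ne']
  have hμ0 : 0 ≤ μ := mul_nonneg (by positivity) (Finset.sum_nonneg fun i _ => h.U_nonneg i)
  have hs : ∑ i, s i ≤ m * (M * n + 1) := by
    calc ∑ i, s i ≤ ∑ i, (s i ^ 2 + 1) :=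
          Finset.sum_le_sum fun i _ => by nlinarith [sq_nonneg (s i - 1), sq_nonneg (s i)]
      _ = ∑ i, s i ^ 2 + m := by rw [Finset.sum_add_distrib]; simp
      _ ≤ m * (M * n + 1) := by linarith [h.sum_s_sq_le]
  have havg : m * (n * μ) ≤ m * (M * (M * n + 1 + (2 * μ + M))) := by
    calc m * (n * μ) = ∑ i, n * U i := by rw [← Finset.mul_sum, hsum]; ring
      _ ≤ ∑ i, M * (s i + (U i + μ + B i)) := Finset.sum_le_sum fun i _ => h.U_le i
      _ = M * (∑ i, s i + (2 * (m * μ) + ∑ i, B i)) := by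
          rw [← Finset.mul_sum, Finset.sum_add_distrib, Finset.sum_add_distrib,
            Finset.sum_add_distrib, hsum, Finset.sum_const, Finset.card_univ, Fintype.card_fin,
            nsmul_eq_mul]
          ring
      _ ≤ M * (m * (M * n + 1) + (2 * (m * μ) + M * m)) := by gcongr; exact h.sum_B_le
      _ = m * (M * (M * n + 1 + (2 * μ + M))) := by ring
  have habsorb : n * μ ≤ 2 * M * (M * n + 1 + M) := by
    nlinarith [le_of_mul_le_mul_left havg hm, mul_le_mul_of_nonneg_right h4 hμ0]
  refine le_of_mul_le_mul_left (habsorb.trans ?_) hn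
  nlinarith [mul_le_mul hM (show M ≤ n by linarith) (by linarith) (by linarith),
    mul_le_mul hM (show 1 ≤ n by linarith) one_pos.le (by linarith)]

theorem mul_U_le (h : ErrorSystem M n U s B E) (i : Fin m) :
    n * U i ≤ 8 * M ^ 3 * (s i + 1 + B i) := by
  have hM := h.one_le
  have hs := h.s_nonneg i
  have hB := h.B_nonneg i
  have habsorb : 3 * (n * U i) ≤ 4 * (M * (s i + 6 * M ^ 2 + B i)) := by
    nlinarith [h.U_le i, h.mean_U_le, mul_le_mul_of_nonneg_right h.four_mul_le (h.U_nonneg i)]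
  have hM2 : 1 ≤ M ^ 2 := one_le_pow₀ hM
  have : s i + 6 * M ^ 2 + B i ≤ 6 * M ^ 2 * (s i + 1 + B i) := by nlinarith
  nlinarith

theorem sq_mul_U_le (h : ErrorSystem M n U s B E) (i : Fin m) :
    (n * U i) ^ 2 ≤ 192 * M ^ 6 * (s i ^ 2 + 1 + B i ^ 2) := by
  have hM := h.one_le
  have hU : 0 ≤ n * U i := mul_nonneg h.n_pos.le (h.U_nonneg i)
  calc (n * U i) ^ 2 ≤ (8 * M ^ 3 * (s i + 1 + B i)) ^ 2 := pow_le_pow_left₀ hU (h.mul_U_le i) 2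
    _ = 64 * M ^ 6 * (s i + 1 + B i) ^ 2 := by ring
    _ ≤ 64 * M ^ 6 * (3 * (s i ^ 2 + 1 + B i ^ 2)) := by
        gcongr
        nlinarith [sq_nonneg (s i - 1), sq_nonneg (s i - B i), sq_nonneg (1 - B i)]
    _ = 192 * M ^ 6 * (s i ^ 2 + 1 + B i ^ 2) := by ring

theorem mul_sum_U_sq_le (h : ErrorSystem M n U s B E) :
    n * ∑ i, U i ^ 2 ≤ 576 * M ^ 8 * m := by
  have hM := h.one_le
  have hm := h.cast_m_pos
  have hn := h.n_pos
  have hBsq : ∑ i, B i ^ 2 ≤ M ^ 2 * (m * n) := by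
    calc ∑ i, B i ^ 2 ≤ (∑ i, B i) ^ 2 := Finset.sum_sq_le_sq_sum_of_nonneg fun i _ => h.B_nonneg i
      _ ≤ (M * m) ^ 2 :=
          pow_le_pow_left₀ (Finset.sum_nonneg fun i _ => h.B_nonneg i) h.sum_B_le 2
      _ = M ^ 2 * (m * m) := by ring
      _ ≤ M ^ 2 * (m * n) := by gcongr; exact h.m_le
  refine le_of_mul_le_mul_left ?_ hn
  calc n * (n * ∑ i, U i ^ 2) = ∑ i, (n * U i) ^ 2 := by
        rw [← mul_assoc, Finset.mul_sum]
        exact Finset.sum_congr rfl fun i _ => by ring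
    _ ≤ ∑ i, 192 * M ^ 6 * (s i ^ 2 + 1 + B i ^ 2) := Finset.sum_le_sum fun i _ => h.sq_mul_U_le i
    _ = 192 * M ^ 6 * (∑ i, s i ^ 2 + m + ∑ i, B i ^ 2) := by
        rw [← Finset.mul_sum, Finset.sum_add_distrib, Finset.sum_add_distrib]
        simp
    _ ≤ 192 * M ^ 6 * (M ^ 2 * (m * n) + M ^ 2 * (m * n) + M ^ 2 * (m * n)) := by
        have hMM : M ≤ M ^ 2 := le_self_pow₀ hM two_ne_zero
        have hone : (m : ℝ) ≤ M ^ 2 * (m * n) := by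
          nlinarith [one_le_pow₀ hM (n := 2), mul_le_mul_of_nonneg_left
            (show 1 ≤ n by linarith [h.four_mul_le]) hm.le, mul_pos hm hn]
        gcongr
        exact h.sum_s_sq_le.trans (by gcongr)
    _ = n * (576 * M ^ 8 * m) := by ring

theorem mul_sum_E_le (h : ErrorSystem M n U s B E) : n * ∑ i, E i ≤ 600 * M ^ 9 * m := by
  have hM := h.one_le
  have hm := h.cast_m_pos
  obtain ⟨μ, hμ⟩ : ∃ μ, μ = (m : ℝ)⁻¹ * ∑ i, U i := ⟨_, rfl⟩
  have hsum : ∑ i, U i = m * μ := by rw [hμ, mul_inv_cancel_left₀ hm.ne']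
  have hpow (k : ℕ) (hk : k ≤ 8) : M ^ k ≤ M ^ 8 := pow_le_pow_right₀ hM hk
  calc n * ∑ i, E i ≤ ∑ i, M * (U i + μ + B i + n * U i ^ 2) := by
        rw [Finset.mul_sum, hμ]
        exact Finset.sum_le_sum fun i _ => h.E_le i
    _ = M * (2 * (m * μ) + ∑ i, B i + n * ∑ i, U i ^ 2) := by
        simp only [← Finset.mul_sum, Finset.sum_add_distrib, hsum, Finset.sum_const,
          Finset.card_univ, Fintype.card_fin, nsmul_eq_mul]
        ring
    _ ≤ M * (2 * (m * (6 * M ^ 2)) + M ^ 1 * m + 576 * M ^ 8 * m) := by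
        have hB : ∑ i, B i ≤ M ^ 1 * m := by simpa only [pow_one] using h.sum_B_le
        refine mul_le_mul_of_nonneg_left (add_le_add (add_le_add ?_ hB) ?_) (by linarith)
        · gcongr
          exact hμ ▸ h.mean_U_le
        · exact h.mul_sum_U_sq_le
    _ ≤ M * (2 * (m * (6 * M ^ 8)) + M ^ 8 * m + 576 * M ^ 8 * m) := by
        gcongr M * (2 * (m * (6 * ?_)) + ?_ * m + _)
        · exact hpow 2 (by norm_num)
        · exact hpow 1 (by norm_num)
    _ ≤ 600 * M ^ 9 * m := by
        have : 0 ≤ M ^ 9 * m := by positivity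
        linarith [show M * (2 * (m * (6 * M ^ 8)) + M ^ 8 * m + 576 * M ^ 8 * m) =
          589 * (M ^ 9 * m) by ring]

theorem mul_E_le (h : ErrorSystem M n U s B E) {i : Fin m} (hi : s i ^ 2 ≤ M * n) :
    n * E i ≤ 600 * M ^ 9 * (1 + B i) ^ 2 := by
  have hM := h.one_le
  have hn := h.n_pos
  have hB := h.B_nonneg i
  have hn1 : 1 ≤ n := by linarith [h.four_mul_le]
  have hU : U i ≤ 24 * M ^ 4 * (1 + B i) := by
    refine le_of_mul_le_mul_left ((h.mul_U_le i).trans ?_) hn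
    have hs : s i + 1 + B i ≤ 3 * (M * n) * (1 + B i) := by
      nlinarith [sq_nonneg (s i - 1), mul_le_mul hM hn1 one_pos.le (by linarith)]
    calc 8 * M ^ 3 * (s i + 1 + B i) ≤ 8 * M ^ 3 * (3 * (M * n) * (1 + B i)) := by gcongr
      _ = n * (24 * M ^ 4 * (1 + B i)) := by ring
  have hUsq : n * U i ^ 2 ≤ 384 * M ^ 7 * (1 + B i) ^ 2 := by
    refine le_of_mul_le_mul_left ?_ hn
    calc n * (n * U i ^ 2) = (n * U i) ^ 2 := by ring
      _ ≤ 192 * M ^ 6 * (s i ^ 2 + 1 + B i ^ 2) := h.sq_mul_U_le i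
      _ ≤ 192 * M ^ 6 * (2 * (M * n) * (1 + B i) ^ 2) := by
          gcongr
          nlinarith [mul_le_mul hM hn1 one_pos.le (by linarith), mul_nonneg hB hB]
      _ = n * (384 * M ^ 7 * (1 + B i) ^ 2) := by ring
  have hlin : 1 + B i ≤ (1 + B i) ^ 2 := le_self_pow₀ (by linarith) two_ne_zero
  have hpow (k : ℕ) (hk : k ≤ 8) : M ^ k * (1 + B i) ≤ M ^ 8 * (1 + B i) ^ 2 :=
    mul_le_mul (pow_le_pow_right₀ hM hk) hlin (by linarith) (by positivity)
  have hpow7 : M ^ 7 * (1 + B i) ^ 2 ≤ M ^ 8 * (1 + B i) ^ 2 := by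
    gcongr
    norm_num
  have hμ : 6 * M ^ 2 + B i ≤ 7 * (M ^ 8 * (1 + B i) ^ 2) := by
    nlinarith [hpow 2 (by norm_num), hpow 0 (by norm_num), mul_nonneg (sq_nonneg M) hB]
  calc n * E i ≤ M * (U i + (m : ℝ)⁻¹ * ∑ i', U i' + B i + n * U i ^ 2) := h.E_le i
    _ ≤ M * (600 * (M ^ 8 * (1 + B i) ^ 2)) := by
        gcongr
        nlinarith [h.mean_U_le, hpow 4 (by norm_num), show 0 ≤ M ^ 8 * (1 + B i) ^ 2 by positivity]
    _ = 600 * M ^ 9 * (1 + B i) ^ 2 := by ring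

end ErrorSystem

section Deviation

variable {p : ℕ} {d : Design p} {F : ExpFamily} {β : Fin p → ℝ}
  {b : ℕ → EuclideanSpace ℝ (Fin p)} {Ω : Type*}
  {y : ℕ → ℕ → ℕ → Ω → ℝ} {c₀ c₁ C₁ C₂ : ℝ} {t : ℕ}

variable (d β b) in
/-- The error of `θ` for the identifiable coefficients `β + b_i` of cluster `i`. -/
def dev (θ : Param p (d.m t)) (i : Fin (d.m t)) : Fin p → ℝ :=
  θ.fixed + θ.random i - (β + (b i).ofLp)

variable (d b) in
/-- The centred true random effects, which are the random effects of `target`. -/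
def centred (t : ℕ) (i : ℕ) : Fin p → ℝ := (b i).ofLp - (bbar d b t).ofLp

variable (d β b) in
/-- The average of the errors `dev` over the clusters. -/
def devMean (θ : Param p (d.m t)) : Fin p → ℝ := (d.m t : ℝ)⁻¹ • ∑ i, dev d β b θ i

theorem eta_eq_dotProduct (θ : Param p (d.m t)) (i : Fin (d.m t)) (j : ℕ) :
    eta d θ i j = d.x t i j ⬝ᵥ (θ.fixed + θ.random i) := by
  rw [eta, dotProduct_add]

theorem etaTrue_eq_dotProduct (t i j : ℕ) :
    etaTrue d β b t i j = d.x t i j ⬝ᵥ (β + (b i).ofLp) := by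
  rw [etaTrue, dotProduct_add]

theorem devMean_eq (hm : 0 < d.m t) {θ : Param p (d.m t)} (hθ : ∑ i, θ.random i = 0) :
    devMean d β b θ = θ.fixed - β - (bbar d b t).ofLp := by
  have hm0 : (d.m t : ℝ) ≠ 0 := by exact_mod_cast hm.ne'
  have hsum : ∑ i, dev d β b θ i =
      (d.m t : ℝ) • θ.fixed - (d.m t : ℝ) • β - ∑ i : Fin (d.m t), (b i).ofLp := by
    simp only [dev, Finset.sum_sub_distrib, Finset.sum_add_distrib, hθ, Finset.sum_const,
      Finset.card_univ, Fintype.card_fin, ← Nat.cast_smul_eq_nsmul ℝ]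
    abel
  rw [devMean, hsum, smul_sub, smul_sub, inv_smul_smul₀ hm0, inv_smul_smul₀ hm0, bbar,
    WithLp.ofLp_smul, WithLp.ofLp_sum]

theorem random_eq (hm : 0 < d.m t) {θ : Param p (d.m t)} (hθ : ∑ i, θ.random i = 0)
    (i : Fin (d.m t)) : θ.random i = dev d β b θ i - devMean d β b θ + centred d b t i := by
  rw [devMean_eq hm hθ, dev, centred]
  abel

theorem sub_target_fixed (hm : 0 < d.m t) {θ : Param p (d.m t)} (hθ : ∑ i, θ.random i = 0)
    (k : Fin p) : (θ - target d β b t) (k, none) = devMean d β b θ k := by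
  rw [devMean_eq hm hθ]
  simp only [target, thetaTrue, oneStar, Param.fixed, Pi.sub_apply]
  ring

theorem sub_target_random (hm : 0 < d.m t) {θ : Param p (d.m t)} (hθ : ∑ i, θ.random i = 0)
    (k : Fin p) (i : Fin (d.m t)) :
    (θ - target d β b t) (k, some i) = dev d β b θ i k - devMean d β b θ k := by
  have := congrFun (random_eq (β := β) (b := b) hm hθ i) k
  simp only [Pi.add_apply, Pi.sub_apply, Param.random, centred] at this
  simp only [target, thetaTrue, oneStar, Pi.sub_apply, this]
  ring

theorem norm_devMean_le (θ : Param p (d.m t)) :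
    ‖devMean d β b θ‖ ≤ (d.m t : ℝ)⁻¹ * ∑ i, ‖dev d β b θ i‖ := by
  rw [devMean, norm_smul, Real.norm_eq_abs, abs_of_nonneg (by positivity)]
  gcongr
  exact norm_sum_le _ _

theorem norm_random_le (hm : 0 < d.m t) {θ : Param p (d.m t)} (hθ : ∑ i, θ.random i = 0)
    (i : Fin (d.m t)) : ‖θ.random i‖ ≤
      ‖dev d β b θ i‖ + (d.m t : ℝ)⁻¹ * ∑ i', ‖dev d β b θ i'‖ + ‖centred d b t i‖ := by
  rw [random_eq (β := β) (b := b) hm hθ i]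
  refine (norm_add_le _ _).trans ?_
  gcongr
  exact (norm_sub_le _ _).trans (by gcongr; exact norm_devMean_le θ)

variable {ω : Ω} {G : Matrix (Fin p) (Fin p) ℝ} {ψ : ℝ} {θ : Param p (d.m t)}

namespace StageBounds

theorem norm_dev_le (h : StageBounds d F β b c₁ C₁ C₂ t) (hF : CurvatureBounds F c₀)
    (hG : G.IsSymm) (hψ : ψ ≠ 0) (hθ : IsPQLEstimate d F (fun i j => y t i j ω) G ψ θ)
    (i : Fin (d.m t)) :
    c₀ * (c₀ * F.φ * c₁ * d.n t i) * ‖dev d β b θ i‖ ≤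
      p * (‖score d F β b y t i ω‖ + ‖ψ • (G⁻¹ *ᵥ θ.random i)‖) := by
  have hs := hθ.score_eq hF hG hψ i
  simp only [eta_eq_dotProduct] at hs
  have hφ := F.φ_pos
  have hc := hF.pos
  have hc1 := h.c_pos
  have := hF.norm_sub_le_of_score_eq (γ := β + (b i).ofLp)
    (κ := c₀ * F.φ * c₁ * d.n t i) (by positivity)
    (fun j => by rw [← etaTrue_eq_dotProduct]; exact h.dom i i.2 j j.2)
    (fun j => by rw [← eta_eq_dotProduct]; exact hθ.1 i j) (h.mul_dotProduct_self_le hF i) hs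
  simp only [← etaTrue_eq_dotProduct, Fintype.card_fin] at this
  exact this

theorem norm_dev_sub_lead_le (h : StageBounds d F β b c₁ C₁ C₂ t) (hF : CurvatureBounds F c₀)
    (hG : G.IsSymm) (hψ : ψ ≠ 0) (hθ : IsPQLEstimate d F (fun i j => y t i j ω) G ψ θ)
    (i : Fin (d.m t)) :
    ‖dev d β b θ i - lead d F β b y t i ω‖ ≤ (d.n t i : ℝ)⁻¹ * (F.φ⁻¹ * (p * c₁⁻¹)) *
      (‖ψ • (G⁻¹ *ᵥ θ.random i)‖ +
        d.n t i * (C₁ * (c₀⁻¹ * (p * (C₁ * ‖dev d β b θ i‖)) ^ 2))) := by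
  have hs := hθ.score_eq hF hG hψ i
  simp only [eta_eq_dotProduct] at hs
  have hφ := F.φ_pos
  have hc1 := h.c_pos
  have hexpansion := hF.norm_score_expansion_le (γ := β + (b i).ofLp) h.C_nonneg
    (fun j : Fin (d.n t i) => h.x_le i i.2 j j.2)
    (fun j => by rw [← etaTrue_eq_dotProduct]; exact h.dom i i.2 j j.2)
    (fun j => by rw [← eta_eq_dotProduct]; exact hθ.1 i j) hs
  simp only [← etaTrue_eq_dotProduct, Fintype.card_fin] at hexpansion
  have hlead : dev d β b θ i - lead d F β b y t i ω = ((d.n t i : ℝ) * F.φ)⁻¹ •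
      (H d F β b t i *ᵥ (∑ j : Fin (d.n t i), (iteratedDeriv 2 F.a (etaTrue d β b t i j) *
        (d.x t i j ⬝ᵥ dev d β b θ i)) • d.x t i j - score d F β b y t i ω)) := by
    rw [mulVec_sub, smul_sub, ← mulVec_smul, ← info_mulVec, mulVec_mulVec, h.H_mul_info,
      one_mulVec, lead]
  rw [hlead]
  refine (h.norm_smul_H_mulVec_le i _).trans ?_
  gcongr
  exact hexpansion

theorem nL_mul_norm_dev_le (h : StageBounds d F β b c₁ C₁ C₂ t) (hF : CurvatureBounds F c₀)
    (hG : G.PosDef) (hψ : ψ ≠ 0) (hθ : IsPQLEstimate d F (fun i j => y t i j ω) G ψ θ)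
    {L M : ℝ} (hL : 0 ≤ L) (hpenalty : ∀ v, ‖ψ • (G⁻¹ *ᵥ v)‖ ≤ L * ‖v‖)
    (hM : p * (1 + L) ≤ c₀ * (c₀ * F.φ * c₁) * M) (i : Fin (d.m t)) :
    d.nL t * ‖dev d β b θ i‖ ≤ M * (‖score d F β b y t i ω‖ +
      (‖dev d β b θ i‖ + (d.m t : ℝ)⁻¹ * ∑ i', ‖dev d β b θ i'‖ + ‖centred d b t i‖)) := by
  have hφ := F.φ_pos
  have hc := hF.pos
  have hc1 := h.c_pos
  have hsymm : G.IsSymm := (conjTranspose_eq_transpose_of_trivial G).symm.trans hG.1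
  have hrandom := norm_random_le (β := β) (b := b) h.one_le_m (hθ.sum_random hF hG) i
  set r := ‖dev d β b θ i‖ + (d.m t : ℝ)⁻¹ * ∑ i', ‖dev d β b θ i'‖ + ‖centred d b t i‖
  set σ := ‖score d F β b y t i ω‖
  have hr : 0 ≤ r := (norm_nonneg _).trans hrandom
  refine le_of_mul_le_mul_left ?_ (show 0 < c₀ * (c₀ * F.φ * c₁) by positivity)
  calc c₀ * (c₀ * F.φ * c₁) * (d.nL t * ‖dev d β b θ i‖)
      ≤ c₀ * (c₀ * F.φ * c₁) * (d.n t i * ‖dev d β b θ i‖) := by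
        gcongr
        exact_mod_cast nL_le_n d i
    _ = c₀ * (c₀ * F.φ * c₁ * d.n t i) * ‖dev d β b θ i‖ := by ring
    _ ≤ p * (σ + ‖ψ • (G⁻¹ *ᵥ θ.random i)‖) := h.norm_dev_le hF hsymm hψ hθ i
    _ ≤ p * (σ + L * r) := by
        gcongr
        exact (hpenalty _).trans (by gcongr)
    _ ≤ p * ((1 + L) * (σ + r)) := by
        gcongr
        nlinarith [norm_nonneg (score d F β b y t i ω), mul_nonneg hL (norm_nonneg
          (score d F β b y t i ω))]
    _ = p * (1 + L) * (σ + r) := by ring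
    _ ≤ c₀ * (c₀ * F.φ * c₁) * M * (σ + r) := by gcongr
    _ = c₀ * (c₀ * F.φ * c₁) * (M * (σ + r)) := by ring

theorem nL_mul_norm_dev_sub_lead_le (h : StageBounds d F β b c₁ C₁ C₂ t)
    (hF : CurvatureBounds F c₀) (hG : G.PosDef) (hψ : ψ ≠ 0)
    (hθ : IsPQLEstimate d F (fun i j => y t i j ω) G ψ θ)
    {L M : ℝ} (hL : 0 ≤ L) (hpenalty : ∀ v, ‖ψ • (G⁻¹ *ᵥ v)‖ ≤ L * ‖v‖)
    (hM : F.φ⁻¹ * (p * c₁⁻¹) * (L + C₁ * (c₀⁻¹ * (p * C₁) ^ 2)) ≤ M) (i : Fin (d.m t)) :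
    d.nL t * ‖dev d β b θ i - lead d F β b y t i ω‖ ≤
      M * (‖dev d β b θ i‖ + (d.m t : ℝ)⁻¹ * ∑ i', ‖dev d β b θ i'‖ + ‖centred d b t i‖ +
        d.nL t * ‖dev d β b θ i‖ ^ 2) := by
  have hφ := F.φ_pos
  have hc := hF.pos
  have hc1 := h.c_pos
  have hn := h.n_pos i
  have hsymm : G.IsSymm := (conjTranspose_eq_transpose_of_trivial G).symm.trans hG.1
  have hrandom := norm_random_le (β := β) (b := b) h.one_le_m (hθ.sum_random hF hG) i
  set U := ‖dev d β b θ i‖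
  set r := U + (d.m t : ℝ)⁻¹ * ∑ i', ‖dev d β b θ i'‖ + ‖centred d b t i‖
  set D₁ := F.φ⁻¹ * (p * c₁⁻¹)
  set D₂ := C₁ * (c₀⁻¹ * (p * C₁) ^ 2)
  have hr : 0 ≤ r := (norm_nonneg _).trans hrandom
  have hD₂ : 0 ≤ D₂ := mul_nonneg h.C_nonneg (by positivity)
  calc d.nL t * ‖dev d β b θ i - lead d F β b y t i ω‖
      ≤ d.nL t * ((d.n t i : ℝ)⁻¹ * D₁ * (L * r + d.n t i * (D₂ * U ^ 2))) := by
        gcongr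
        refine (h.norm_dev_sub_lead_le hF hsymm hψ hθ i).trans ?_
        rw [show C₁ * (c₀⁻¹ * (p * (C₁ * U)) ^ 2) = D₂ * U ^ 2 by ring]
        gcongr
        exact (hpenalty _).trans (by gcongr)
    _ = D₁ * (d.nL t / d.n t i * (L * r) + d.nL t * (D₂ * U ^ 2)) := by field_simp
    _ ≤ D₁ * (1 * (L * r) + d.nL t * (D₂ * U ^ 2)) := by
        gcongr
        exact div_le_one_of_le₀ (nL_le_n d i) hn.le
    _ ≤ D₁ * ((L + D₂) * (r + d.nL t * U ^ 2)) := by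
        gcongr
        nlinarith [mul_nonneg hD₂ hr, mul_nonneg hL
          (show 0 ≤ (d.nL t : ℝ) * U ^ 2 by positivity)]
    _ = D₁ * (L + D₂) * (r + d.nL t * U ^ 2) := by ring
    _ ≤ M * (r + d.nL t * U ^ 2) := by gcongr

end StageBounds

end Deviation

/-! ### Bounds in probability -/

section InProb

variable {Ω : Type*} [MeasurableSpace Ω] {P : Measure Ω}

theorem boundedInProb_of_integral_le [IsProbabilityMeasure P] {Z : ℕ → Ω → ℝ} (C : ℝ)
    (hZ : ∀ t ω, 0 ≤ Z t ω) (h : ∀ᶠ t in atTop, Integrable (Z t) P ∧ ∫ ω, Z t ω ∂P ≤ C) :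
    BoundedInProb P Z := by
  intro ε hε
  set M := (|C| + 1) / ε with hM
  have hM0 : 0 < M := by positivity
  refine ⟨M, ?_⟩
  filter_upwards [h] with t ⟨hint, hle⟩
  have hmarkov : P.real {ω | M ≤ Z t ω} ≤ ε := by
    refine le_of_mul_le_mul_left
      ((mul_meas_ge_le_integral_of_nonneg (ae_of_all _ (hZ t)) hint M).trans (hle.trans ?_)) hM0
    rw [hM, div_mul_cancel₀ _ hε.ne']
    linarith [le_abs_self C]
  calc P {ω | M < |Z t ω|} ≤ P {ω | M ≤ Z t ω} := by
        refine measure_mono fun ω hω => ?_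
        rw [Set.mem_ofPred_eq, abs_of_nonneg (hZ t ω)] at hω
        exact hω.le
    _ = ENNReal.ofReal (P.real {ω | M ≤ Z t ω}) := by simp
    _ ≤ ENNReal.ofReal ε := ENNReal.ofReal_le_ofReal hmarkov

theorem boundedInProb_sum_abs {α : Type*} [Fintype α] {Z : α → ℕ → Ω → ℝ}
    (hZ : ∀ a, BoundedInProb P (Z a)) : BoundedInProb P fun t ω => ∑ a, |Z a t ω| := by
  intro ε hε
  have hε' : 0 < ε / (Fintype.card α + 1) := by positivity
  choose M hM using fun a => hZ a _ hε'
  refine ⟨∑ a, M a, ?_⟩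
  filter_upwards [eventually_all.2 hM] with t ht
  calc P {ω | ∑ a, M a < |(∑ a, |Z a t ω|)|} ≤ P (⋃ a, {ω | M a < |Z a t ω|}) := by
        refine measure_mono fun ω hω => ?_
        rw [Set.mem_ofPred_eq, abs_of_nonneg (Finset.sum_nonneg fun a _ => abs_nonneg _)] at hω
        obtain ⟨a, -, ha⟩ := Finset.exists_lt_of_sum_lt hω
        exact Set.mem_iUnion.2 ⟨a, ha⟩
    _ ≤ ∑ a, P {ω | M a < |Z a t ω|} := measure_iUnion_fintype_le _ _
    _ ≤ ∑ _a : α, ENNReal.ofReal (ε / (Fintype.card α + 1)) :=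
        Finset.sum_le_sum fun a _ => ht a
    _ = ENNReal.ofReal (Fintype.card α * (ε / (Fintype.card α + 1))) := by
        rw [Finset.sum_const, Finset.card_univ, nsmul_eq_mul, ← ENNReal.ofReal_natCast,
          ← ENNReal.ofReal_mul (by positivity)]
    _ ≤ ENNReal.ofReal ε := by
        refine ENNReal.ofReal_le_ofReal ?_
        rw [mul_div_left_comm]
        exact mul_le_of_le_one_right hε.le (div_le_one_of_le₀ (by linarith) (by positivity))

theorem tendstoInMeasure_of_boundedInProb {Z : ℕ → Ω → ℝ} (hZ : BoundedInProb P Z)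
    {bad : ℕ → Set Ω} (hbad : Tendsto (fun t => P (bad t)) atTop (𝓝 0)) {R : ℕ → Ω → ℝ}
    (h : ∀ M, 0 ≤ M → ∀ δ > 0, ∀ᶠ t in atTop, ∀ ω ∉ bad t, |Z t ω| ≤ M → |R t ω| < δ) :
    TendstoInMeasure P R atTop fun _ => 0 := by
  rw [tendstoInMeasure_iff_norm]
  intro δ hδ
  rw [ENNReal.tendsto_nhds_zero]
  intro ε hε
  obtain ⟨r, hr, hrε⟩ := ENNReal.lt_iff_exists_nnreal_btwn.1 hε
  have hr2 : 0 < (r : ℝ) / 2 := by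
    have : (0 : ℝ) < r := by exact_mod_cast hr
    positivity
  obtain ⟨M, hM⟩ := hZ _ hr2
  filter_upwards [h |M| (abs_nonneg _) δ hδ, hM,
    ENNReal.tendsto_nhds_zero.1 hbad _ (ENNReal.ofReal_pos.2 hr2)] with t hsmall hZt hbadt
  calc P {ω | δ ≤ ‖R t ω - 0‖} ≤ P (bad t ∪ {ω | M < |Z t ω|}) := by
        refine measure_mono fun ω hω => ?_
        by_contra! hgood
        rw [Set.mem_union, not_or, Set.mem_ofPred_eq, not_lt] at hgood
        rw [Set.mem_ofPred_eq, sub_zero, Real.norm_eq_abs] at hω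
        exact (hsmall ω hgood.1 (hgood.2.trans (le_abs_self M))).not_ge hω
    _ ≤ P (bad t) + P {ω | M < |Z t ω|} := measure_union_le _ _
    _ ≤ ENNReal.ofReal (r / 2) + ENNReal.ofReal (r / 2) := add_le_add hbadt hZt
    _ = r := by
        rw [← ENNReal.ofReal_add hr2.le hr2.le, add_halves, ENNReal.ofReal_coe_nnreal]
    _ ≤ ε := hrε.le

end InProb

section CentredEffects

variable {p : ℕ} {d : Design p} {b : ℕ → EuclideanSpace ℝ (Fin p)} {t : ℕ} {Cb : ℝ}

theorem norm_ofLp_le (v : EuclideanSpace ℝ (Fin p)) : ‖v.ofLp‖ ≤ ‖v‖ :=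
  (pi_norm_le_iff_of_nonneg (norm_nonneg _)).2 fun k => PiLp.norm_apply_le v k

theorem norm_bbar_le (hCb : ∀ M : ℕ, ∑ i ∈ Finset.range M, ‖b i‖ ≤ Cb * M) (hm : 0 < d.m t) :
    ‖bbar d b t‖ ≤ Cb := by
  have hm0 : (0 : ℝ) < d.m t := by exact_mod_cast hm
  rw [bbar, norm_smul, Real.norm_eq_abs, abs_of_pos (inv_pos.2 hm0), inv_mul_le_iff₀ hm0,
    mul_comm, ← Finset.sum_range fun i => b i]
  exact (norm_sum_le _ _).trans (hCb (d.m t))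

theorem norm_centred_le (hCb : ∀ M : ℕ, ∑ i ∈ Finset.range M, ‖b i‖ ≤ Cb * M) (hm : 0 < d.m t)
    (i : ℕ) : ‖centred d b t i‖ ≤ ‖b i‖ + Cb :=
  (norm_sub_le _ _).trans
    (add_le_add (norm_ofLp_le _) ((norm_ofLp_le _).trans (norm_bbar_le hCb hm)))

theorem sum_norm_centred_le (hCb : ∀ M : ℕ, ∑ i ∈ Finset.range M, ‖b i‖ ≤ Cb * M)
    (hm : 0 < d.m t) : ∑ i : Fin (d.m t), ‖centred d b t i‖ ≤ 2 * Cb * d.m t := by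
  calc ∑ i : Fin (d.m t), ‖centred d b t i‖ ≤ ∑ i : Fin (d.m t), (‖b i‖ + Cb) :=
        Finset.sum_le_sum fun i _ => norm_centred_le hCb hm i
    _ = ∑ i ∈ Finset.range (d.m t), ‖b i‖ + d.m t * Cb := by
        rw [Finset.sum_add_distrib, Finset.sum_range]
        simp
    _ ≤ 2 * Cb * d.m t := by linarith [hCb (d.m t)]

end CentredEffects

section ErrorBounds

variable {p : ℕ} {d : Design p} {F : ExpFamily} {β : Fin p → ℝ}
  {b : ℕ → EuclideanSpace ℝ (Fin p)} {Ω : Type*} {y : ℕ → ℕ → ℕ → Ω → ℝ} {c₀ c₁ C₁ C₂ : ℝ}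
  {t m₀ : ℕ}

variable (d F β b y) in
/-- The random quantities that control the estimation error at stage `t` are bounded by `L`: the
operator norm of the penalty, the scores of all clusters on average, those of the clusters `i < m₀`
individually, and the average of the leading terms. -/
structure StochasticBounds (G : Matrix (Fin p) (Fin p) ℝ) (ψ : ℝ) (m₀ : ℕ) (L : ℝ) (t : ℕ)
    (ω : Ω) : Prop where
  penalty_le : ∀ v, ‖ψ • (G⁻¹ *ᵥ v)‖ ≤ L * ‖v‖
  sum_score_sq_le : ∑ i : Fin (d.m t), ‖score d F β b y t i ω‖ ^ 2 ≤ L * (d.m t * d.nL t)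
  score_sq_le : ∀ i < m₀, ‖score d F β b y t i ω‖ ^ 2 ≤ L * d.nL t
  leadMean_sq_le : (d.m t * d.nL t) * ‖leadMean d F β b y t ω‖ ^ 2 ≤ L

variable (d F β b y) in
/-- The bounds on the errors of an estimate `θ` at stage `t`, with individual bounds on the
linearisation errors of the clusters `i < m₀`. -/
structure ErrorBounds (m₀ : ℕ) (C : ℝ) (t : ℕ) (ω : Ω) (θ : Param p (d.m t)) : Prop where
  sum_random : ∑ i, θ.random i = 0
  dev_le : ∀ i, d.nL t * ‖dev d β b θ i‖ ≤
    C * (‖score d F β b y t i ω‖ + 1 + ‖centred d b t i‖)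
  sum_dev_sub_lead_le : d.nL t * ∑ i, ‖dev d β b θ i - lead d F β b y t i ω‖ ≤ C * d.m t
  dev_sub_lead_le : ∀ i : Fin (d.m t), (i : ℕ) < m₀ →
    d.nL t * ‖dev d β b θ i - lead d F β b y t i ω‖ ≤ C * (1 + ‖centred d b t i‖) ^ 2
  sum_score_sq_le : ∑ i : Fin (d.m t), ‖score d F β b y t i ω‖ ^ 2 ≤ C * (d.m t * d.nL t)
  leadMean_sq_le : (d.m t * d.nL t) * ‖leadMean d F β b y t ω‖ ^ 2 ≤ C

theorem ErrorSystem.errorBounds {M : ℝ} {t : ℕ} {ω : Ω} {θ : Param p (d.m t)}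
    {G : Matrix (Fin p) (Fin p) ℝ} {ψ L : ℝ} {m₀ : ℕ}
    (h : ErrorSystem M (d.nL t) (fun i => ‖dev d β b θ i‖) (fun i => ‖score d F β b y t i ω‖)
      (fun i : Fin (d.m t) => ‖centred d b t i‖)
      (fun i => ‖dev d β b θ i - lead d F β b y t i ω‖))
    (hθ : ∑ i, θ.random i = 0) (hs : StochasticBounds d F β b y G ψ m₀ L t ω) (hL : L ≤ M) :
    ErrorBounds d F β b y m₀ (600 * M ^ 9) t ω θ := by
  have hM := h.one_le
  have hMC : M ≤ 600 * M ^ 9 := by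
    linarith [le_self_pow₀ hM (show 9 ≠ 0 by norm_num)]
  refine ⟨hθ, fun i => (h.mul_U_le i).trans ?_, h.mul_sum_E_le,
    fun i hi => h.mul_E_le ((hs.score_sq_le i hi).trans (by gcongr)),
    hs.sum_score_sq_le.trans (by gcongr; linarith), hs.leadMean_sq_le.trans (hL.trans hMC)⟩
  gcongr <;> norm_num

theorem exists_errorBounds (hF : CurvatureBounds F c₀) (hc₁ : 0 < c₁) (hC₁ : 0 ≤ C₁) {L Cb : ℝ}
    (hL : 0 ≤ L) (hCb : 0 ≤ Cb) :
    ∃ C N₀ : ℝ, 0 ≤ C ∧ ∀ t, StageBounds d F β b c₁ C₁ C₂ t → N₀ ≤ d.nL t →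
      ∑ i : Fin (d.m t), ‖centred d b t i‖ ≤ Cb * d.m t →
      ∀ {ω : Ω} {G : Matrix (Fin p) (Fin p) ℝ} {ψ : ℝ} {m₀ : ℕ} {θ : Param p (d.m t)},
        G.PosDef → ψ ≠ 0 → IsPQLEstimate d F (fun i j => y t i j ω) G ψ θ →
        StochasticBounds d F β b y G ψ m₀ L t ω → ErrorBounds d F β b y m₀ C t ω θ := by
  have hφ := F.φ_pos
  have hc := hF.pos
  set κ := c₀ * (c₀ * F.φ * c₁)
  have hκ0 : 0 < κ := by positivity
  set M₁ := p * (1 + L) / κ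
  set M₂ := F.φ⁻¹ * (p * c₁⁻¹) * (L + C₁ * (c₀⁻¹ * (p * C₁) ^ 2))
  have h₁ : 0 ≤ M₁ := by positivity
  have h₂ : 0 ≤ M₂ := by positivity
  set M := 1 + L + Cb + M₁ + M₂
  refine ⟨600 * M ^ 9, 4 * M, by positivity, fun t h hN hcentred ω G ψ m₀ θ hG hψ hθ hs => ?_⟩
  have hMκ : p * (1 + L) ≤ κ * M := by
    rw [← div_le_iff₀' hκ0]
    linarith
  refine ErrorSystem.errorBounds ⟨by linarith, h.one_le_m, by exact_mod_cast h.m_le, hN,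
    fun _ => norm_nonneg _, fun _ => norm_nonneg _, fun _ => norm_nonneg _,
    h.nL_mul_norm_dev_le hF hG hψ hθ hL hs.penalty_le hMκ,
    h.nL_mul_norm_dev_sub_lead_le hF hG hψ hθ hL hs.penalty_le (by linarith),
    hs.sum_score_sq_le.trans ?_, hcentred.trans ?_⟩ (hθ.sum_random hF hG) hs (by linarith)
  · gcongr
    linarith
  · gcongr
    linarith

theorem norm_smul_inv_mulVec_le {G : Matrix (Fin p) (Fin p) ℝ} {ψ M : ℝ} (hψ : |ψ| ≤ M)
    (hG : ∀ k l, |G⁻¹ k l| ≤ M) (v : Fin p → ℝ) :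
    ‖ψ • (G⁻¹ *ᵥ v)‖ ≤ p * M ^ 2 * ‖v‖ := by
  have hM : 0 ≤ M := (abs_nonneg _).trans hψ
  rw [norm_smul, Real.norm_eq_abs]
  calc |ψ| * ‖G⁻¹ *ᵥ v‖ ≤ M * (p * M * ‖v‖) := by
        gcongr
        simpa using norm_mulVec_le hM hG v
    _ = p * M ^ 2 * ‖v‖ := by ring

theorem stochasticBounds_of_le (h : StageBounds d F β b c₁ C₁ C₂ t)
    {G : Matrix (Fin p) (Fin p) ℝ} {ψ M : ℝ} {ω : Ω} (hψ : |ψ| ≤ M) (hG : ∀ k l, |G⁻¹ k l| ≤ M)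
    (hsum : ((d.m t : ℝ) * d.nL t)⁻¹ *
      ∑ i : Fin (d.m t), score d F β b y t i ω ⬝ᵥ score d F β b y t i ω ≤ M)
    (hscore : ∀ i < m₀, (d.nL t : ℝ)⁻¹ *
      (score d F β b y t i ω ⬝ᵥ score d F β b y t i ω) ≤ M)
    (hmean : ((d.m t : ℝ) * d.nL t) *
      (leadMean d F β b y t ω ⬝ᵥ leadMean d F β b y t ω) ≤ M) :
    StochasticBounds d F β b y G ψ m₀ (p * M ^ 2 + M) t ω := by
  have hm := h.m_pos
  have hn := h.nL_pos
  have hM : 0 ≤ M := (abs_nonneg _).trans hψ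
  have hML : M ≤ p * M ^ 2 + M := le_add_of_nonneg_left (by positivity)
  refine ⟨fun v => ?_, ?_, fun i hi => ?_, ?_⟩
  · refine (norm_smul_inv_mulVec_le hψ hG v).trans ?_
    gcongr
    exact le_add_of_nonneg_right hM
  · refine (Finset.sum_le_sum fun i _ => norm_sq_le_dotProduct_self _).trans ?_
    rw [mul_comm]
    exact (inv_mul_le_iff₀ (by positivity)).1 (hsum.trans hML)
  · refine (norm_sq_le_dotProduct_self _).trans ?_
    rw [mul_comm]
    exact (inv_mul_le_iff₀ hn).1 ((hscore i hi).trans hML)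
  · refine le_trans ?_ (hmean.trans hML)
    exact mul_le_mul_of_nonneg_left (norm_sq_le_dotProduct_self _) (by positivity)

variable [MeasurableSpace Ω] {P : Measure Ω} [IsProbabilityMeasure P]

theorem boundedInProb_sum_score (hF : CurvatureBounds F c₀) (hy : ResponseModel d F β b P y)
    (hst : ∀ᶠ t in atTop, StageBounds d F β b c₁ C₁ C₂ t) :
    BoundedInProb P fun t ω => ((d.m t : ℝ) * d.nL t)⁻¹ *
      ∑ i : Fin (d.m t), score d F β b y t i ω ⬝ᵥ score d F β b y t i ω := by
  have hφ := F.φ_pos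
  have hc := hF.pos
  refine boundedInProb_of_integral_le (p * (F.φ * c₀⁻¹ * (p * C₁) ^ 2) * C₂) (fun t ω => ?_) ?_
  · exact mul_nonneg (by positivity) (Finset.sum_nonneg fun i _ =>
      (sq_nonneg _).trans (norm_sq_le_dotProduct_self _))
  filter_upwards [hst] with t h
  have hm := h.m_pos
  have hn := h.nL_pos
  have hint := fun i => h.integral_score_dotProduct_self_le hF hy i
  refine ⟨(integrable_finsetSum _ fun i _ => (hint i).1).const_mul _, ?_⟩
  rw [integral_const_mul, integral_finsetSum _ fun i _ => (hint i).1,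
    inv_mul_le_iff₀ (by positivity)]
  calc ∑ i : Fin (d.m t), ∫ ω, score d F β b y t i ω ⬝ᵥ score d F β b y t i ω ∂P
      ≤ ∑ i : Fin (d.m t), p * (F.φ * c₀⁻¹ * (p * C₁) ^ 2 * d.n t i) :=
        Finset.sum_le_sum fun i _ => (hint i).2
    _ = p * (F.φ * c₀⁻¹ * (p * C₁) ^ 2) * d.N t := by
        rw [Design.N, Nat.cast_sum, Finset.mul_sum]
        exact Finset.sum_congr rfl fun i _ => by ring
    _ ≤ p * (F.φ * c₀⁻¹ * (p * C₁) ^ 2) * (C₂ * (d.m t * d.nL t)) := by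
        gcongr
        exact h.N_le
    _ = d.m t * d.nL t * (p * (F.φ * c₀⁻¹ * (p * C₁) ^ 2) * C₂) := by ring

theorem boundedInProb_score (hF : CurvatureBounds F c₀) (hy : ResponseModel d F β b P y)
    (hm : Tendsto d.m atTop atTop) (hst : ∀ᶠ t in atTop, StageBounds d F β b c₁ C₁ C₂ t) (i : ℕ) :
    BoundedInProb P fun t ω => (d.nL t : ℝ)⁻¹ *
      (score d F β b y t i ω ⬝ᵥ score d F β b y t i ω) := by
  have hφ := F.φ_pos
  have hc := hF.pos
  refine boundedInProb_of_integral_le (p * (F.φ * c₀⁻¹ * (p * C₁) ^ 2 * C₂)) (fun t ω => ?_) ?_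
  · exact mul_nonneg (by positivity) ((sq_nonneg _).trans (norm_sq_le_dotProduct_self _))
  filter_upwards [hst, hm.eventually_gt_atTop i] with t h hi
  obtain ⟨hint, hle⟩ := h.integral_score_dotProduct_self_le hF hy ⟨i, hi⟩
  refine ⟨hint.const_mul _, ?_⟩
  rw [integral_const_mul, inv_mul_le_iff₀ h.nL_pos]
  calc ∫ ω, score d F β b y t i ω ⬝ᵥ score d F β b y t i ω ∂P
      ≤ p * (F.φ * c₀⁻¹ * (p * C₁) ^ 2 * d.n t i) := hle
    _ ≤ p * (F.φ * c₀⁻¹ * (p * C₁) ^ 2 * (C₂ * d.nL t)) := by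
        gcongr
        exact h.size_le i hi
    _ = d.nL t * (p * (F.φ * c₀⁻¹ * (p * C₁) ^ 2 * C₂)) := by ring

theorem boundedInProb_leadMean (hF : CurvatureBounds F c₀) (hy : ResponseModel d F β b P y)
    (hst : ∀ᶠ t in atTop, StageBounds d F β b c₁ C₁ C₂ t) :
    BoundedInProb P fun t ω => ((d.m t : ℝ) * d.nL t) *
      (leadMean d F β b y t ω ⬝ᵥ leadMean d F β b y t ω) := by
  refine boundedInProb_of_integral_le
    (p * (F.φ * c₀⁻¹ * (p * C₁) ^ 2 * (F.φ⁻¹ * (p * c₁⁻¹)) ^ 2)) (fun t ω => ?_) ?_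
  · exact mul_nonneg (by positivity) ((sq_nonneg _).trans (norm_sq_le_dotProduct_self _))
  filter_upwards [hst] with t h
  obtain ⟨hint, hle⟩ := h.integral_leadMean_dotProduct_self_le hF hy
  have hm := h.m_pos
  have hn := h.nL_pos
  refine ⟨hint.const_mul _, ?_⟩
  rw [integral_const_mul]
  refine (mul_le_mul_of_nonneg_left hle (by positivity)).trans_eq ?_
  field_simp

theorem exists_boundedInProb_stochasticBounds (hreg : d.Regime) (hF : CurvatureBounds F c₀)
    (hst : ∀ᶠ t in atTop, StageBounds d F β b c₁ C₁ C₂ t) (hy : ResponseModel d F β b P y)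
    {Ghat : ℕ → Ω → Matrix (Fin p) (Fin p) ℝ} {φhat : ℕ → Ω → ℝ} (h4 : Cond4 P Ghat φhat)
    (m₀ : ℕ) :
    ∃ Z : ℕ → Ω → ℝ, BoundedInProb P Z ∧ ∀ M, 0 ≤ M → ∃ L, 0 ≤ L ∧
      ∀ t, StageBounds d F β b c₁ C₁ C₂ t → ∀ ω, |Z t ω| ≤ M →
        StochasticBounds d F β b y (Ghat t ω) (φhat t ω) m₀ L t ω := by
  set Z : ((Fin p × Fin p) ⊕ Fin m₀) ⊕ Fin 3 → ℕ → Ω → ℝ := Sum.elim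
    (Sum.elim (fun kl t ω => (Ghat t ω)⁻¹ kl.1 kl.2)
      (fun i t ω => (d.nL t : ℝ)⁻¹ * (score d F β b y t i ω ⬝ᵥ score d F β b y t i ω)))
    ![φhat,
      fun t ω => ((d.m t : ℝ) * d.nL t)⁻¹ *
        ∑ i : Fin (d.m t), score d F β b y t i ω ⬝ᵥ score d F β b y t i ω,
      fun t ω => ((d.m t : ℝ) * d.nL t) *
        (leadMean d F β b y t ω ⬝ᵥ leadMean d F β b y t ω)]
  have hZ : ∀ a, BoundedInProb P (Z a) := by
    rintro ((kl | i) | a)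
    · exact h4.inv_bounded kl.1 kl.2
    · exact boundedInProb_score hF hy hreg.m_tendsto hst i
    · fin_cases a
      · exact h4.bounded
      · exact boundedInProb_sum_score hF hy hst
      · exact boundedInProb_leadMean hF hy hst
  refine ⟨_, boundedInProb_sum_abs hZ, fun M hM => ⟨p * M ^ 2 + M, by positivity,
    fun t h ω hω => ?_⟩⟩
  have hZM (a) : |Z a t ω| ≤ M :=
    (Finset.single_le_sum (f := fun a => |Z a t ω|) (fun _ _ => abs_nonneg _)
      (Finset.mem_univ a)).trans ((le_abs_self _).trans hω)
  exact stochasticBounds_of_le h (hZM (.inr 0)) (fun k l => hZM (.inl (.inl (k, l))))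
    ((le_abs_self _).trans (hZM (.inr 1)))
    (fun i hi => (le_abs_self _).trans (hZM (.inl (.inr ⟨i, hi⟩))))
    ((le_abs_self _).trans (hZM (.inr 2)))

theorem tendstoInMeasure_of_errorBounds (hreg : d.Regime) (hF : CurvatureBounds F c₀)
    (h3 : Cond3 d F β b) (hst : ∀ᶠ t in atTop, StageBounds d F β b c₁ C₁ C₂ t)
    (hy : ResponseModel d F β b P y)
    {Ghat : ℕ → Ω → Matrix (Fin p) (Fin p) ℝ} {φhat : ℕ → Ω → ℝ} (h4 : Cond4 P Ghat φhat)
    {θhat : ∀ t, Ω → Param p (d.m t)}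
    (hθ : Tendsto (fun t => P {ω | ¬ IsPQLEstimate d F (fun i j => y t i j ω)
        (Ghat t ω) (φhat t ω) (θhat t ω)}) atTop (𝓝 0)) (m₀ : ℕ) {R : ℕ → Ω → ℝ}
    (hR : ∀ C, 0 ≤ C → ∀ δ > 0, ∀ᶠ t in atTop, ∀ ω,
      ErrorBounds d F β b y m₀ C t ω (θhat t ω) → |R t ω| < δ) :
    TendstoInMeasure P R atTop fun _ => 0 := by
  obtain ⟨Cb, hCb⟩ := h3.effects
  have hCb0 : 0 ≤ Cb := (norm_nonneg (b 0)).trans (by simpa using hCb 1)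
  obtain ⟨t₀, ht₀⟩ := hst.exists
  obtain ⟨Z, hZ, hbounds⟩ := exists_boundedInProb_stochasticBounds hreg hF hst hy h4 m₀
  refine tendstoInMeasure_of_boundedInProb hZ hθ fun M hM δ hδ => ?_
  obtain ⟨L, hL, hstoch⟩ := hbounds M hM
  obtain ⟨C, N₀, hC, herror⟩ := exists_errorBounds (d := d) (β := β) (b := b) (y := y) (C₂ := C₂)
    hF ht₀.c_pos ht₀.C_nonneg hL (show 0 ≤ 2 * Cb by positivity)
  have hlarge : ∀ᶠ t in atTop, N₀ ≤ d.nL t :=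
    (tendsto_natCast_atTop_atTop.comp hreg.nL_tendsto).eventually_ge_atTop N₀
  filter_upwards [hst, hlarge, hR C hC δ hδ] with t h hN hRt ω hω hZω
  exact hRt ω (herror t h hN (sum_norm_centred_le hCb h.one_le_m) (h4.posDef t ω) (h4.pos t ω).ne'
    (not_not.1 hω) (hstoch t h ω hZω))

end ErrorBounds

section Consistency

variable {p : ℕ} {d : Design p} {F : ExpFamily} {β : Fin p → ℝ}
  {b : ℕ → EuclideanSpace ℝ (Fin p)} {Ω : Type*} {y : ℕ → ℕ → ℕ → Ω → ℝ} {c₀ c₁ C₁ C₂ : ℝ}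
  {m₀ : ℕ} {C : ℝ} {t : ℕ} {ω : Ω} {θ : Param p (d.m t)}

theorem Param.norm_fixed_le {m : ℕ} (α : Param p m) : ‖α.fixed‖ ≤ ‖α‖ :=
  (pi_norm_le_iff_of_nonneg (norm_nonneg _)).2 fun k => norm_le_pi_norm α (k, none)

theorem Param.norm_random_le {m : ℕ} (α : Param p m) (i : Fin m) : ‖α.random i‖ ≤ ‖α‖ :=
  (pi_norm_le_iff_of_nonneg (norm_nonneg _)).2 fun k => norm_le_pi_norm α (k, some i)

theorem sqrt_mul_mul_eq {n : ℝ} (hn : 0 < n) (C m : ℝ) :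
    Real.sqrt (C * (m * n)) = n * Real.sqrt (C * (m / n)) := by
  rw [← Real.sqrt_sq hn.le, ← Real.sqrt_mul (sq_nonneg _), Real.sqrt_sq hn.le]
  congr 1
  field_simp

theorem norm_sub_target_le_two_mul (hm : 0 < d.m t) (hθ : ∑ i, θ.random i = 0) {ρ : ℝ}
    (hdev : ∀ i, ‖dev d β b θ i‖ ≤ ρ) : ‖θ - target d β b t‖ ≤ 2 * ρ := by
  have hρ : 0 ≤ ρ := (norm_nonneg _).trans (hdev ⟨0, hm⟩)
  have hmean : ‖devMean d β b θ‖ ≤ ρ := by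
    refine (norm_devMean_le θ).trans ?_
    rw [inv_mul_le_iff₀ (by exact_mod_cast hm)]
    refine (Finset.sum_le_sum fun i _ => hdev i).trans_eq ?_
    simp
  have hmeank (k) := (norm_le_pi_norm (devMean d β b θ) k).trans hmean
  refine (pi_norm_le_iff_of_nonneg (by positivity)).2 ?_
  rintro ⟨k, _ | i⟩
  · rw [sub_target_fixed hm hθ]
    linarith [hmeank k]
  · rw [sub_target_random hm hθ, two_mul]
    exact (norm_sub_le _ _).trans
      (add_le_add ((norm_le_pi_norm (dev d β b θ i) k).trans (hdev i)) (hmeank k))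

namespace ErrorBounds

theorem norm_dev_le (e : ErrorBounds d F β b y m₀ C t ω θ)
    (h : StageBounds d F β b c₁ C₁ C₂ t) (hC : 0 ≤ C) {Cb : ℝ}
    (hcentred : ∑ i : Fin (d.m t), ‖centred d b t i‖ ≤ Cb * d.m t) (i : Fin (d.m t)) :
    ‖dev d β b θ i‖ ≤ C * (Real.sqrt (C * ((d.m t : ℝ) / d.nL t)) + (d.nL t : ℝ)⁻¹ +
      Cb * ((d.m t : ℝ) / d.nL t)) := by
  have hn := h.nL_pos
  have hscore : ‖score d F β b y t i ω‖ ≤ d.nL t * Real.sqrt (C * ((d.m t : ℝ) / d.nL t)) := by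
    rw [← sqrt_mul_mul_eq hn]
    refine Real.le_sqrt_of_sq_le (le_trans ?_ e.sum_score_sq_le)
    exact Finset.single_le_sum (f := fun i : Fin (d.m t) => ‖score d F β b y t i ω‖ ^ 2)
      (fun _ _ => sq_nonneg _) (Finset.mem_univ i)
  have hcentred_i : ‖centred d b t i‖ ≤ Cb * d.m t :=
    (Finset.single_le_sum (f := fun i : Fin (d.m t) => ‖centred d b t i‖)
      (fun _ _ => norm_nonneg _) (Finset.mem_univ i)).trans hcentred
  refine le_of_mul_le_mul_left ((e.dev_le i).trans ?_) hn
  calc C * (‖score d F β b y t i ω‖ + 1 + ‖centred d b t i‖)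
      ≤ C * (d.nL t * Real.sqrt (C * ((d.m t : ℝ) / d.nL t)) + 1 + Cb * d.m t) := by gcongr
    _ = d.nL t * (C * (Real.sqrt (C * ((d.m t : ℝ) / d.nL t)) + (d.nL t : ℝ)⁻¹ +
          Cb * ((d.m t : ℝ) / d.nL t))) := by field_simp

theorem norm_devMean_sub_leadMean_le (e : ErrorBounds d F β b y m₀ C t ω θ)
    (h : StageBounds d F β b c₁ C₁ C₂ t) :
    ‖devMean d β b θ - leadMean d F β b y t ω‖ ≤ C * (d.nL t : ℝ)⁻¹ := by
  have hm := h.m_pos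
  have hn := h.nL_pos
  rw [devMean, leadMean, ← smul_sub, ← Finset.sum_sub_distrib, norm_smul, Real.norm_eq_abs,
    abs_of_pos (by positivity), inv_mul_le_iff₀ hm]
  refine (norm_sum_le _ _).trans (le_of_mul_le_mul_left (e.sum_dev_sub_lead_le.trans_eq ?_) hn)
  field_simp

theorem sqrt_N_mul_norm_le (e : ErrorBounds d F β b y m₀ C t ω θ)
    (h : StageBounds d F β b c₁ C₁ C₂ t) :
    Real.sqrt (d.N t) * ‖devMean d β b θ - leadMean d F β b y t ω‖ ≤
      C * Real.sqrt (C₂ * ((d.m t : ℝ) / d.nL t)) := by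
  have hn := h.nL_pos
  have hN : Real.sqrt (d.N t) ≤ d.nL t * Real.sqrt (C₂ * ((d.m t : ℝ) / d.nL t)) := by
    rw [← sqrt_mul_mul_eq hn]
    exact Real.sqrt_le_sqrt h.N_le
  calc Real.sqrt (d.N t) * ‖devMean d β b θ - leadMean d F β b y t ω‖
      ≤ d.nL t * Real.sqrt (C₂ * ((d.m t : ℝ) / d.nL t)) * (C * (d.nL t : ℝ)⁻¹) := by
        gcongr
        exact e.norm_devMean_sub_leadMean_le h
    _ = C * Real.sqrt (C₂ * ((d.m t : ℝ) / d.nL t)) := by field_simp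

theorem norm_leadMean_le (e : ErrorBounds d F β b y m₀ C t ω θ)
    (h : StageBounds d F β b c₁ C₁ C₂ t) (hC : 0 ≤ C) : ‖leadMean d F β b y t ω‖ ≤
      Real.sqrt C * ((Real.sqrt (d.m t))⁻¹ * (Real.sqrt (d.nL t))⁻¹) := by
  have hm := h.m_pos
  have hn := h.nL_pos
  have hsq : ‖leadMean d F β b y t ω‖ ^ 2 ≤ C / (d.m t * d.nL t) := by
    rw [le_div_iff₀ (by positivity), mul_comm]
    exact e.leadMean_sq_le
  refine (Real.le_sqrt_of_sq_le hsq).trans_eq ?_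
  rw [Real.sqrt_div hC, Real.sqrt_mul hm.le, div_eq_mul_inv, mul_inv]

theorem sqrt_n_mul_norm_le (e : ErrorBounds d F β b y m₀ C t ω θ)
    (h : StageBounds d F β b c₁ C₁ C₂ t) (hC : 0 ≤ C) {B : ℝ} {i : Fin (d.m t)}
    (hi : (i : ℕ) < m₀) (hB : ‖centred d b t i‖ ≤ B) :
    Real.sqrt (d.n t i) * ‖dev d β b θ i - lead d F β b y t i ω - devMean d β b θ‖ ≤
      Real.sqrt C₂ * (C * (1 + B) ^ 2 * (Real.sqrt (d.nL t))⁻¹ + C * (Real.sqrt (d.nL t))⁻¹ +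
        Real.sqrt C * (Real.sqrt (d.m t))⁻¹) := by
  have hn := h.nL_pos
  set r := Real.sqrt (d.nL t) with hr
  have hr0 : 0 < r := Real.sqrt_pos.2 hn
  have hinv : (d.nL t : ℝ)⁻¹ = r⁻¹ * r⁻¹ := by rw [← mul_inv, hr, Real.mul_self_sqrt hn.le]
  have hsize : Real.sqrt (d.n t i) ≤ Real.sqrt C₂ * r := by
    rw [hr, ← Real.sqrt_mul' _ hn.le]
    exact Real.sqrt_le_sqrt (h.size_le i i.2)
  have hlead : ‖dev d β b θ i - lead d F β b y t i ω‖ ≤ C * (1 + B) ^ 2 * (d.nL t : ℝ)⁻¹ := by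
    rw [← div_eq_mul_inv, le_div_iff₀' hn]
    exact (e.dev_sub_lead_le i hi).trans (by gcongr)
  have hmean : ‖devMean d β b θ‖ ≤
      C * (d.nL t : ℝ)⁻¹ + Real.sqrt C * ((Real.sqrt (d.m t))⁻¹ * r⁻¹) :=
    calc ‖devMean d β b θ‖
        = ‖(devMean d β b θ - leadMean d F β b y t ω) + leadMean d F β b y t ω‖ := by
          rw [sub_add_cancel]
      _ ≤ _ := norm_add_le_of_le (e.norm_devMean_sub_leadMean_le h) (e.norm_leadMean_le h hC)
  calc Real.sqrt (d.n t i) * ‖dev d β b θ i - lead d F β b y t i ω - devMean d β b θ‖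
      ≤ (Real.sqrt C₂ * r) * (C * (1 + B) ^ 2 * (d.nL t : ℝ)⁻¹ +
          (C * (d.nL t : ℝ)⁻¹ + Real.sqrt C * ((Real.sqrt (d.m t))⁻¹ * r⁻¹))) := by
        gcongr
        exact norm_sub_le_of_le hlead hmean
    _ = Real.sqrt C₂ * (C * (1 + B) ^ 2 * r⁻¹ + C * r⁻¹ +
          Real.sqrt C * (Real.sqrt (d.m t))⁻¹) := by
        rw [hinv]
        field_simp
        ring

end ErrorBounds

theorem tendsto_inv_nL (hreg : d.Regime) :
    Tendsto (fun t => (d.nL t : ℝ)⁻¹) atTop (𝓝 0) :=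
  tendsto_inv_atTop_zero.comp (tendsto_natCast_atTop_atTop.comp hreg.nL_tendsto)

theorem tendsto_inv_sqrt_natCast {f : ℕ → ℕ} (hf : Tendsto f atTop atTop) :
    Tendsto (fun t => (Real.sqrt (f t))⁻¹) atTop (𝓝 0) :=
  tendsto_inv_atTop_zero.comp
    (Real.tendsto_sqrt_atTop.comp (tendsto_natCast_atTop_atTop.comp hf))

theorem tendsto_sqrt_mul_ratio (hreg : d.Regime) (c : ℝ) :
    Tendsto (fun t => Real.sqrt (c * ((d.m t : ℝ) / d.nL t))) atTop (𝓝 0) := by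
  simpa only [mul_zero, Real.sqrt_zero] using (hreg.ratio.const_mul c).sqrt

variable [MeasurableSpace Ω] {P : Measure Ω} [IsProbabilityMeasure P]

theorem tendstoInMeasure_norm_sub_target (hreg : d.Regime) (hF : CurvatureBounds F c₀)
    (h3 : Cond3 d F β b) (hst : ∀ᶠ t in atTop, StageBounds d F β b c₁ C₁ C₂ t)
    (hy : ResponseModel d F β b P y)
    {Ghat : ℕ → Ω → Matrix (Fin p) (Fin p) ℝ} {φhat : ℕ → Ω → ℝ} (h4 : Cond4 P Ghat φhat)
    {θhat : ∀ t, Ω → Param p (d.m t)}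
    (hθ : Tendsto (fun t => P {ω | ¬ IsPQLEstimate d F (fun i j => y t i j ω)
        (Ghat t ω) (φhat t ω) (θhat t ω)}) atTop (𝓝 0)) :
    TendstoInMeasure P (fun t ω => ‖θhat t ω - target d β b t‖) atTop (fun _ => 0) := by
  obtain ⟨Cb, hCb⟩ := h3.effects
  refine tendstoInMeasure_of_errorBounds hreg hF h3 hst hy h4 hθ 0 fun C hC δ hδ => ?_
  have hlim : Tendsto (fun t => 2 * (C * (Real.sqrt (C * ((d.m t : ℝ) / d.nL t)) +
      (d.nL t : ℝ)⁻¹ + 2 * Cb * ((d.m t : ℝ) / d.nL t)))) atTop (𝓝 0) := by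
    simpa only [mul_zero, add_zero] using ((((tendsto_sqrt_mul_ratio hreg C).add
      (tendsto_inv_nL hreg)).add (hreg.ratio.const_mul (2 * Cb))).const_mul C).const_mul 2
  filter_upwards [hst, hlim.eventually_lt_const hδ] with t h hlt ω e
  rw [abs_of_nonneg (norm_nonneg _)]
  exact (norm_sub_target_le_two_mul h.one_le_m e.sum_random
    (e.norm_dev_le h hC (sum_norm_centred_le hCb h.one_le_m))).trans_lt hlt

end Consistency

/-! ### Finite selections -/

section Blocks

variable {p q : ℕ} {d : Design p} {F : ExpFamily} {β : Fin p → ℝ}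
  {b : ℕ → EuclideanSpace ℝ (Fin p)} {t : ℕ}

theorem sum_fin_eq_sum_range {E : Type*} [AddCommMonoid E] {m m₀ : ℕ} (hm : m₀ ≤ m) {g : ℕ → E}
    (hg : ∀ i, m₀ ≤ i → g i = 0) : ∑ i : Fin m, g i = ∑ i ∈ Finset.range m₀, g i := by
  rw [← Finset.sum_range]
  refine (Finset.sum_subset (Finset.range_mono hm) fun i _ hi => hg i ?_).symm
  exact not_lt.1 fun h => hi (Finset.mem_range.2 h)

theorem mul_mul_transpose_apply {m n : Type*} [Fintype n] (A : Matrix m n ℝ) (M : Matrix n n ℝ)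
    (r r' : m) : (A * M * Aᵀ) r r' = A r ⬝ᵥ (M *ᵥ A r') := by
  rw [dotProduct_mulVec]
  rfl

theorem tendsto_mul_mul_transpose {m n : Type*} [Fintype n] {A : ℕ → Matrix m n ℝ}
    {M : ℕ → Matrix n n ℝ} {A' : Matrix m n ℝ} {M' : Matrix n n ℝ}
    (hA : Tendsto A atTop (𝓝 A')) (hM : Tendsto M atTop (𝓝 M')) :
    Tendsto (fun t => A t * M t * (A t)ᵀ) atTop (𝓝 (A' * M' * A'ᵀ)) := by
  have hc : Continuous fun x : Matrix m n ℝ × Matrix n n ℝ => x.1 * x.2 * x.1ᵀ :=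
    (continuous_fst.matrix_mul continuous_snd).matrix_mul continuous_fst.matrix_transpose
  simpa only [Function.comp_def] using (hc.tendsto (A', M')).comp (hA.prodMk_nhds hM)

theorem dotProduct_param {m : ℕ} (α δ : Param p m) :
    α ⬝ᵥ δ = α.fixed ⬝ᵥ δ.fixed + ∑ i, α.random i ⬝ᵥ δ.random i := by
  simp only [dotProduct, Param.fixed, Param.random]
  rw [Fintype.sum_prod_type, Finset.sum_comm (s := (Finset.univ : Finset (Fin m))),
    ← Finset.sum_add_distrib]
  refine Finset.sum_congr rfl fun k _ => ?_
  rw [Fintype.sum_option]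

theorem fixed_scaling_mulVec (δ : Param p (d.m t)) :
    Param.fixed (scaling d t *ᵥ δ) = Real.sqrt (d.N t) • δ.fixed := by
  ext k
  simp [scaling, Param.fixed, mulVec_diagonal]

theorem random_scaling_mulVec (δ : Param p (d.m t)) (i : Fin (d.m t)) :
    Param.random (scaling d t *ᵥ δ) i = Real.sqrt (d.n t i) • δ.random i := by
  ext k
  simp [scaling, Param.random, mulVec_diagonal]

theorem fixed_blockMatrix_mulVec (δ : Param p (d.m t)) :
    Param.fixed (blockMatrix d F β b t *ᵥ δ) = Hbar d F β b t *ᵥ δ.fixed := by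
  ext k
  simp only [blockMatrix, Param.fixed, mulVec, dotProduct]
  rw [Fintype.sum_prod_type]
  refine Finset.sum_congr rfl fun l _ => ?_
  rw [Fintype.sum_option]
  simp [blockDiagonal_apply]

theorem random_blockMatrix_mulVec (δ : Param p (d.m t)) (i : Fin (d.m t)) :
    Param.random (blockMatrix d F β b t *ᵥ δ) i = H d F β b t i *ᵥ δ.random i := by
  ext k
  simp only [blockMatrix, Param.random, mulVec, dotProduct]
  rw [Fintype.sum_prod_type]
  refine Finset.sum_congr rfl fun l _ => ?_
  rw [Fintype.sum_option]
  simp [blockDiagonal_apply]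

theorem dotProduct_blockMatrix_mulVec (α δ : Param p (d.m t)) :
    α ⬝ᵥ (blockMatrix d F β b t *ᵥ δ) = α.fixed ⬝ᵥ (Hbar d F β b t *ᵥ δ.fixed) +
      ∑ i, α.random i ⬝ᵥ (H d F β b t i *ᵥ δ.random i) := by
  rw [dotProduct_param, fixed_blockMatrix_mulVec]
  simp_rw [random_blockMatrix_mulVec]

/-- The block `A^{(0)}` (for `none`) or `A^{(i)}` (for `some i`) of a `q × (m + 1) p` matrix; it is
zero if there is no cluster `i`. -/
def block {m : ℕ} (A : Matrix (Fin q) (Fin p × Option (Fin m)) ℝ) (s : Option ℕ) :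
    Matrix (Fin q) (Fin p) ℝ :=
  of fun r k => entry A r k s

theorem block_some {m : ℕ} (A : Matrix (Fin q) (Fin p × Option (Fin m)) ℝ) (r : Fin q)
    (i : Fin m) : block A (some i) r = Param.random (A r) i := by
  ext k
  simp [block, entry, Param.random]

theorem mul_blockMatrix_mul_transpose (A : Matrix (Fin q) (Fin p × Option (Fin (d.m t))) ℝ) :
    A * blockMatrix d F β b t * Aᵀ = block A none * Hbar d F β b t * (block A none)ᵀ +
      ∑ i : Fin (d.m t), block A (some i) * H d F β b t i * (block A (some i))ᵀ := by
  ext r r'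
  rw [mul_mul_transpose_apply, dotProduct_blockMatrix_mulVec, Matrix.add_apply, Matrix.sum_apply,
    mul_mul_transpose_apply]
  simp_rw [mul_mul_transpose_apply, block_some]
  rfl

theorem norm_param_le_sum {m m₀ : ℕ} {α : Param p m}
    (hα : ∀ i : Fin m, m₀ ≤ i → α.random i = 0) {u : ℕ → ℝ} (hu : ∀ i, 0 ≤ u i)
    (hαu : ∀ i : Fin m, ‖α.random i‖ ≤ u i) :
    ‖α‖ ≤ ‖α.fixed‖ + ∑ i ∈ Finset.range m₀, u i := by
  have hsum : 0 ≤ ∑ i ∈ Finset.range m₀, u i := Finset.sum_nonneg fun i _ => hu i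
  refine (pi_norm_le_iff_of_nonneg (by positivity)).2 ?_
  rintro ⟨k, _ | i⟩
  · exact (norm_le_pi_norm α.fixed k).trans (le_add_of_nonneg_right hsum)
  · refine (norm_le_pi_norm (α.random i) k).trans (le_add_of_nonneg_of_le (norm_nonneg _) ?_)
    rcases lt_or_ge (i : ℕ) m₀ with hi | hi
    · exact (hαu i).trans
        (Finset.single_le_sum (fun i _ => hu i) (Finset.mem_range.2 hi))
    · rwa [hα i hi, norm_zero]

end Blocks

section FiniteSelection

variable {p q : ℕ} {d : Design p} {F : ExpFamily} {β : Fin p → ℝ}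
  {b : ℕ → EuclideanSpace ℝ (Fin p)} {c₀ c₁ C₁ C₂ : ℝ}
  {A : ∀ t, Matrix (Fin q) (Fin p × Option (Fin (d.m t))) ℝ}
  {L : Option ℕ → Matrix (Fin q) (Fin p) ℝ} {K₀ : Matrix (Fin p) (Fin p) ℝ}
  {K : ℕ → Matrix (Fin p) (Fin p) ℝ}

/-- The limit covariance of a finite selection, the sum of the contributions of the fixed effects
and of the clusters. -/
def limitCov (L : Option ℕ → Matrix (Fin q) (Fin p) ℝ) (K₀ : Matrix (Fin p) (Fin p) ℝ)
    (K : ℕ → Matrix (Fin p) (Fin p) ℝ) : Matrix (Fin q) (Fin q) ℝ :=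
  L none * K₀ * (L none)ᵀ + ∑ᶠ i : ℕ, L (some i) * K i * (L (some i))ᵀ

theorem posSemidef_limitCov (L : Option ℕ → Matrix (Fin q) (Fin p) ℝ) (hK₀ : K₀.PosSemidef)
    (hK : ∀ i, (K i).PosSemidef) : (limitCov L K₀ K).PosSemidef := by
  have hconj {M : Matrix (Fin p) (Fin p) ℝ} (hM : M.PosSemidef) (B : Matrix (Fin q) (Fin p) ℝ) :
      (B * M * Bᵀ).PosSemidef := by
    simpa only [conjTranspose_eq_transpose_of_trivial] using hM.mul_mul_conjTranspose_same B
  exact (hconj hK₀ _).add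
    (finsum_induction _ PosSemidef.zero (fun _ _ => PosSemidef.add) fun i => hconj (hK i) _)

namespace FiniteSelection

theorem tendsto_block (hA : FiniteSelection d A L) (s : Option ℕ) :
    Tendsto (fun t => block (A t) s) atTop (𝓝 (L s)) :=
  tendsto_pi_nhds.2 fun r => tendsto_pi_nhds.2 fun k => hA.tendsto r k s

theorem exists_block_eq_zero (hA : FiniteSelection d A L) :
    ∃ m₀ : ℕ, ∀ t, m₀ < d.m t → ∀ i, m₀ ≤ i → block (A t) (some i) = 0 := by
  choose m₀ hm₀ using hA.finite
  have hle (r : Fin q) : m₀ r ≤ ∑ r, m₀ r :=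
    Finset.single_le_sum (fun _ _ => Nat.zero_le _) (Finset.mem_univ r)
  refine ⟨∑ r, m₀ r, fun t ht i hi => ?_⟩
  ext r k
  simp only [block, of_apply, entry]
  split_ifs with h
  · exact hm₀ r t ((hle r).trans_lt ht) ⟨i, h⟩ ((hle r).trans hi) k
  · rfl

theorem limit_eq_zero (hA : FiniteSelection d A L) (hm : Tendsto d.m atTop atTop) {m₀ : ℕ}
    (hm₀ : ∀ t, m₀ < d.m t → ∀ i, m₀ ≤ i → block (A t) (some i) = 0) {i : ℕ} (hi : m₀ ≤ i) :
    L (some i) = 0 := by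
  refine tendsto_nhds_unique (hA.tendsto_block (some i)) (tendsto_const_nhds.congr' ?_)
  filter_upwards [hm.eventually_gt_atTop m₀] with t ht
  exact (hm₀ t ht i hi).symm

theorem tendsto_mul_blockMatrix_mul_transpose (hA : FiniteSelection d A L)
    (hm : Tendsto d.m atTop atTop) (h2 : Cond2 d F β b K₀ K) :
    Tendsto (fun t => A t * blockMatrix d F β b t * (A t)ᵀ) atTop (𝓝 (limitCov L K₀ K)) := by
  obtain ⟨m₀, hm₀⟩ := hA.exists_block_eq_zero
  have hsupp : limitCov L K₀ K = L none * K₀ * (L none)ᵀ +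
      ∑ i ∈ Finset.range m₀, L (some i) * K i * (L (some i))ᵀ := by
    refine congrArg _ (finsum_eq_sum_of_support_subset _ fun i hi => ?_)
    refine Finset.mem_coe.2 (Finset.mem_range.2 (not_le.1 fun hle => hi ?_))
    simp only [hA.limit_eq_zero hm hm₀ hle, Matrix.zero_mul]
  rw [hsupp]
  refine ((tendsto_mul_mul_transpose (hA.tendsto_block none) h2.tendsto_bar).add
    (tendsto_finsetSum _ fun i _ =>
      tendsto_mul_mul_transpose (hA.tendsto_block (some i)) (h2.tendsto i))).congr' ?_
  filter_upwards [hm.eventually_gt_atTop m₀] with t ht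
  rw [mul_blockMatrix_mul_transpose, ← sum_fin_eq_sum_range ht.le fun i hi => by
    rw [hm₀ t ht i hi, Matrix.zero_mul, Matrix.zero_mul]]

theorem exists_norm_row_le (hA : FiniteSelection d A L) (hm : Tendsto d.m atTop atTop) :
    ∃ a, 0 ≤ a ∧ ∀ᶠ t in atTop, ∀ r, ‖A t r‖ ≤ a := by
  obtain ⟨m₀, hm₀⟩ := hA.exists_block_eq_zero
  have hlim (r : Fin q) : Tendsto (fun t => ‖block (A t) none r‖ +
      ∑ i ∈ Finset.range m₀, ‖block (A t) (some i) r‖) atTop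
      (𝓝 (‖L none r‖ + ∑ i ∈ Finset.range m₀, ‖L (some i) r‖)) :=
    (tendsto_pi_nhds.1 (hA.tendsto_block none) r).norm.add (tendsto_finsetSum _ fun i _ =>
      (tendsto_pi_nhds.1 (hA.tendsto_block (some i)) r).norm)
  set ℓ : Fin q → ℝ := fun r => ‖L none r‖ + ∑ i ∈ Finset.range m₀, ‖L (some i) r‖
  have hℓ (r : Fin q) : 0 ≤ ℓ r + 1 := by positivity
  refine ⟨∑ r, (ℓ r + 1), Finset.sum_nonneg fun r _ => hℓ r, ?_⟩
  filter_upwards [hm.eventually_gt_atTop m₀,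
    eventually_all.2 fun r => (hlim r).eventually_lt_const (lt_add_one (ℓ r))] with t ht hlt r
  calc ‖A t r‖ ≤ ‖block (A t) none r‖ + ∑ i ∈ Finset.range m₀, ‖block (A t) (some i) r‖ :=
        norm_param_le_sum (fun i hi => by rw [← block_some, hm₀ t ht i hi]; rfl)
          (fun i => norm_nonneg _) fun i => by rw [block_some]
    _ ≤ ℓ r + 1 := (hlt r).le
    _ ≤ ∑ r, (ℓ r + 1) := Finset.single_le_sum (fun r _ => hℓ r) (Finset.mem_univ r)

end FiniteSelection

end FiniteSelection

/-! ### Asymptotic normality -/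

section LeadingTerm

variable {p : ℕ} {d : Design p} {F : ExpFamily} {β : Fin p → ℝ}
  {b : ℕ → EuclideanSpace ℝ (Fin p)} {Ω : Type*} {y : ℕ → ℕ → ℕ → Ω → ℝ} {c₀ c₁ C₁ C₂ a : ℝ}
  {t m₀ : ℕ}

theorem abs_sum_fin_le {m m₀ : ℕ} {f : Fin m → ℝ} {B : ℝ} (hB : 0 ≤ B)
    (hf : ∀ i : Fin m, m₀ ≤ i → f i = 0) (hfB : ∀ i : Fin m, (i : ℕ) < m₀ → |f i| ≤ B) :
    |(∑ i, f i)| ≤ m₀ * B := by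
  set s : Finset (Fin m) := Finset.univ.filter fun i : Fin m => (i : ℕ) < m₀
  have hsupp : ∑ i ∈ s, f i = ∑ i, f i :=
    Finset.sum_filter_of_ne fun i _ hi => not_le.1 fun hle => hi (hf i hle)
  have hcard : s.card ≤ m₀ := (Fin.card_filter_val_lt ..).trans_le (min_le_right _ _)
  calc |(∑ i, f i)| ≤ ∑ i ∈ s, |f i| := hsupp ▸ Finset.abs_sum_le_sum_abs _ _
    _ ≤ s.card • B := Finset.sum_le_card_nsmul _ _ _ fun i hi => hfB i (Finset.mem_filter.1 hi).2
    _ ≤ m₀ * B := by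
        rw [nsmul_eq_mul]
        gcongr

variable (d F β b y) in
/-- The leading terms of the estimation errors of all blocks, as a parameter vector. -/
def leadParam (t : ℕ) (ω : Ω) : Param p (d.m t)
  | (k, none) => leadMean d F β b y t ω k
  | (k, some i) => lead d F β b y t i ω k

variable (d) in
/-- The vector `(N^{1/2} / m) α₀ + n_i^{1/2} α_i`: the leading term of the fixed effects is the
average of those of the clusters, so this is the total weight of the leading term of cluster `i` in
`α ⬝ᵥ scaling d t *ᵥ leadParam`. -/
def blockComb (α : Param p (d.m t)) (i : Fin (d.m t)) : Fin p → ℝ :=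
  (Real.sqrt (d.N t) / d.m t) • α.fixed + Real.sqrt (d.n t i) • α.random i

variable (d F β b) in
/-- The coefficient of the score of cluster `i` in `α ⬝ᵥ scaling d t *ᵥ leadParam`. -/
def scoreCoeff (α : Param p (d.m t)) (i : Fin (d.m t)) : Fin p → ℝ :=
  ((d.n t i : ℝ) * F.φ)⁻¹ • (H d F β b t i *ᵥ blockComb d α i)

theorem dotProduct_scaling_mulVec (α δ : Param p (d.m t)) :
    α ⬝ᵥ (scaling d t *ᵥ δ) = α.fixed ⬝ᵥ (Real.sqrt (d.N t) • δ.fixed) +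
      ∑ i : Fin (d.m t), α.random i ⬝ᵥ (Real.sqrt (d.n t i) • δ.random i) := by
  rw [dotProduct_param, fixed_scaling_mulVec]
  simp_rw [random_scaling_mulVec]

theorem dotProduct_scaling_leadParam (h : StageBounds d F β b c₁ C₁ C₂ t)
    (α : Param p (d.m t)) (ω : Ω) : α ⬝ᵥ (scaling d t *ᵥ leadParam d F β b y t ω) =
      ∑ i : Fin (d.m t), scoreCoeff d F β b α i ⬝ᵥ score d F β b y t i ω := by
  have hfixed : (leadParam d F β b y t ω).fixed = leadMean d F β b y t ω := rfl
  have hrandom (i : Fin (d.m t)) :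
      (leadParam d F β b y t ω).random i = lead d F β b y t i ω := rfl
  rw [dotProduct_scaling_mulVec, hfixed]
  simp_rw [hrandom, scoreCoeff, ← dotProduct_lead h]
  rw [leadMean, dotProduct_smul, dotProduct_smul, dotProduct_sum, smul_smul, Finset.smul_sum,
    ← Finset.sum_add_distrib]
  refine Finset.sum_congr rfl fun i _ => ?_
  rw [blockComb, add_dotProduct, smul_dotProduct, smul_dotProduct, dotProduct_smul,
    div_eq_mul_inv]

theorem dotProduct_Hbar_mulVec (u : Fin p → ℝ) : u ⬝ᵥ (Hbar d F β b t *ᵥ u) =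
    ∑ i : Fin (d.m t), (d.m t : ℝ)⁻¹ * (d.nbar t / d.n t i) * (u ⬝ᵥ (H d F β b t i *ᵥ u)) := by
  rw [Hbar, smul_mulVec, sum_mulVec, dotProduct_smul, dotProduct_sum, Finset.smul_sum]
  refine Finset.sum_congr rfl fun i _ => ?_
  rw [smul_mulVec, dotProduct_smul, smul_eq_mul, smul_eq_mul, mul_assoc]

namespace StageBounds

theorem mul_scoreCoeff_dotProduct_info (h : StageBounds d F β b c₁ C₁ C₂ t)
    (α : Param p (d.m t)) (i : Fin (d.m t)) :
    (d.n t i : ℝ) * F.φ ^ 2 *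
      (scoreCoeff d F β b α i ⬝ᵥ (info d F β b t i *ᵥ scoreCoeff d F β b α i)) =
    (d.n t i : ℝ)⁻¹ * (blockComb d α i ⬝ᵥ (H d F β b t i *ᵥ blockComb d α i)) := by
  have hφ := F.φ_pos.ne'
  have hn := (h.n_pos i).ne'
  rw [scoreCoeff, mulVec_smul, h.info_mulVec_H_mulVec, dotProduct_smul, smul_dotProduct,
    dotProduct_comm (H d F β b t i *ᵥ _), smul_eq_mul, smul_eq_mul]
  field_simp

theorem inv_mul_blockComb_dotProduct_H (h : StageBounds d F β b c₁ C₁ C₂ t)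
    (α : Param p (d.m t)) (i : Fin (d.m t)) :
    (d.n t i : ℝ)⁻¹ * (blockComb d α i ⬝ᵥ (H d F β b t i *ᵥ blockComb d α i)) =
      (d.m t : ℝ)⁻¹ * (d.nbar t / d.n t i) * (α.fixed ⬝ᵥ (H d F β b t i *ᵥ α.fixed)) +
      α.random i ⬝ᵥ (H d F β b t i *ᵥ α.random i) +
      2 * (Real.sqrt (d.N t) / (d.m t * Real.sqrt (d.n t i))) *
        (α.fixed ⬝ᵥ (H d F β b t i *ᵥ α.random i)) := by
  have hm := h.m_pos.ne'
  have hsqrt_n : Real.sqrt (d.n t i) ^ 2 = d.n t i := Real.sq_sqrt (h.n_pos i).le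
  have hsqrt_N : Real.sqrt (d.N t) ^ 2 = d.N t := Real.sq_sqrt (Nat.cast_nonneg _)
  have hs : Real.sqrt (d.n t i) ≠ 0 := (Real.sqrt_pos.2 (h.n_pos i)).ne'
  have hsymm : α.random i ⬝ᵥ (H d F β b t i *ᵥ α.fixed) =
      α.fixed ⬝ᵥ (H d F β b t i *ᵥ α.random i) := by
    rw [dotProduct_mulVec, ← mulVec_transpose, (h.eig i i.2).isSymm.eq, dotProduct_comm]
  rw [blockComb, Design.nbar]
  simp only [mulVec_add, mulVec_smul, dotProduct_add, add_dotProduct, dotProduct_smul,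
    smul_dotProduct, smul_eq_mul, hsymm]
  generalize Real.sqrt (d.n t i) = s at *
  generalize Real.sqrt (d.N t) = S at *
  rw [← hsqrt_n, ← hsqrt_N]
  field_simp
  ring

theorem sum_scoreCoeff_sq_mul_obsVar (h : StageBounds d F β b c₁ C₁ C₂ t)
    (α : Param p (d.m t)) :
    ∑ s : d.Obs t, (scoreCoeff d F β b α s.1 ⬝ᵥ d.x t s.1 s.2) ^ 2 *
      obsVar d F β b t s.1 s.2 = α ⬝ᵥ (blockMatrix d F β b t *ᵥ α) +
      ∑ i : Fin (d.m t), 2 * (Real.sqrt (d.N t) / (d.m t * Real.sqrt (d.n t i))) *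
        (α.fixed ⬝ᵥ (H d F β b t i *ᵥ α.random i)) := by
  rw [sum_weight_sq_mul_obsVar h, dotProduct_blockMatrix_mulVec, dotProduct_Hbar_mulVec,
    ← Finset.sum_add_distrib, ← Finset.sum_add_distrib]
  refine Finset.sum_congr rfl fun i _ => ?_
  rw [h.mul_scoreCoeff_dotProduct_info, h.inv_mul_blockComb_dotProduct_H]

theorem sqrt_N_div_le (h : StageBounds d F β b c₁ C₁ C₂ t) (i : Fin (d.m t)) :
    Real.sqrt (d.N t) / d.m t ≤
      Real.sqrt C₂ * (Real.sqrt (d.m t))⁻¹ * Real.sqrt (d.n t i) := by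
  have hm := h.m_pos
  calc Real.sqrt (d.N t) / d.m t
      ≤ Real.sqrt (C₂ * (d.m t * d.nL t)) / d.m t := by
        gcongr
        exact h.N_le
    _ = Real.sqrt C₂ * Real.sqrt (d.nL t) * (Real.sqrt (d.m t) / d.m t) := by
        rw [Real.sqrt_mul h.C₂_pos.le, Real.sqrt_mul hm.le]
        ring
    _ = Real.sqrt C₂ * (Real.sqrt (d.m t))⁻¹ * Real.sqrt (d.nL t) := by
        rw [Real.sqrt_div_self]
        ring
    _ ≤ Real.sqrt C₂ * (Real.sqrt (d.m t))⁻¹ * Real.sqrt (d.n t i) := by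
        gcongr
        exact_mod_cast nL_le_n d i

theorem norm_blockComb_le (h : StageBounds d F β b c₁ C₁ C₂ t) {α : Param p (d.m t)}
    (hα : ‖α‖ ≤ a) (i : Fin (d.m t)) :
    ‖blockComb d α i‖ ≤ a * (Real.sqrt C₂ + 1) * Real.sqrt (d.n t i) := by
  have hm := h.m_pos
  have hinv : (Real.sqrt (d.m t))⁻¹ ≤ 1 :=
    inv_le_one_of_one_le₀ (Real.one_le_sqrt.2 (by exact_mod_cast h.one_le_m))
  have hratio : Real.sqrt (d.N t) / d.m t ≤ Real.sqrt C₂ * Real.sqrt (d.n t i) := by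
    refine (h.sqrt_N_div_le i).trans ?_
    gcongr
    exact mul_le_of_le_one_right (Real.sqrt_nonneg _) hinv
  calc ‖blockComb d α i‖
      ≤ Real.sqrt (d.N t) / d.m t * ‖α.fixed‖ + Real.sqrt (d.n t i) * ‖α.random i‖ := by
        refine (norm_add_le _ _).trans_eq ?_
        rw [norm_smul, norm_smul, Real.norm_of_nonneg (by positivity),
          Real.norm_of_nonneg (Real.sqrt_nonneg _)]
    _ ≤ Real.sqrt C₂ * Real.sqrt (d.n t i) * a + Real.sqrt (d.n t i) * a := by
        gcongr
        · exact α.norm_fixed_le.trans hα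
        · exact (α.norm_random_le i).trans hα
    _ = a * (Real.sqrt C₂ + 1) * Real.sqrt (d.n t i) := by ring

theorem norm_scoreCoeff_le (h : StageBounds d F β b c₁ C₁ C₂ t) {α : Param p (d.m t)}
    (hα : ‖α‖ ≤ a) (i : Fin (d.m t)) :
    ‖scoreCoeff d F β b α i‖ ≤
      F.φ⁻¹ * (p * c₁⁻¹) * (a * (Real.sqrt C₂ + 1)) * (Real.sqrt (d.nL t))⁻¹ := by
  have hφ := F.φ_pos
  have hc := h.c_pos
  have hn := h.n_pos i
  have ha : 0 ≤ a := (norm_nonneg _).trans hα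
  calc ‖scoreCoeff d F β b α i‖
      ≤ (d.n t i : ℝ)⁻¹ * (F.φ⁻¹ * (p * c₁⁻¹)) *
          (a * (Real.sqrt C₂ + 1) * Real.sqrt (d.n t i)) := by
        refine (h.norm_smul_H_mulVec_le i _).trans ?_
        gcongr
        exact h.norm_blockComb_le hα i
    _ = F.φ⁻¹ * (p * c₁⁻¹) * (a * (Real.sqrt C₂ + 1)) * (Real.sqrt (d.n t i) / d.n t i) := by
        ring
    _ ≤ F.φ⁻¹ * (p * c₁⁻¹) * (a * (Real.sqrt C₂ + 1)) * (Real.sqrt (d.nL t))⁻¹ := by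
        rw [Real.sqrt_div_self]
        have hsqrt := Real.sqrt_pos.2 h.nL_pos
        gcongr
        exact_mod_cast nL_le_n d i

theorem abs_scoreCoeff_dotProduct_le (h : StageBounds d F β b c₁ C₁ C₂ t)
    {α : Param p (d.m t)} (hα : ‖α‖ ≤ a) (s : d.Obs t) :
    |scoreCoeff d F β b α s.1 ⬝ᵥ d.x t s.1 s.2| ≤
      p * (F.φ⁻¹ * (p * c₁⁻¹) * (a * (Real.sqrt C₂ + 1)) * C₁) * (Real.sqrt (d.nL t))⁻¹ := by
  have hcoeff := h.norm_scoreCoeff_le hα s.1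
  have hdot := abs_dotProduct_le (scoreCoeff d F β b α s.1) (d.x t s.1 s.2)
  rw [Fintype.card_fin] at hdot
  calc |scoreCoeff d F β b α s.1 ⬝ᵥ d.x t s.1 s.2|
      ≤ p * ((F.φ⁻¹ * (p * c₁⁻¹) * (a * (Real.sqrt C₂ + 1)) * (Real.sqrt (d.nL t))⁻¹) * C₁) := by
        refine hdot.trans (mul_le_mul_of_nonneg_left ?_ (Nat.cast_nonneg _))
        exact mul_le_mul hcoeff (h.x_le _ s.1.2 _ s.2.2) (norm_nonneg _)
          ((norm_nonneg _).trans hcoeff)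
    _ = _ := by ring

theorem abs_fixed_dotProduct_H_random_le (h : StageBounds d F β b c₁ C₁ C₂ t)
    {α : Param p (d.m t)} (hα : ‖α‖ ≤ a) (i : Fin (d.m t)) :
    |α.fixed ⬝ᵥ (H d F β b t i *ᵥ α.random i)| ≤ p * (a * (p * c₁⁻¹ * a)) := by
  have hc := h.c_pos
  have ha : 0 ≤ a := (norm_nonneg _).trans hα
  have hdot := abs_dotProduct_le α.fixed (H d F β b t i *ᵥ α.random i)
  rw [Fintype.card_fin] at hdot
  refine hdot.trans ?_
  gcongr
  · exact α.norm_fixed_le.trans hα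
  · refine ((h.eig i i.2).norm_mulVec_le h.c_pos _).trans ?_
    gcongr
    exact (α.norm_random_le _).trans hα

theorem abs_sum_cross_le (h : StageBounds d F β b c₁ C₁ C₂ t) {α : Param p (d.m t)}
    (hα : ‖α‖ ≤ a) (hz : ∀ i : Fin (d.m t), m₀ ≤ i → α.random i = 0) :
    |(∑ i : Fin (d.m t), 2 * (Real.sqrt (d.N t) / (d.m t * Real.sqrt (d.n t i))) *
        (α.fixed ⬝ᵥ (H d F β b t i *ᵥ α.random i)))| ≤
      m₀ * (2 * (Real.sqrt C₂ * (Real.sqrt (d.m t))⁻¹) * (p * (a * (p * c₁⁻¹ * a)))) := by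
  have hc := h.c_pos
  have hm := h.m_pos
  have ha : 0 ≤ a := (norm_nonneg _).trans hα
  refine abs_sum_fin_le (by positivity) (fun i hi => by simp [hz i hi]) fun i _ => ?_
  have hratio : Real.sqrt (d.N t) / (d.m t * Real.sqrt (d.n t i)) ≤
      Real.sqrt C₂ * (Real.sqrt (d.m t))⁻¹ := by
    rw [← div_div, div_le_iff₀ (Real.sqrt_pos.2 (h.n_pos i))]
    exact h.sqrt_N_div_le i
  rw [abs_mul, abs_of_nonneg (by positivity)]
  gcongr
  exact h.abs_fixed_dotProduct_H_random_le hα i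

end StageBounds

variable [MeasurableSpace Ω] {P : Measure Ω}

namespace ResponseModel

theorem aemeasurable_lead (hy : ResponseModel d F β b P y) (i : Fin (d.m t)) :
    AEMeasurable (lead d F β b y t i) P := by
  have hscore : AEMeasurable (score d F β b y t i) P :=
    Finset.aemeasurable_fun_sum _ fun j _ =>
      ((hy.law t i i.2 j j.2).aemeasurable.sub_const _).smul_const _
  have hH : Continuous fun v : Fin p → ℝ => H d F β b t i *ᵥ v :=
    continuous_const.matrix_mulVec continuous_id
  exact (hH.measurable.comp_aemeasurable hscore).const_smul ((d.n t i : ℝ) * F.φ)⁻¹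

theorem aemeasurable_leadParam (hy : ResponseModel d F β b P y) (t : ℕ) :
    AEMeasurable (leadParam d F β b y t) P := by
  have hmean : AEMeasurable (leadMean d F β b y t) P :=
    (Finset.aemeasurable_fun_sum _ fun i _ => hy.aemeasurable_lead i).const_smul (d.m t : ℝ)⁻¹
  refine aemeasurable_pi_lambda _ ?_
  rintro ⟨k, _ | i⟩
  · exact (measurable_pi_apply k).comp_aemeasurable hmean
  · exact (measurable_pi_apply k).comp_aemeasurable (hy.aemeasurable_lead i)

end ResponseModel

variable [IsProbabilityMeasure P]

theorem tendsto_charFun_dotProduct_leadParam (hreg : d.Regime) (hF : CurvatureBounds F c₀)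
    (h3 : Cond3 d F β b) (hst : ∀ᶠ t in atTop, StageBounds d F β b c₁ C₁ C₂ t)
    (hy : ResponseModel d F β b P y) {σ : ℝ} {α : ∀ t, Param p (d.m t)}
    (hα : ∀ᶠ t in atTop, ‖α t‖ ≤ a)
    (hz : ∀ᶠ t in atTop, ∀ i : Fin (d.m t), m₀ ≤ i → (α t).random i = 0)
    (hσ : Tendsto (fun t => α t ⬝ᵥ (blockMatrix d F β b t *ᵥ α t)) atTop (𝓝 σ)) :
    Tendsto (fun t => charFun (P.map fun ω =>
        α t ⬝ᵥ (scaling d t *ᵥ leadParam d F β b y t ω)) 1)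
      atTop (𝓝 (Real.exp (-(σ / 2)) : ℂ)) := by
  obtain ⟨ε, hε, hint⟩ := h3.interior
  have hmax : ∀ δ > 0, ∀ᶠ t in atTop, ∀ s : d.Obs t,
      |scoreCoeff d F β b (α t) s.1 ⬝ᵥ d.x t s.1 s.2| ≤ δ := by
    intro δ hδ
    have hlim := (tendsto_inv_sqrt_natCast hreg.nL_tendsto).const_mul
      (p * (F.φ⁻¹ * (p * c₁⁻¹) * (a * (Real.sqrt C₂ + 1)) * C₁))
    rw [mul_zero] at hlim
    filter_upwards [hst, hα, hlim.eventually_lt_const hδ] with t h ht hlt s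
    exact (h.abs_scoreCoeff_dotProduct_le ht s).trans hlt.le
  have hcross : Tendsto (fun t => ∑ i : Fin (d.m t),
      2 * (Real.sqrt (d.N t) / (d.m t * Real.sqrt (d.n t i))) *
        ((α t).fixed ⬝ᵥ (H d F β b t i *ᵥ (α t).random i))) atTop (𝓝 0) := by
    have hlim : Tendsto (fun t => m₀ * (2 * (Real.sqrt C₂ * (Real.sqrt (d.m t))⁻¹) *
        (p * (a * (p * c₁⁻¹ * a))))) atTop (𝓝 0) := by
      simpa only [mul_zero, zero_mul] using ((((tendsto_inv_sqrt_natCast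
        hreg.m_tendsto).const_mul (Real.sqrt C₂)).const_mul 2).mul_const
          (p * (a * (p * c₁⁻¹ * a)))).const_mul (m₀ : ℝ)
    refine squeeze_zero_norm' ?_ hlim
    filter_upwards [hst, hα, hz] with t h ht hzt
    exact h.abs_sum_cross_le ht hzt
  have hvar := hσ.add hcross
  rw [add_zero] at hvar
  have hclt := hy.tendsto_charFun_sum_mul_resid hF hε hint hmax (hvar.congr' (by
    filter_upwards [hst] with t h
    exact (h.sum_scoreCoeff_sq_mul_obsVar (α t)).symm)) 1
  rw [one_pow, one_mul] at hclt
  refine hclt.congr' ?_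
  filter_upwards [hst] with t h
  simp_rw [dotProduct_scaling_leadParam h, sum_dotProduct_score]

end LeadingTerm

section SelectionLaw

variable {p q : ℕ} {d : Design p} {F : ExpFamily} {β : Fin p → ℝ}
  {b : ℕ → EuclideanSpace ℝ (Fin p)} {Ω : Type*} {y : ℕ → ℕ → ℕ → Ω → ℝ} {c₀ c₁ C₁ C₂ a : ℝ}
  {A : ∀ t, Matrix (Fin q) (Fin p × Option (Fin (d.m t))) ℝ}
  {L : Option ℕ → Matrix (Fin q) (Fin p) ℝ} {t m₀ : ℕ}

theorem abs_dotProduct_scaling_le {B₀ B₁ : ℝ} {α δ : Param p (d.m t)} (hα : ‖α‖ ≤ a)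
    (hB₁ : 0 ≤ B₁) (hz : ∀ i : Fin (d.m t), m₀ ≤ i → α.random i = 0)
    (hfixed : Real.sqrt (d.N t) * ‖δ.fixed‖ ≤ B₀)
    (hrandom : ∀ i : Fin (d.m t), (i : ℕ) < m₀ → Real.sqrt (d.n t i) * ‖δ.random i‖ ≤ B₁) :
    |α ⬝ᵥ (scaling d t *ᵥ δ)| ≤ p * (a * B₀) + m₀ * (p * (a * B₁)) := by
  have ha : 0 ≤ a := (norm_nonneg _).trans hα
  have hdot {u v : Fin p → ℝ} {s B : ℝ} (hs : 0 ≤ s) (hu : ‖u‖ ≤ a) (hv : s * ‖v‖ ≤ B) :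
      |u ⬝ᵥ (s • v)| ≤ p * (a * B) := by
    refine (abs_dotProduct_le u (s • v)).trans ?_
    rw [Fintype.card_fin, norm_smul, Real.norm_of_nonneg hs]
    gcongr
  rw [dotProduct_scaling_mulVec]
  refine (abs_add_le _ _).trans (add_le_add ?_ ?_)
  · exact hdot (Real.sqrt_nonneg _) (α.norm_fixed_le.trans hα) hfixed
  · refine abs_sum_fin_le (by positivity) (fun i hi => ?_) fun i hi => ?_
    · rw [hz i hi, zero_dotProduct]
    · exact hdot (Real.sqrt_nonneg _) ((α.norm_random_le i).trans hα) (hrandom i hi)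

theorem norm_toLp_le_sum (u : Fin q → ℝ) : ‖WithLp.toLp 2 u‖ ≤ ∑ r, |u r| := by
  rw [EuclideanSpace.norm_eq]
  refine Real.sqrt_le_iff.2 ⟨Finset.sum_nonneg fun _ _ => abs_nonneg _, ?_⟩
  exact Finset.sum_sq_le_sq_sum_of_nonneg fun _ _ => abs_nonneg _

theorem norm_vecMul_le {n : Type*} [Fintype n] {M : Matrix (Fin q) n ℝ} (hM : ∀ r, ‖M r‖ ≤ a)
    (w : Fin q → ℝ) : ‖w ᵥ* M‖ ≤ (∑ r, |w r|) * a := by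
  rw [vecMul_eq_sum, Finset.sum_mul]
  refine (norm_sum_le _ _).trans (Finset.sum_le_sum fun r _ => ?_)
  rw [norm_smul, Real.norm_eq_abs]
  exact mul_le_mul_of_nonneg_left (hM r) (abs_nonneg _)

theorem random_vecMul (w : Fin q → ℝ) {m : ℕ} (M : Matrix (Fin q) (Fin p × Option (Fin m)) ℝ)
    (i : Fin m) : Param.random (w ᵥ* M) i = w ᵥ* block M (some i) := by
  ext k
  simp [block, entry, Param.random, vecMul, dotProduct]

theorem dotProduct_mul_mul_transpose_mulVec {n : Type*} [Fintype n] (w : Fin q → ℝ)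
    (M : Matrix (Fin q) n ℝ) (B : Matrix n n ℝ) :
    w ⬝ᵥ ((M * B * Mᵀ) *ᵥ w) = (w ᵥ* M) ⬝ᵥ (B *ᵥ (w ᵥ* M)) := by
  rw [← mulVec_mulVec, ← mulVec_mulVec, mulVec_transpose, dotProduct_mulVec]

theorem charFun_multivariateGaussian_zero {S : Matrix (Fin q) (Fin q) ℝ} (hS : S.PosSemidef)
    (v : EuclideanSpace ℝ (Fin q)) : charFun (multivariateGaussian 0 S) v =
      (Real.exp (-((v.ofLp ⬝ᵥ (S *ᵥ v.ofLp)) / 2)) : ℂ) := by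
  rw [charFun_multivariateGaussian hS]
  simp

theorem fixed_sub_target_sub_leadParam (hm : 0 < d.m t) {θ : Param p (d.m t)}
    (hθ : ∑ i, θ.random i = 0) (ω : Ω) :
    (θ - target d β b t - leadParam d F β b y t ω : Param p (d.m t)).fixed =
      devMean d β b θ - leadMean d F β b y t ω := by
  ext k
  exact congrArg (· - leadMean d F β b y t ω k) (sub_target_fixed hm hθ k)

theorem random_sub_target_sub_leadParam (hm : 0 < d.m t) {θ : Param p (d.m t)}
    (hθ : ∑ i, θ.random i = 0) (ω : Ω) (i : Fin (d.m t)) :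
    (θ - target d β b t - leadParam d F β b y t ω : Param p (d.m t)).random i =
      dev d β b θ i - lead d F β b y t i ω - devMean d β b θ := by
  ext k
  exact (congrArg (· - lead d F β b y t i ω k) (sub_target_random hm hθ k i)).trans
    (sub_right_comm _ _ _)

variable (p d) in
/-- The bound on the error of the leading-term approximation of a linear combination of the scaled
estimation errors; `a` bounds the coefficients, those of the random effects vanish from cluster `m₀`
on, and `C`, `C₂`, `B` are the constants of `ErrorBounds`, `StageBounds` and the centred effects. -/
def approxBound (a : ℝ) (m₀ : ℕ) (C C₂ B : ℝ) (t : ℕ) : ℝ :=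
  p * (a * (C * Real.sqrt (C₂ * ((d.m t : ℝ) / d.nL t)))) +
    m₀ * (p * (a * (Real.sqrt C₂ * (C * (1 + B) ^ 2 * (Real.sqrt (d.nL t))⁻¹ +
      C * (Real.sqrt (d.nL t))⁻¹ + Real.sqrt C * (Real.sqrt (d.m t))⁻¹))))

namespace ErrorBounds

theorem abs_dotProduct_scaling_sub_leadParam_le {C B : ℝ} {ω : Ω} {α θ : Param p (d.m t)}
    (e : ErrorBounds d F β b y m₀ C t ω θ) (h : StageBounds d F β b c₁ C₁ C₂ t) (hC : 0 ≤ C)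
    (hB : ∀ i < m₀, ‖centred d b t i‖ ≤ B) (hα : ‖α‖ ≤ a)
    (hz : ∀ i : Fin (d.m t), m₀ ≤ i → α.random i = 0) :
    |α ⬝ᵥ (scaling d t *ᵥ (θ - target d β b t - leadParam d F β b y t ω))| ≤
      approxBound p d a m₀ C C₂ B t := by
  refine abs_dotProduct_scaling_le hα (by positivity) hz ?_ fun i hi => ?_
  · rw [fixed_sub_target_sub_leadParam h.one_le_m e.sum_random]
    exact e.sqrt_N_mul_norm_le h
  · rw [random_sub_target_sub_leadParam h.one_le_m e.sum_random]
    exact e.sqrt_n_mul_norm_le h hC hi (hB i hi)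

end ErrorBounds

theorem tendsto_approxBound (hreg : d.Regime) (a : ℝ) (m₀ : ℕ) (C C₂ B : ℝ) :
    Tendsto (approxBound p d a m₀ C C₂ B) atTop (𝓝 0) := by
  unfold approxBound
  have hnL := tendsto_inv_sqrt_natCast hreg.nL_tendsto
  have hm := tendsto_inv_sqrt_natCast hreg.m_tendsto
  have hfixed := (((tendsto_sqrt_mul_ratio hreg C₂).const_mul C).const_mul a).const_mul (p : ℝ)
  have hrandom := (((((hnL.const_mul (C * (1 + B) ^ 2)).add (hnL.const_mul C)).add
    (hm.const_mul (Real.sqrt C))).const_mul (Real.sqrt C₂)).const_mul a).const_mul (p : ℝ)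
  simpa only [mul_zero, add_zero] using hfixed.add (hrandom.const_mul (m₀ : ℝ))

variable [MeasurableSpace Ω] {P : Measure Ω}

theorem charFun_map_toLp {T : Ω → Fin q → ℝ} (hT : AEMeasurable T P)
    (v : EuclideanSpace ℝ (Fin q)) :
    charFun (P.map fun ω => WithLp.toLp 2 (T ω)) v = charFun (P.map fun ω => v.ofLp ⬝ᵥ T ω) 1 := by
  have hT_toLp : AEMeasurable (fun ω => WithLp.toLp 2 (T ω)) P :=
    (PiLp.continuous_toLp 2 _).measurable.comp_aemeasurable hT
  have hdot : Continuous fun u : Fin q → ℝ => v.ofLp ⬝ᵥ u :=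
    continuous_const.dotProduct continuous_id
  have hT_dot : AEMeasurable (fun ω => v.ofLp ⬝ᵥ T ω) P := hdot.measurable.comp_aemeasurable hT
  rw [charFun_apply, charFun_apply, integral_map hT_toLp (by fun_prop),
    integral_map hT_dot (by fun_prop)]
  simp [EuclideanSpace.inner_eq_star_dotProduct]

variable [IsProbabilityMeasure P]

namespace FiniteSelection

/- By Lévy's continuity theorem it suffices to treat the inner products with a fixed vector `v`,
which are linear combinations of the leading terms with coefficients `v ᵥ* A t`. -/
theorem tendstoInDistribution_leadParam (hA : FiniteSelection d A L) (hreg : d.Regime)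
    (hF : CurvatureBounds F c₀) (h3 : Cond3 d F β b)
    (hst : ∀ᶠ t in atTop, StageBounds d F β b c₁ C₁ C₂ t) (hy : ResponseModel d F β b P y)
    {S : Matrix (Fin q) (Fin q) ℝ} (hS : S.PosSemidef)
    (hlim : Tendsto (fun t => A t * blockMatrix d F β b t * (A t)ᵀ) atTop (𝓝 S)) :
    TendstoInDistribution
      (fun t ω => WithLp.toLp 2 (A t *ᵥ (scaling d t *ᵥ leadParam d F β b y t ω)))
      atTop (id : EuclideanSpace ℝ (Fin q) → EuclideanSpace ℝ (Fin q)) (fun _ => P)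
      (multivariateGaussian 0 S) := by
  have hT (t : ℕ) : AEMeasurable
      (fun ω => A t *ᵥ (scaling d t *ᵥ leadParam d F β b y t ω)) P := by
    have hc : Continuous fun u : Param p (d.m t) => A t *ᵥ (scaling d t *ᵥ u) :=
      continuous_const.matrix_mulVec (continuous_const.matrix_mulVec continuous_id)
    exact hc.measurable.comp_aemeasurable (hy.aemeasurable_leadParam t)
  refine ⟨fun t => (PiLp.continuous_toLp 2 _).measurable.comp_aemeasurable (hT t),
    aemeasurable_id, ProbabilityMeasure.tendsto_iff_tendsto_charFun.2 fun v => ?_⟩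
  obtain ⟨m₀, hm₀⟩ := hA.exists_block_eq_zero
  obtain ⟨a, -, hrow⟩ := hA.exists_norm_row_le hreg.m_tendsto
  have hσ : Tendsto (fun t => (v.ofLp ᵥ* A t) ⬝ᵥ (blockMatrix d F β b t *ᵥ (v.ofLp ᵥ* A t)))
      atTop (𝓝 (v.ofLp ⬝ᵥ (S *ᵥ v.ofLp))) := by
    have hc : Continuous fun M : Matrix (Fin q) (Fin q) ℝ => v.ofLp ⬝ᵥ (M *ᵥ v.ofLp) :=
      continuous_const.dotProduct (continuous_id.matrix_mulVec continuous_const)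
    exact ((hc.tendsto S).comp hlim).congr fun t => dotProduct_mul_mul_transpose_mulVec _ _ _
  have hα : ∀ᶠ t in atTop, ‖v.ofLp ᵥ* A t‖ ≤ (∑ r, |v.ofLp r|) * a :=
    hrow.mono fun t ht => norm_vecMul_le ht _
  have hz : ∀ᶠ t in atTop, ∀ i : Fin (d.m t), m₀ ≤ i → Param.random (v.ofLp ᵥ* A t) i = 0 := by
    filter_upwards [hreg.m_tendsto.eventually_gt_atTop m₀] with t hmt i hi
    rw [random_vecMul, hm₀ t hmt i hi, vecMul_zero]
  rw! [Measure.map_id]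
  simp only [ProbabilityMeasure.coe_mk]
  rw [charFun_multivariateGaussian_zero hS]
  refine (tendsto_charFun_dotProduct_leadParam hreg hF h3 hst hy hα hz hσ).congr fun t => ?_
  rw [charFun_map_toLp (hT t)]
  simp_rw [dotProduct_mulVec]

variable {Ghat : ℕ → Ω → Matrix (Fin p) (Fin p) ℝ} {φhat : ℕ → Ω → ℝ}
  {θhat : ∀ t, Ω → Param p (d.m t)}

theorem tendstoInMeasure_sub_leadParam (hA : FiniteSelection d A L)
    (hreg : d.Regime) (hF : CurvatureBounds F c₀) (h3 : Cond3 d F β b)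
    (hst : ∀ᶠ t in atTop, StageBounds d F β b c₁ C₁ C₂ t)
    (hy : ResponseModel d F β b P y) (h4 : Cond4 P Ghat φhat)
    (hθ : Tendsto (fun t => P {ω | ¬ IsPQLEstimate d F (fun i j => y t i j ω)
        (Ghat t ω) (φhat t ω) (θhat t ω)}) atTop (𝓝 0)) :
    TendstoInMeasure P (fun t ω => ‖WithLp.toLp 2 (A t *ᵥ (scaling d t *ᵥ
      (θhat t ω - target d β b t - leadParam d F β b y t ω)))‖) atTop (fun _ => 0) := by
  obtain ⟨Cb, hCb⟩ := h3.effects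
  obtain ⟨m₀, hm₀⟩ := hA.exists_block_eq_zero
  obtain ⟨a, -, hrow⟩ := hA.exists_norm_row_le hreg.m_tendsto
  refine tendstoInMeasure_of_errorBounds hreg hF h3 hst hy h4 hθ m₀ fun C hC δ hδ => ?_
  have hbound := (tendsto_approxBound hreg a m₀ C C₂
    (∑ i ∈ Finset.range m₀, ‖b i‖ + Cb)).const_mul (q : ℝ)
  rw [mul_zero] at hbound
  filter_upwards [hst, hrow, hreg.m_tendsto.eventually_gt_atTop m₀,
    hbound.eventually_lt_const hδ] with t h hrow_t hmt hlt ω e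
  rw [abs_norm]
  refine ((norm_toLp_le_sum _).trans ?_).trans_lt hlt
  have hcentred (i : ℕ) (hi : i < m₀) :
      ‖centred d b t i‖ ≤ ∑ i ∈ Finset.range m₀, ‖b i‖ + Cb :=
    (norm_centred_le hCb h.one_le_m i).trans (add_le_add_left (Finset.single_le_sum
      (f := fun i => ‖b i‖) (fun _ _ => norm_nonneg _) (Finset.mem_range.2 hi)) Cb)
  suffices hentry : ∀ r, |(A t r) ⬝ᵥ (scaling d t *ᵥ
      (θhat t ω - target d β b t - leadParam d F β b y t ω))| ≤
        approxBound p d a m₀ C C₂ (∑ i ∈ Finset.range m₀, ‖b i‖ + Cb) t by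
    refine (Finset.sum_le_sum fun r _ => hentry r).trans_eq ?_
    rw [Finset.sum_const, Finset.card_univ, Fintype.card_fin, nsmul_eq_mul]
  intro r
  refine e.abs_dotProduct_scaling_sub_leadParam_le h hC hcentred (hrow_t r) fun i hi => ?_
  rw [← block_some, hm₀ t hmt i hi]
  rfl

theorem tendstoInDistribution (hA : FiniteSelection d A L)
    (hreg : d.Regime) (hF : CurvatureBounds F c₀) (h3 : Cond3 d F β b)
    (hst : ∀ᶠ t in atTop, StageBounds d F β b c₁ C₁ C₂ t)
    (hy : ResponseModel d F β b P y) (h4 : Cond4 P Ghat φhat) (hmeas : ∀ t, Measurable (θhat t))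
    (hθ : Tendsto (fun t => P {ω | ¬ IsPQLEstimate d F (fun i j => y t i j ω)
        (Ghat t ω) (φhat t ω) (θhat t ω)}) atTop (𝓝 0))
    {S : Matrix (Fin q) (Fin q) ℝ} (hS : S.PosSemidef)
    (hlim : Tendsto (fun t => A t * blockMatrix d F β b t * (A t)ᵀ) atTop (𝓝 S)) :
    TendstoInDistribution
      (fun t ω => WithLp.toLp 2 (A t *ᵥ (scaling d t *ᵥ (θhat t ω - target d β b t))))
      atTop (id : EuclideanSpace ℝ (Fin q) → EuclideanSpace ℝ (Fin q)) (fun _ => P)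
      (multivariateGaussian 0 S) := by
  refine tendstoInDistribution_of_tendstoInMeasure_sub _ _
    (hA.tendstoInDistribution_leadParam hreg hF h3 hst hy hS hlim) ?_ fun t => ?_
  · have hsub := hA.tendstoInMeasure_sub_leadParam hreg hF h3 hst hy h4 hθ
    rw [tendstoInMeasure_iff_norm] at hsub ⊢
    simpa [mulVec_sub] using hsub
  · have hc : Continuous fun u : Param p (d.m t) =>
        WithLp.toLp 2 (A t *ᵥ (scaling d t *ᵥ (u - target d β b t))) :=
      (PiLp.continuous_toLp 2 _).comp (continuous_const.matrix_mulVec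
        (continuous_const.matrix_mulVec (continuous_id.sub continuous_const)))
    exact (hc.measurable.comp (hmeas t)).aemeasurable

end FiniteSelection

end SelectionLaw

end PQL

end

theorem theorem1_general {p : ℕ} (d : PQL.Design p) (F : PQL.ExpFamily) (β : Fin p → ℝ)
    (hreg : d.Regime) (hC1 : PQL.Cond1 F) :
    (F.dom = Set.univ → ∀ (μ : Measure (EuclideanSpace ℝ (Fin p))) [IsProbabilityMeasure μ],
      Integrable id μ → ∀ᵐ b ∂(Measure.infinitePi fun _ : ℕ => μ), PQL.Cond3 d F β b) ∧
    ∀ (b : ℕ → EuclideanSpace ℝ (Fin p)) (_ : PQL.Cond3 d F β b)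
      (K₀ : Matrix (Fin p) (Fin p) ℝ) (K : ℕ → Matrix (Fin p) (Fin p) ℝ)
      (_ : PQL.Cond2 d F β b K₀ K)
      {Ω : Type*} [MeasurableSpace Ω] (P : Measure Ω) [IsProbabilityMeasure P]
      (y : ℕ → ℕ → ℕ → Ω → ℝ) (_ : PQL.ResponseModel d F β b P y)
      (Ghat : ℕ → Ω → Matrix (Fin p) (Fin p) ℝ) (φhat : ℕ → Ω → ℝ)
      (_ : PQL.Cond4 P Ghat φhat)
      (θhat : ∀ t, Ω → PQL.Param p (d.m t)) (_ : ∀ t, Measurable (θhat t))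
      (_ : Tendsto (fun t => P {ω | ¬ PQL.IsPQLEstimate d F (fun i j => y t i j ω)
        (Ghat t ω) (φhat t ω) (θhat t ω)}) atTop (𝓝 0)),
      TendstoInMeasure P (fun t ω => ‖θhat t ω - PQL.target d β b t‖) atTop (fun _ => 0) ∧
      ∀ (q : ℕ) (A : ∀ t, Matrix (Fin q) (Fin p × Option (Fin (d.m t))) ℝ)
        (L : Option ℕ → Matrix (Fin q) (Fin p) ℝ) (_ : PQL.FiniteSelection d A L),
        ∃ Om : Matrix (Fin q) (Fin q) ℝ,
          Om.PosSemidef ∧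
          Tendsto (fun t => A t * PQL.blockMatrix d F β b t * (A t)ᵀ) atTop (𝓝 Om) ∧
          Om = L none * K₀ * (L none)ᵀ + ∑ᶠ i : ℕ, L (some i) * K i * (L (some i))ᵀ ∧
          TendstoInDistribution
            (fun t ω => WithLp.toLp 2
              (A t *ᵥ (PQL.scaling d t *ᵥ (θhat t ω - PQL.target d β b t))))
            atTop (id : EuclideanSpace ℝ (Fin q) → EuclideanSpace ℝ (Fin q)) (fun _ => P)
            (multivariateGaussian 0 Om) := by
  obtain ⟨c₀, hF⟩ := hC1.exists_curvatureBounds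
  refine ⟨fun hdom μ _ hμ => PQL.ae_cond3_of_integrable d β hdom hμ, ?_⟩
  intro b h3 K₀ K h2 Ω _ P _ y hy Ghat φhat h4 θhat hmeas hθ
  obtain ⟨c₁, C₁, C₂, hst⟩ := PQL.eventually_stageBounds hreg h2 h3
  refine ⟨PQL.tendstoInMeasure_norm_sub_target hreg hF h3 hst hy h4 hθ, fun q A L hA => ?_⟩
  obtain ⟨c, hc, -, hK, hK₀⟩ := h2.eigenvalues
  have hOm := PQL.posSemidef_limitCov L (hK₀.posDef hc).posSemidef
    fun i => ((hK i).posDef hc).posSemidef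
  have hlim := hA.tendsto_mul_blockMatrix_mul_transpose hreg.m_tendsto h2
  exact ⟨_, hOm, hlim, rfl,
    hA.tendstoInDistribution hreg hF h3 hst hy h4 hmeas hθ hOm hlim⟩

theorem theorem1 {p : ℕ} (d : PQL.Design p) (F : PQL.ExpFamily) (β : Fin p → ℝ)
    (hreg : d.Regime) (hC1 : PQL.Cond1 F) :
    -- if the domain of `a` is the real line, `Cond3` holds for almost every realisation of the
    -- i.i.d. `N(0, G)` random effects
    (F.dom = Set.univ → ∀ G : Matrix (Fin p) (Fin p) ℝ, G.PosSemidef →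
      ∀ᵐ b ∂(Measure.infinitePi fun _ : ℕ => multivariateGaussian (0 : EuclideanSpace ℝ (Fin p)) G),
        PQL.Cond3 d F β b) ∧
    -- the conditional regime: `b` is the given sequence of true random effects, and `P` is the
    -- distribution of the data given `b`
    ∀ (b : ℕ → EuclideanSpace ℝ (Fin p)) (_ : PQL.Cond3 d F β b)
      (K₀ : Matrix (Fin p) (Fin p) ℝ) (K : ℕ → Matrix (Fin p) (Fin p) ℝ)
      (_ : PQL.Cond2 d F β b K₀ K)
      {Ω : Type*} [MeasurableSpace Ω] (P : Measure Ω) [IsProbabilityMeasure P]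
      (y : ℕ → ℕ → ℕ → Ω → ℝ) (_ : PQL.ResponseModel d F β b P y)
      (Ghat : ℕ → Ω → Matrix (Fin p) (Fin p) ℝ) (φhat : ℕ → Ω → ℝ)
      (_ : PQL.Cond4 P Ghat φhat) (_ : PQL.Cond5 d F β b P y Ghat φhat)
      (θhat : ∀ t, Ω → PQL.Param p (d.m t)) (_ : ∀ t, Measurable (θhat t))
      (_ : Tendsto (fun t => P {ω | ¬ PQL.IsPQLEstimate d F (fun i j => y t i j ω)
        (Ghat t ω) (φhat t ω) (θhat t ω)}) atTop (𝓝 0)),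
      -- (a) consistency in maximum norm
      TendstoInMeasure P (fun t ω => ‖θhat t ω - PQL.target d β b t‖) atTop (fun _ => 0) ∧
      -- (b) asymptotic normality of finite selections
      ∀ (q : ℕ) (A : ∀ t, Matrix (Fin q) (Fin p × Option (Fin (d.m t))) ℝ)
        (L : Option ℕ → Matrix (Fin q) (Fin p) ℝ) (_ : PQL.FiniteSelection d A L),
        ∃ Om : Matrix (Fin q) (Fin q) ℝ,
          Om.PosSemidef ∧
          Tendsto (fun t => A t * PQL.blockMatrix d F β b t * (A t)ᵀ) atTop (𝓝 Om) ∧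
          Om = L none * K₀ * (L none)ᵀ + ∑ᶠ i : ℕ, L (some i) * K i * (L (some i))ᵀ ∧
          TendstoInDistribution
            (fun t ω => WithLp.toLp 2
              (A t *ᵥ (PQL.scaling d t *ᵥ (θhat t ω - PQL.target d β b t))))
            atTop (id : EuclideanSpace ℝ (Fin q) → EuclideanSpace ℝ (Fin q)) (fun _ => P)
            (multivariateGaussian 0 Om) := by
  have h := theorem1_general d F β hreg hC1
  exact ⟨fun hdom G _ => h.1 hdom _ IsGaussian.integrable_id,
    fun b h3 K₀ K h2 _ _ P _ y hy Ghat φhat h4 _ => h.2 b h3 K₀ K h2 P y hy Ghat φhat h4⟩
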